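/- Let $G$ be a noncompact connected Lie group with identity $e$, let $\rho$ be a right Haar measure on $G$, let $\chi\colon G\to(0,\infty)$ be a continuous positive character (a continuous group homomorphism), and let $\mu_\chi$ be the measure with density $\chi$ with respect to $\rho$. Let $\mathbf X=\{X_1,\dots,X_\ell\}$ be a family of linearly independent left-invariant vector fields on $G$ satisfying Hörmander's condition (they generate the Lie algebra of $G$), let $d_C$ be the associated left-invariant Carnot–Carathéodory distance, and for $r>0$ let $B_r=\{x\in G: d_C(x,e)<r\}$. Write $\nabla u=(X_1u,\dots,X_\ell u)$, $|\nabla u|=\big(\sum_{j=1}^\ell (X_ju)^2\big)^{1/2}$, and $$\Delta_\chi=-\sum_{j=1}^{\ell}\big(X_j^2+(X_j\chi)(e)\,X_j\big).$$ Let $M\in L^1(\mu_\chi)$ be a positive function of class $C^2$ on $G$, let $v=-\log M$, and let $\mu_{\chi,M}$ be the finite measure with density $M$ with respect to $\mu_\chi$. Let $$L^2_1(\mu_{\chi,M})=\{f\in L^2(\mu_{\chi,M}) : |\nabla f|\in L^2(\mu_{\chi,M})\},$$ where $f$ is real-valued and the derivatives $X_jf$ are meant in the distributional sense, and for $f\in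 L^2_1(\mu_{\chi,M})$ let $f_{\chi,M}=\frac{1}{\mu_{\chi,M}(G)}\int_G f\,d\mu_{\chi,M}$. Suppose that there exist $c>0$, $R>0$ and $\epsilon\in(0,1)$ such that $$\frac{1-\epsilon}{2}\,|\nabla v|^2(x)+\Delta_\chi v(x)\ \ge\ c\qquad\text{for all } x\in G\setminus B_R .$$ Then there exists $C>0$ such that for all $f\in L^2_1(\mu_{\chi,M})$ $$\big\|\,|f-f_{\chi,M}|\,(1+|\nabla v|)\,\big\|_{L^2(\mu_{\chi,M})}\ \le\ C\,\big\|\,|\nabla f|\,\big\|_{L^2(\mu_{\chi,M})}.$$ -/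

import Mathlib

open scoped Manifold ContDiff ENNReal
open MeasureTheory

noncomputable section

namespace LiePoincare

section Defs

variable {E : Type*} [NormedAddCommGroup E] [NormedSpace ℝ E]
  {G : Type*} [TopologicalSpace G] [ChartedSpace E G] [Group G]

instance : ENat.LEInfty (minSmoothness ℝ 3) := ⟨by
  simp only [minSmoothness_of_isRCLikeNormedField]
  exact WithTop.coe_le_coe.2 (le_top : (3 : ℕ∞) ≤ ⊤)⟩

/-- The derivative `Z u` of a function `u` along the left-invariant vector field on `G` whose value
at the identity is `Z`. -/
def lieDeriv (Z : GroupLieAlgebra 𝓘(ℝ, E) G) (u : G → ℝ) (x : G) : ℝ :=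
  (mfderiv 𝓘(ℝ, E) 𝓘(ℝ, ℝ) u x : E →L[ℝ] ℝ) (mulInvariantVectorField Z x)

variable {ℓ : ℕ} (X : Fin ℓ → GroupLieAlgebra 𝓘(ℝ, E) G)

/-- Hörmander's condition: the `Xⱼ` generate the Lie algebra of `G`. -/
def HormanderCondition [FiniteDimensional ℝ E] [LieGroup 𝓘(ℝ, E) ∞ G] : Prop :=
  haveI : CompleteSpace E := FiniteDimensional.complete ℝ E
  LieSubalgebra.lieSpan ℝ (GroupLieAlgebra 𝓘(ℝ, E) G) (Set.range X) = ⊤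

/-- The horizontal gradient `∇u = (X₁ u, …, X_ℓ u)` of a differentiable function; its Euclidean
norm is `|∇u| = (∑ⱼ (Xⱼ u)²)^{1/2}`. -/
def horGrad (u : G → ℝ) (x : G) : EuclideanSpace ℝ (Fin ℓ) :=
  WithLp.toLp 2 fun j => lieDeriv (X j) u x

/-- The sub-Laplacian with drift `Δ_χ u = -∑ⱼ (Xⱼ² u + (Xⱼ χ)(e) Xⱼ u)`. -/
def subLaplacian (χ : G → ℝ) (u : G → ℝ) (x : G) : ℝ :=
  -∑ j, (lieDeriv (X j) (lieDeriv (X j) u) x + lieDeriv (X j) χ 1 * lieDeriv (X j) u x)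

/-- `γ : [0,1] → G` is an absolutely continuous horizontal curve with (integrable) coordinates `a`:
`γ'(t) = ∑ⱼ aⱼ(t) Xⱼ(γ(t))` for almost every `t ∈ [0,1]`. Absolute continuity of a continuous curve
in a manifold is tested by composing it with smooth real functions. -/
structure IsHorizontalCurve (γ : ℝ → G) (a : ℝ → EuclideanSpace ℝ (Fin ℓ)) : Prop where
  continuousOn : ContinuousOn γ (Set.Icc 0 1)
  absolutelyContinuous : ∀ φ : G → ℝ, ContMDiff 𝓘(ℝ, E) 𝓘(ℝ, ℝ) ∞ φ →
    AbsolutelyContinuousOnInterval (φ ∘ γ) 0 1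
  integrableOn : IntegrableOn a (Set.Icc 0 1)
  hasMFDerivAt : ∀ᵐ t ∂(volume.restrict (Set.Icc (0 : ℝ) 1)),
    HasMFDerivAt 𝓘(ℝ, ℝ) 𝓘(ℝ, E) γ t
      ((1 : ℝ →L[ℝ] ℝ).smulRight (∑ j, a t j • (mulInvariantVectorField (X j) (γ t) : E)))

/-- The Carnot–Carathéodory distance: the infimum of the lengths `∫₀¹ (∑ⱼ aⱼ(t)²)^{1/2} dt` of the
horizontal curves from `x` to `y`. -/
def ccDist (x y : G) : ℝ≥0∞ :=
  ⨅ (γ : ℝ → G) (a : ℝ → EuclideanSpace ℝ (Fin ℓ))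
    (_ : IsHorizontalCurve X γ a ∧ γ 0 = x ∧ γ 1 = y), ∫⁻ t in Set.Icc (0 : ℝ) 1, ‖a t‖ₑ

/-- The open Carnot–Carathéodory ball `B_r` centred at the identity. -/
def ccBall (r : ℝ) : Set G := {x | ccDist X x 1 < ENNReal.ofReal r}

variable [MeasurableSpace G] (ρ : Measure G)

/-- The measure `μ_χ` with density `χ` with respect to `ρ`. -/
def muChi (χ : G → ℝ) : Measure G := ρ.withDensity fun x => ENNReal.ofReal (χ x)

/-- The measure `μ_{χ,M}` with density `M` with respect to `μ_χ`. -/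
def muChiM (χ M : G → ℝ) : Measure G := (muChi ρ χ).withDensity fun x => ENNReal.ofReal (M x)

/-- `g = (g₁, …, g_ℓ)` is the distributional horizontal gradient `∇f` of `f`, that is,
`∫ f (Xⱼ φ) dρ = -∫ gⱼ φ dρ` for every test function `φ`; left-invariant vector fields are
skew-symmetric with respect to a right Haar measure `ρ`. -/
structure IsWeakHorGrad (f : G → ℝ) (g : G → EuclideanSpace ℝ (Fin ℓ)) : Prop where
  locallyIntegrable : LocallyIntegrable f ρ
  locallyIntegrable_grad : LocallyIntegrable g ρ
  integral_eq : ∀ φ : G → ℝ, ContMDiff 𝓘(ℝ, E) 𝓘(ℝ, ℝ) ∞ φ → HasCompactSupport φ →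
    ∀ j, ∫ x, f x * lieDeriv (X j) φ x ∂ρ = -∫ x, g x j * φ x ∂ρ

/-- `f ∈ L²₁(μ)` with distributional horizontal gradient `∇f = g` (unique almost everywhere):
`f ∈ L²(μ)` and `|∇f| ∈ L²(μ)`. -/
structure MemSobolev (μ : Measure G) (f : G → ℝ) (g : G → EuclideanSpace ℝ (Fin ℓ)) : Prop where
  isWeakHorGrad : IsWeakHorGrad X ρ f g
  memLp : MemLp f 2 μ
  memLp_grad : MemLp g 2 μ

end Defs

end LiePoincare

end

/-! Let `m = χ e⁻ᵛ` be the density of the measure `μ` with respect to `ρ`, and put `pⱼ = Xⱼ v`, `aⱼ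
= (Xⱼ χ)(e)`, so that `Xⱼ m = m (aⱼ - pⱼ)`. Right invariance of `ρ` makes the integral of `Xⱼ` of a
compactly supported function vanish. Applied to `h² η² m pⱼ` with a cutoff `η` and summed over `j`,
this turns `∫ η² h² (|∇v|² + Δ_χ v) dμ` into cross terms in `∇η` and `∇h`. Young's inequality bounds
them at the price of half of `|∇v|²`. Outside the ball the hypothesis still leaves `c + (ε/2)|∇v|²`
on the left. The cutoffs have gradients bounded independently of the compact set on which they equal
one (`exists_cutoff`), so for `h ∈ L²(μ)` the error they cause disappears in the limit. As
Carnot–Carathéodory balls are relatively compact, the result is `∫ h² (1 + |∇v|)² dμ ≤ C (∫ |∇h|² dμ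
+ ∫_K h² dμ)` with `K` compact (`exists_lyapunov_bound`).

The term on `K` is removed by taking `h = f - a`, with `a` from a local Poincaré inequality
(`exists_local_poincare`). This is where Hörmander's condition enters. Translating `f` along the
flow of `Xⱼ` for time `t` changes it in `L²` on compact sets by at most `|t|` times a local `L²`
norm of `Xⱼ f`. Such bounds pass to products, hence to products of conjugates of one-parameter
subgroups. By Hörmander's condition the adjoint orbits of the `Xⱼ` span the Lie algebra
(`adjSpan_eq_top`), so these products fill a neighbourhood of `e`, and by connectedness finitely
many of them cover any compact set. Averaging the translation estimate gives the inequality.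

Finally, `h = 1` in the weighted estimate shows `1 + |∇v| ∈ L²(μ)`, which allows `a` to be replaced
by the mean of `f` (`eLpNorm_sub_average_mul_le`). Weak derivatives are handled throughout as
absolute continuity along almost every orbit, in the integrated form `FlowDeriv`
(`flowDeriv_of_weak`); no smoothing of `f` is needed. -/

namespace LiePoincare

set_option linter.unusedSectionVars false

open Filter Set VectorField
open scoped Topology Pointwise

/-! ### Manifold derivatives as linear maps between the model spaces -/

section HasMD

variable {E : Type*} [NormedAddCommGroup E] [NormedSpace ℝ E]
  {E' : Type*} [NormedAddCommGroup E'] [NormedSpace ℝ E']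
  {E'' : Type*} [NormedAddCommGroup E''] [NormedSpace ℝ E'']
  {M : Type*} [TopologicalSpace M] [ChartedSpace E M]
  {M' : Type*} [TopologicalSpace M'] [ChartedSpace E' M']
  {M'' : Type*} [TopologicalSpace M''] [ChartedSpace E'' M'']

/-- `HasMFDerivAt` for boundaryless models, the derivative being a map of the model spaces. -/
def HasMD (f : M → M') (x : M) (A : E →L[ℝ] E') : Prop :=
  HasMFDerivAt 𝓘(ℝ, E) 𝓘(ℝ, E') f x A

lemma HasMD.comp {g : M' → M''} {f : M → M'} {x : M} {B : E' →L[ℝ] E''} {A : E →L[ℝ] E'}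
    (hg : HasMD g (f x) B) (hf : HasMD f x A) : HasMD (fun y => g (f y)) x (B.comp A) :=
  HasMFDerivAt.comp x hg hf

lemma HasMD.unique {f : M → M'} {x : M} {A B : E →L[ℝ] E'}
    (hA : HasMD f x A) (hB : HasMD f x B) : A = B :=
  hasMFDerivAt_unique hA hB

lemma HasMD.mfderiv_eq {f : M → M'} {x : M} {A : E →L[ℝ] E'} (hA : HasMD f x A) :
    (mfderiv 𝓘(ℝ, E) 𝓘(ℝ, E') f x : E →L[ℝ] E') = A :=
  HasMFDerivAt.mfderiv hA

lemma _root_.MDifferentiableAt.hasMD {f : M → M'} {x : M}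
    (h : MDifferentiableAt 𝓘(ℝ, E) 𝓘(ℝ, E') f x) :
    HasMD (E := E) (E' := E') f x (mfderiv 𝓘(ℝ, E) 𝓘(ℝ, E') f x) :=
  h.hasMFDerivAt

lemma HasMD.mdifferentiableAt {f : M → M'} {x : M} {A : E →L[ℝ] E'} (hA : HasMD f x A) :
    MDifferentiableAt 𝓘(ℝ, E) 𝓘(ℝ, E') f x :=
  HasMFDerivAt.mdifferentiableAt hA

lemma hasMD_iff_hasFDerivAt {f : E → E'} {x : E} {A : E →L[ℝ] E'} :
    HasMD f x A ↔ HasFDerivAt f A x :=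
  hasMFDerivAt_iff_hasFDerivAt

lemma HasMD.hasDerivAt {f : ℝ → E'} {x : ℝ} {v : E'}
    (h : HasMD f x ((1 : ℝ →L[ℝ] ℝ).smulRight v)) : HasDerivAt f v x := by
  simpa using (hasMD_iff_hasFDerivAt.1 h).hasDerivAt

lemma comp_smulRight_one (A : E →L[ℝ] E') (v : E) :
    A.comp ((1 : ℝ →L[ℝ] ℝ).smulRight v) = (1 : ℝ →L[ℝ] ℝ).smulRight (A v) := by
  ext; simp

lemma HasMD.comp_curve {g : M → M'} {γ : ℝ → M} {t : ℝ} {B : E →L[ℝ] E'} {v : E}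
    (hg : HasMD g (γ t) B) (hγ : HasMD γ t ((1 : ℝ →L[ℝ] ℝ).smulRight v)) :
    HasMD (fun s => g (γ s)) t ((1 : ℝ →L[ℝ] ℝ).smulRight (B v)) := by
  rw [← comp_smulRight_one]
  exact hg.comp hγ

end HasMD

/-! ### One-parameter subgroups -/

section OneParameter

variable {E : Type*} [NormedAddCommGroup E] [NormedSpace ℝ E]
  {G : Type*} [TopologicalSpace G] [ChartedSpace E G] [Group G] [LieGroup 𝓘(ℝ, E) ∞ G]

lemma contMDiff_mulInvariantVectorField_one (Z : GroupLieAlgebra 𝓘(ℝ, E) G) :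
    ContMDiff 𝓘(ℝ, E) 𝓘(ℝ, E).tangent 1
      (fun g : G ↦ (⟨g, mulInvariantVectorField Z g⟩ : TangentBundle 𝓘(ℝ, E) G)) := by
  refine (contMDiff_mulInvariantVectorField (I := 𝓘(ℝ, E)) Z).of_le ?_
  simp only [minSmoothness_of_isRCLikeNormedField]
  norm_num

lemma mdifferentiable_mul_left (g : G) :
    MDifferentiable 𝓘(ℝ, E) 𝓘(ℝ, E) (fun x : G => g * x) :=
  (contMDiff_mul_left (I := 𝓘(ℝ, E)) (n := ∞)).mdifferentiable (by simp)

lemma mdifferentiable_mul_right (g : G) :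
    MDifferentiable 𝓘(ℝ, E) 𝓘(ℝ, E) (fun x : G => x * g) :=
  (contMDiff_mul_right (I := 𝓘(ℝ, E)) (n := ∞)).mdifferentiable (by simp)

/-- The left-invariant vector field with value `Z` at the identity, with values in the model. -/
noncomputable def leftField (Z : GroupLieAlgebra 𝓘(ℝ, E) G) (g : G) : E := mulInvariantVectorField Z g

omit [LieGroup 𝓘(ℝ, E) ∞ G] in
lemma leftField_eq_of_hasMD {Z : GroupLieAlgebra 𝓘(ℝ, E) G} {g : G} {A : E →L[ℝ] E}
    (h : HasMD (fun x : G => g * x) 1 A) : leftField Z g = A Z :=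
  DFunLike.congr_fun h.mfderiv_eq _

lemma HasMD.map_leftField {Z : GroupLieAlgebra 𝓘(ℝ, E) G} {g h : G} {A : E →L[ℝ] E}
    (hA : HasMD (fun x : G => g * x) h A) : A (leftField Z h) = leftField Z (g * h) := by
  have h1 : HasMD (fun x : G => g * x) (h * 1) A := by simpa using hA
  have h2 := (mdifferentiable_mul_left (E := E) h 1).hasMD
  have h3 := h1.comp h2
  simp only [← mul_assoc] at h3
  exact (leftField_eq_of_hasMD h3).symm

lemma _root_.IsMIntegralCurveOn.mul_left {γ : ℝ → G} {Z : GroupLieAlgebra 𝓘(ℝ, E) G} {s : Set ℝ}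
    (h : IsMIntegralCurveOn γ (mulInvariantVectorField Z) s) (g : G) :
    IsMIntegralCurveOn (fun t => g * γ t) (mulInvariantVectorField Z) s := by
  intro t ht
  have h0 := (mdifferentiable_mul_left (E := E) g (γ t)).hasMD
  have h1 := HasMFDerivAt.comp_hasMFDerivWithinAt t h0 (h t ht)
  refine h1.congr_mfderiv ((comp_smulRight_one (E := E) (E' := E) _ (leftField Z (γ t))).trans ?_)
  rw [h0.map_leftField]
  rfl

lemma _root_.IsMIntegralCurve.mul_left {γ : ℝ → G} {Z : GroupLieAlgebra 𝓘(ℝ, E) G}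
    (h : IsMIntegralCurve γ (mulInvariantVectorField Z)) (g : G) :
    IsMIntegralCurve (fun t => g * γ t) (mulInvariantVectorField Z) := by
  rw [isMIntegralCurve_iff_isMIntegralCurveOn] at *
  exact h.mul_left g

variable [CompleteSpace E] [T2Space G]

/-- Left translates of one local integral curve through the identity are integral curves through
every point, all defined on the same interval `(-ε, ε)`. A uniform existence time makes the field
complete. -/
lemma exists_isMIntegralCurve_one (Z : GroupLieAlgebra 𝓘(ℝ, E) G) :
    ∃ γ : ℝ → G, γ 0 = 1 ∧ IsMIntegralCurve γ (mulInvariantVectorField Z) := by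
  have hv := contMDiff_mulInvariantVectorField_one Z
  obtain ⟨γ, h0, hγ⟩ :=
    exists_isMIntegralCurveAt_of_contMDiffAt_boundaryless 0 (hv.contMDiffAt (x := 1))
  obtain ⟨ε, hε, hγ⟩ := isMIntegralCurveAt_iff'.1 hγ
  refine exists_isMIntegralCurve_of_isMIntegralCurveOn hv hε (fun x => ⟨fun t => x * γ t, ?_, ?_⟩) 1
  · simp [h0]
  · have := hγ.mul_left x
    simpa [Real.ball_eq_Ioo] using this

/-- The one-parameter subgroup `t ↦ exp (t Z)`. -/
noncomputable def oneParam (Z : GroupLieAlgebra 𝓘(ℝ, E) G) : ℝ → G :=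
  (exists_isMIntegralCurve_one Z).choose

variable (Z : GroupLieAlgebra 𝓘(ℝ, E) G)

@[simp] lemma oneParam_zero : oneParam Z 0 = 1 := (exists_isMIntegralCurve_one Z).choose_spec.1

lemma isMIntegralCurve_oneParam : IsMIntegralCurve (oneParam Z) (mulInvariantVectorField Z) :=
  (exists_isMIntegralCurve_one Z).choose_spec.2

lemma continuous_oneParam : Continuous (oneParam Z) := (isMIntegralCurve_oneParam Z).continuous

/-- As functions of `t`, both sides are integral curves of the same field with the same value at
`0`, so uniqueness applies. -/
lemma oneParam_add (s t : ℝ) : oneParam Z (s + t) = oneParam Z s * oneParam Z t := by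
  have h1 : IsMIntegralCurve (fun t => oneParam Z (t + s)) (mulInvariantVectorField Z) :=
    (isMIntegralCurve_oneParam Z).comp_add s
  have h2 := (isMIntegralCurve_oneParam Z).mul_left (oneParam Z s)
  have := isMIntegralCurve_Ioo_eq_of_contMDiff_boundaryless (t₀ := 0)
    (contMDiff_mulInvariantVectorField_one Z) h1 h2 (by simp)
  simpa [add_comm] using congrFun this t

lemma oneParam_comm (s t : ℝ) : oneParam Z s * oneParam Z t = oneParam Z t * oneParam Z s := by
  rw [← oneParam_add, ← oneParam_add, add_comm]

lemma hasMD_mul_oneParam (x : G) (t : ℝ) :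
    HasMD (fun t => x * oneParam Z t) t
      ((1 : ℝ →L[ℝ] ℝ).smulRight (leftField Z (x * oneParam Z t))) :=
  (isMIntegralCurve_oneParam Z).mul_left x t

lemma hasMD_oneParam (t : ℝ) :
    HasMD (oneParam Z) t ((1 : ℝ →L[ℝ] ℝ).smulRight (leftField Z (oneParam Z t))) :=
  isMIntegralCurve_oneParam Z t

lemma hasDerivAt_comp_mul_oneParam {u : G → ℝ} {x : G} {t : ℝ}
    (hu : MDifferentiableAt 𝓘(ℝ, E) 𝓘(ℝ, ℝ) u (x * oneParam Z t)) :
    HasDerivAt (fun t => u (x * oneParam Z t)) (lieDeriv Z u (x * oneParam Z t)) t :=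
  (hu.hasMD.comp_curve (hasMD_mul_oneParam Z x t)).hasDerivAt

lemma hasDerivAt_comp_mul_oneParam_zero {u : G → ℝ} {x : G}
    (hu : MDifferentiableAt 𝓘(ℝ, E) 𝓘(ℝ, ℝ) u x) :
    HasDerivAt (fun t => u (x * oneParam Z t)) (lieDeriv Z u x) 0 := by
  have := hasDerivAt_comp_mul_oneParam Z (u := u) (x := x) (t := 0) (by simpa using hu)
  simpa using this

end OneParameter

/-! ### The group law in a chart at the identity -/

section Chart

variable {E : Type*} [NormedAddCommGroup E] [NormedSpace ℝ E]
  {G : Type*} [TopologicalSpace G] [ChartedSpace E G] [Group G]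

variable (E G) in
/-- The preferred chart at the identity. -/
noncomputable abbrev chartOne : PartialEquiv G E := extChartAt 𝓘(ℝ, E) (1 : G)

variable (E G) in
/-- The coordinates of the identity. -/
noncomputable abbrev coordOne : E := chartOne E G 1

variable (E G) in
/-- The multiplication in the chart at the identity. -/
noncomputable def mulChart (p : E × E) : E :=
  chartOne E G ((chartOne E G).symm p.1 * (chartOne E G).symm p.2)

lemma chartOne_symm_coordOne : (chartOne E G).symm (coordOne E G) = 1 :=
  (chartOne E G).left_inv (mem_extChartAt_source _)

lemma chartOne_target_mem_nhds : (chartOne E G).target ∈ 𝓝 (coordOne E G) :=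
  extChartAt_target_mem_nhds (I := 𝓘(ℝ, E)) (1 : G)

lemma chartOne_source_mem_nhds : (chartOne E G).source ∈ 𝓝 (1 : G) :=
  extChartAt_source_mem_nhds (I := 𝓘(ℝ, E)) (1 : G)

variable [LieGroup 𝓘(ℝ, E) ∞ G]

lemma hasMD_chartOne {x : G} (hx : x ∈ (chartOne E G).source) :
    HasMD (E := E) (E' := E) (chartOne E G) x (mfderiv 𝓘(ℝ, E) 𝓘(ℝ, E) (chartOne E G) x) :=
  (mdifferentiableAt_extChartAt (by simpa using hx)).hasMD

lemma hasMD_chartOne_one :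
    HasMD (E := E) (E' := E) (chartOne E G) 1 (ContinuousLinearMap.id ℝ E) := by
  have h := hasMD_chartOne (E := E) (mem_extChartAt_source (I := 𝓘(ℝ, E)) (1 : G))
  have h2 := mfderiv_extChartAt_self (I := 𝓘(ℝ, E)) (x := (1 : G))
  rwa [h2] at h

lemma mdifferentiableAt_chartOne_symm {y : E} (hy : y ∈ (chartOne E G).target) :
    MDifferentiableAt 𝓘(ℝ, E) 𝓘(ℝ, E) (chartOne E G).symm y := by
  have := mdifferentiableWithinAt_extChartAt_symm hy
  simpa [mdifferentiableWithinAt_univ] using this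

lemma hasMD_chartOne_symm {y : E} (hy : y ∈ (chartOne E G).target) :
    HasMD (E := E) (E' := E) (chartOne E G).symm y
      (mfderiv 𝓘(ℝ, E) 𝓘(ℝ, E) (chartOne E G).symm y) :=
  (mdifferentiableAt_chartOne_symm hy).hasMD

lemma hasMD_congr {E' M M' : Type*} [NormedAddCommGroup E'] [NormedSpace ℝ E'] [TopologicalSpace M]
    [ChartedSpace E M] [TopologicalSpace M'] [ChartedSpace E' M'] {f g : M → M'} {x : M}
    {A : E →L[ℝ] E'} (h : HasMD f x A) (hfg : g =ᶠ[𝓝 x] f) : HasMD g x A :=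
  HasMFDerivAt.congr_of_eventuallyEq h hfg

lemma hasMD_id {M : Type*} [TopologicalSpace M] [ChartedSpace E M] (x : M) :
    HasMD (E := E) (E' := E) (fun y : M => y) x (ContinuousLinearMap.id ℝ E) :=
  hasMFDerivAt_id x

lemma chart_comp_symm {y : E} (hy : y ∈ (chartOne E G).target) {A B : E →L[ℝ] E}
    (hA : HasMD (chartOne E G) ((chartOne E G).symm y) A)
    (hB : HasMD (chartOne E G).symm y B) : A.comp B = ContinuousLinearMap.id ℝ E := by
  refine (hA.comp hB).unique (hasMD_congr (hasMD_id y) ?_)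
  filter_upwards [extChartAt_target_mem_nhds' (I := 𝓘(ℝ, E)) hy] with z hz
  exact (chartOne E G).right_inv hz

lemma symm_comp_chart {y : E} (hy : y ∈ (chartOne E G).target) {A B : E →L[ℝ] E}
    (hA : HasMD (chartOne E G) ((chartOne E G).symm y) A)
    (hB : HasMD (chartOne E G).symm y B) : B.comp A = ContinuousLinearMap.id ℝ E := by
  have hB' : HasMD (chartOne E G).symm (chartOne E G ((chartOne E G).symm y)) B := by
    rwa [(chartOne E G).right_inv hy]
  refine (hB'.comp hA).unique (hasMD_congr (hasMD_id _) ?_)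
  have := extChartAt_source_mem_nhds' (I := 𝓘(ℝ, E)) ((chartOne E G).map_target hy)
  filter_upwards [this] with z hz
  exact (chartOne E G).left_inv hz

lemma hasMD_chartOne_symm_coordOne :
    HasMD (E := E) (E' := E) (chartOne E G).symm (coordOne E G) (ContinuousLinearMap.id ℝ E) := by
  obtain ⟨B, h⟩ : ∃ B, HasMD (E := E) (E' := E) (chartOne E G).symm (coordOne E G) B :=
    ⟨_, hasMD_chartOne_symm (mem_extChartAt_target (1 : G))⟩
  have h1 : HasMD (E := E) (E' := E) (chartOne E G) ((chartOne E G).symm (coordOne E G))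
      (ContinuousLinearMap.id ℝ E) := by
    rw [chartOne_symm_coordOne]; exact hasMD_chartOne_one
  have := chart_comp_symm (mem_extChartAt_target (1 : G)) h1 h
  rw [ContinuousLinearMap.id_comp] at this
  rwa [this] at h

lemma contMDiffAt_chartOne_symm :
    ContMDiffAt 𝓘(ℝ, E) 𝓘(ℝ, E) ∞ (chartOne E G).symm (coordOne E G) :=
  (contMDiffOn_extChartAt_symm (1 : G)).contMDiffAt chartOne_target_mem_nhds

lemma contDiffAt_mulChart : ContDiffAt ℝ ∞ (mulChart E G) (coordOne E G, coordOne E G) := by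
  rw [← contMDiffAt_iff_contDiffAt]
  have h1 : ContMDiffAt 𝓘(ℝ, E × E) 𝓘(ℝ, E) ∞ (fun p : E × E => (chartOne E G).symm p.1)
      (coordOne E G, coordOne E G) :=
    ContMDiffAt.comp (I' := 𝓘(ℝ, E)) _ contMDiffAt_chartOne_symm contDiff_fst.contMDiff.contMDiffAt
  have h2 : ContMDiffAt 𝓘(ℝ, E × E) 𝓘(ℝ, E) ∞ (fun p : E × E => (chartOne E G).symm p.2)
      (coordOne E G, coordOne E G) :=
    ContMDiffAt.comp (I' := 𝓘(ℝ, E)) _ contMDiffAt_chartOne_symm contDiff_snd.contMDiff.contMDiffAt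
  refine ContMDiffAt.comp (I' := 𝓘(ℝ, E)) _ ?_ (h1.mul h2)
  simp only [chartOne_symm_coordOne, mul_one]
  exact contMDiffAt_extChartAt

lemma eventually_differentiableAt_mulChart :
    ∀ᶠ p in 𝓝 (coordOne E G, coordOne E G), DifferentiableAt ℝ (mulChart E G) p := by
  have h := (contDiffAt_mulChart (E := E) (G := G)).of_le (m := 1) (by simp)
  filter_upwards [h.eventually (by simp)] with p hp
  exact hp.differentiableAt (by simp)

lemma mulChart_coordOne_right {a : E} (ha : a ∈ (chartOne E G).target) :
    mulChart E G (a, coordOne E G) = a := by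
  simp only [mulChart, chartOne_symm_coordOne, mul_one]
  exact (chartOne E G).right_inv ha

lemma mulChart_coordOne_left {a : E} (ha : a ∈ (chartOne E G).target) :
    mulChart E G (coordOne E G, a) = a := by
  simp only [mulChart, chartOne_symm_coordOne, one_mul]
  exact (chartOne E G).right_inv ha

lemma fderiv_mulChart_coordOne_inl :
    (fderiv ℝ (mulChart E G) (coordOne E G, coordOne E G)).comp (ContinuousLinearMap.inl ℝ E E) =
      ContinuousLinearMap.id ℝ E := by
  have h := (eventually_differentiableAt_mulChart (E := E) (G := G)).self_of_nhds.hasFDerivAt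
  have h1 := HasFDerivAt.comp (f := fun e => (e, coordOne E G)) (coordOne E G) h
    (hasFDerivAt_prodMk_left (𝕜 := ℝ) (coordOne E G) (coordOne E G))
  refine h1.unique ((hasFDerivAt_id _).congr_of_eventuallyEq ?_)
  filter_upwards [chartOne_target_mem_nhds (E := E) (G := G)] with a ha
  exact mulChart_coordOne_right ha

lemma fderiv_mulChart_coordOne_inr :
    (fderiv ℝ (mulChart E G) (coordOne E G, coordOne E G)).comp (ContinuousLinearMap.inr ℝ E E) =
      ContinuousLinearMap.id ℝ E := by
  have h := (eventually_differentiableAt_mulChart (E := E) (G := G)).self_of_nhds.hasFDerivAt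
  have h1 := h.comp (coordOne E G) (hasFDerivAt_prodMk_right (𝕜 := ℝ) (coordOne E G) (coordOne E G))
  refine h1.unique ((hasFDerivAt_id _).congr_of_eventuallyEq ?_)
  filter_upwards [chartOne_target_mem_nhds (E := E) (G := G)] with a ha
  exact mulChart_coordOne_left ha

variable (E G) in
/-- The left-invariant vector field of `Z` read in the chart at the identity. -/
noncomputable def leftChart (Z : E) (a : E) : E :=
  fderiv ℝ (mulChart E G) (a, coordOne E G) (0, Z)

variable (E G) in
/-- The derivative at the identity of the right multiplication, read in the chart. -/
noncomputable def rightChart (a : E) : E →L[ℝ] E :=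
  (fderiv ℝ (mulChart E G) (coordOne E G, a)).comp (ContinuousLinearMap.inl ℝ E E)

lemma eventually_mulChart_left : ∀ᶠ a in 𝓝 (coordOne E G),
    a ∈ (chartOne E G).target ∧ DifferentiableAt ℝ (mulChart E G) (a, coordOne E G) := by
  have h : Tendsto (fun a : E => (a, coordOne E G)) (𝓝 (coordOne E G))
      (𝓝 (coordOne E G, coordOne E G)) :=
    (by fun_prop : Continuous fun a : E => (a, coordOne E G)).tendsto _
  filter_upwards [chartOne_target_mem_nhds (E := E) (G := G),
    h.eventually eventually_differentiableAt_mulChart] with a h1 h2 using ⟨h1, h2⟩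

lemma eventually_mulChart_right : ∀ᶠ a in 𝓝 (coordOne E G),
    a ∈ (chartOne E G).target ∧ DifferentiableAt ℝ (mulChart E G) (coordOne E G, a) := by
  have h : Tendsto (fun a : E => (coordOne E G, a)) (𝓝 (coordOne E G))
      (𝓝 (coordOne E G, coordOne E G)) :=
    (by fun_prop : Continuous fun a : E => (coordOne E G, a)).tendsto _
  filter_upwards [chartOne_target_mem_nhds (E := E) (G := G),
    h.eventually eventually_differentiableAt_mulChart] with a h1 h2 using ⟨h1, h2⟩

/-- Left multiplication by the point with coordinate `a` reads in the chart as `mulChart (a, ·)`.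
The left-invariant field is therefore a partial derivative of `mulChart`, and its own derivative a
mixed second derivative. -/
lemma chart_leftField (Z : GroupLieAlgebra 𝓘(ℝ, E) G) {a : E}
    (ha' : DifferentiableAt ℝ (mulChart E G) (a, coordOne E G)) {A : E →L[ℝ] E}
    (hA : HasMD (chartOne E G) ((chartOne E G).symm a) A) :
    A (leftField Z ((chartOne E G).symm a)) = leftChart E G Z a := by
  set g := (chartOne E G).symm a with hg
  obtain ⟨L, hL⟩ : ∃ L, HasMD (E := E) (E' := E) (fun x : G => g * x) 1 L :=
    ⟨_, (mdifferentiable_mul_left (E := E) g 1).hasMD⟩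
  rw [leftField_eq_of_hasMD hL]
  have h0 := hasMD_chartOne_symm_coordOne (E := E) (G := G)
  have h1 : HasMD (fun x : G => g * x) ((chartOne E G).symm (coordOne E G)) L := by
    rwa [chartOne_symm_coordOne]
  have h2 : HasMD (chartOne E G) (g * (chartOne E G).symm (coordOne E G)) A := by
    rwa [chartOne_symm_coordOne, mul_one]
  have h3 := hasMD_iff_hasFDerivAt.1 
    (HasMD.comp (f := fun y => g * (chartOne E G).symm y) h2 (h1.comp h0))
  have h4 := ha'.hasFDerivAt.comp (coordOne E G)
    (hasFDerivAt_prodMk_right (𝕜 := ℝ) a (coordOne E G))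
  exact DFunLike.congr_fun (h3.unique h4) Z

lemma chart_rightMul {a : E}
    (ha' : DifferentiableAt ℝ (mulChart E G) (coordOne E G, a)) {A R : E →L[ℝ] E}
    (hA : HasMD (chartOne E G) ((chartOne E G).symm a) A)
    (hR : HasMD (fun x : G => x * (chartOne E G).symm a) 1 R) :
    A.comp R = rightChart E G a := by
  have h0 := hasMD_chartOne_symm_coordOne (E := E) (G := G)
  set g := (chartOne E G).symm a with hg
  have h1 : HasMD (fun x : G => x * g) ((chartOne E G).symm (coordOne E G)) R := by
    rwa [chartOne_symm_coordOne]
  have h2 : HasMD (chartOne E G) ((chartOne E G).symm (coordOne E G) * g) A := by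
    rwa [chartOne_symm_coordOne, one_mul]
  have h3 := hasMD_iff_hasFDerivAt.1 
    (HasMD.comp (f := fun y => (chartOne E G).symm y * g) h2 (h1.comp h0))
  have h4 := HasFDerivAt.comp (f := fun e => (e, a)) (coordOne E G) ha'.hasFDerivAt
    (hasFDerivAt_prodMk_left (𝕜 := ℝ) (coordOne E G) a)
  exact h3.unique h4

end Chart

/-! ### The bracket as the derivative of the adjoint action -/

section Bracket

variable {E : Type*} [NormedAddCommGroup E] [NormedSpace ℝ E] [CompleteSpace E]
  {G : Type*} [TopologicalSpace G] [ChartedSpace E G] [Group G] [LieGroup 𝓘(ℝ, E) ∞ G]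

lemma mpullback_chart_leftField (Z : GroupLieAlgebra 𝓘(ℝ, E) G) {a : E}
    (ha : a ∈ (chartOne E G).target)
    (ha' : DifferentiableAt ℝ (mulChart E G) (a, coordOne E G)) :
    mpullback 𝓘(ℝ, E) 𝓘(ℝ, E) (chartOne E G).symm (mulInvariantVectorField Z) a =
      leftChart E G Z a := by
  have hA := hasMD_chartOne ((chartOne E G).map_target ha)
  have hB := hasMD_chartOne_symm (E := E) (G := G) ha
  have h1 := chart_comp_symm ha hA hB
  have h2 := symm_comp_chart ha hA hB
  rw [← chart_leftField Z ha' hA]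
  have h3 := ContinuousLinearMap.inverse_eq h2 h1
  exact DFunLike.congr_fun h3 (leftField Z _)

/-- The bracket on the Lie algebra is that of the left-invariant fields at the identity, computed in
the preferred chart. The derivative of this chart at its base point is the identity, so no
correction appears. -/
lemma bracket_eq_lieBracket_leftChart (X Y : GroupLieAlgebra 𝓘(ℝ, E) G) :
    (⁅X, Y⁆ : GroupLieAlgebra 𝓘(ℝ, E) G) =
      lieBracket ℝ (leftChart E G X) (leftChart E G Y) (coordOne E G) := by
  rw [GroupLieAlgebra.bracket_def, ← mlieBracketWithin_univ, mlieBracketWithin_apply,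
    mfderiv_extChartAt_self]
  simp only [preimage_univ, univ_inter, ModelWithCorners.range_eq_univ, mpullbackWithin_univ]
  have h : ∀ Z : GroupLieAlgebra 𝓘(ℝ, E) G,
      mpullback 𝓘(ℝ, E) 𝓘(ℝ, E) (chartOne E G).symm (mulInvariantVectorField Z)
        =ᶠ[𝓝 (coordOne E G)] leftChart E G Z := by
    intro Z
    filter_upwards [eventually_mulChart_left (E := E) (G := G)] with a ha
    exact mpullback_chart_leftField Z ha.1 ha.2
  have h1 := Filter.EventuallyEq.lieBracket_vectorField_eq (𝕜 := ℝ) (h X) (h Y)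
  have h2 : (ContinuousLinearMap.id ℝ E).inverse = ContinuousLinearMap.id ℝ E :=
    ContinuousLinearMap.inverse_id
  refine (DFunLike.congr_fun h2 _).trans ?_
  exact (congrFun lieBracketWithin_univ _).trans h1

/-- The second derivative of the multiplication in the chart at the identity. -/
lemma exists_second_fderiv_mulChart :
    ∃ D : E × E →L[ℝ] E × E →L[ℝ] E, HasFDerivAt (fderiv ℝ (mulChart E G)) D
      (coordOne E G, coordOne E G) ∧ ∀ v w, D v w = D w v := by
  have h := contDiffAt_mulChart (E := E) (G := G)
  have h1 : ContDiffAt ℝ 1 (fderiv ℝ (mulChart E G)) (coordOne E G, coordOne E G) :=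
    h.fderiv_right (by norm_cast)
  refine ⟨_, (h1.differentiableAt (by simp)).hasFDerivAt, ?_⟩
  have h2 : IsSymmSndFDerivAt ℝ (mulChart E G) (coordOne E G, coordOne E G) :=
    h.isSymmSndFDerivAt (by
      rw [minSmoothness_of_isRCLikeNormedField]; exact WithTop.coe_le_coe.2 le_top)
  exact h2

lemma leftChart_coordOne (Z : E) : leftChart E G Z (coordOne E G) = Z :=
  DFunLike.congr_fun (fderiv_mulChart_coordOne_inr (E := E) (G := G)) Z

lemma rightChart_coordOne : rightChart E G (coordOne E G) = ContinuousLinearMap.id ℝ E :=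
  fderiv_mulChart_coordOne_inl (E := E) (G := G)

lemma hasFDerivAt_leftChart {D : E × E →L[ℝ] E × E →L[ℝ] E}
    (hD : HasFDerivAt (fderiv ℝ (mulChart E G)) D (coordOne E G, coordOne E G)) (Z : E) :
    HasFDerivAt (leftChart E G Z)
      ((ContinuousLinearMap.apply ℝ E ((0, Z) : E × E)).comp (D.comp (ContinuousLinearMap.inl ℝ E E)))
      (coordOne E G) := by
  have h1 := HasFDerivAt.comp (f := fun e => (e, coordOne E G)) (coordOne E G) hD
    (hasFDerivAt_prodMk_left (𝕜 := ℝ) (coordOne E G) (coordOne E G))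
  exact (ContinuousLinearMap.apply ℝ E ((0, Z) : E × E)).hasFDerivAt.comp _ h1

lemma hasFDerivAt_rightChart {D : E × E →L[ℝ] E × E →L[ℝ] E}
    (hD : HasFDerivAt (fderiv ℝ (mulChart E G)) D (coordOne E G, coordOne E G)) :
    HasFDerivAt (rightChart E G)
      (((ContinuousLinearMap.compL ℝ E (E × E) E).flip (ContinuousLinearMap.inl ℝ E E)).comp
        (D.comp (ContinuousLinearMap.inr ℝ E E)))
      (coordOne E G) := by
  have h1 := HasFDerivAt.comp (f := fun e => (coordOne E G, e)) (coordOne E G) hD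
    (hasFDerivAt_prodMk_right (𝕜 := ℝ) (coordOne E G) (coordOne E G))
  exact ((ContinuousLinearMap.compL ℝ E (E × E) E).flip
    (ContinuousLinearMap.inl ℝ E E)).hasFDerivAt.comp _ h1

/-- The adjoint action. -/
noncomputable def adj (h : G) : E →L[ℝ] E :=
  mfderiv 𝓘(ℝ, E) 𝓘(ℝ, E) (fun x : G => h * x * h⁻¹) 1

lemma hasMD_conj (h : G) : HasMD (fun x : G => h * x * h⁻¹) 1 (adj (E := E) h) :=
  HasMD.comp (g := fun x : G => x * h⁻¹) (f := fun x : G => h * x)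
    (mdifferentiable_mul_right (E := E) h⁻¹ _).hasMD
    (mdifferentiable_mul_left (E := E) h _).hasMD |>.mdifferentiableAt.hasMD

lemma adj_mul (g h : G) : adj (E := E) (g * h) = (adj (E := E) g).comp (adj (E := E) h) := by
  have h1 : HasMD (fun x : G => g * x * g⁻¹) (h * 1 * h⁻¹) (adj (E := E) g) := by
    simpa using hasMD_conj (E := E) g
  have h2 := HasMD.comp (f := fun x : G => h * x * h⁻¹) h1 (hasMD_conj (E := E) h)
  refine (hasMD_conj (E := E) (g * h)).unique ?_
  convert h2 using 2
  simp [mul_assoc]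

lemma adj_one : adj (E := E) (1 : G) = ContinuousLinearMap.id ℝ E := by
  refine (hasMD_conj (E := E) (1 : G)).unique ?_
  simpa using hasMD_id (E := E) (1 : G)

/-- This is the chain rule for `h x = (h x h⁻¹) h`. -/
lemma leftField_eq_rightMul_adj (Z : GroupLieAlgebra 𝓘(ℝ, E) G) (h : G) {R : E →L[ℝ] E}
    (hR : HasMD (fun x : G => x * h) 1 R) : leftField Z h = R (adj (E := E) h Z) := by
  refine leftField_eq_of_hasMD (A := R.comp (adj (E := E) h)) ?_
  have h1 : HasMD (fun x : G => x * h) (h * 1 * h⁻¹) R := by simpa using hR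
  have h2 := HasMD.comp (f := fun x : G => h * x * h⁻¹) h1 (hasMD_conj (E := E) h)
  simpa using h2

lemma leftChart_eq_rightChart_adj (Z : E) {a : E} (ha : a ∈ (chartOne E G).target)
    (hl : DifferentiableAt ℝ (mulChart E G) (a, coordOne E G))
    (hr : DifferentiableAt ℝ (mulChart E G) (coordOne E G, a)) :
    leftChart E G Z a = rightChart E G a (adj ((chartOne E G).symm a) Z) := by
  have hA := hasMD_chartOne (E := E) (G := G) ((chartOne E G).map_target ha)
  obtain ⟨R, hR⟩ : ∃ R, HasMD (E := E) (E' := E) (fun x : G => x * (chartOne E G).symm a) 1 R :=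
    ⟨_, (mdifferentiable_mul_right (E := E) _ 1).hasMD⟩
  rw [← chart_leftField Z hl hA, ← chart_rightMul hr hA hR, leftField_eq_rightMul_adj Z _ hR]
  rfl

variable [T2Space G]

lemma hasDerivAt_chart_oneParam (X : GroupLieAlgebra 𝓘(ℝ, E) G) :
    HasDerivAt (fun t => chartOne E G (oneParam X t)) X 0 := by
  have h1 : HasMD (E := E) (E' := E) (chartOne E G) (oneParam X 0)
      (ContinuousLinearMap.id ℝ E) := by
    rw [oneParam_zero]; exact hasMD_chartOne_one
  refine (h1.comp_curve (hasMD_oneParam X 0)).hasDerivAt.congr_deriv ?_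
  rw [oneParam_zero]
  have h2 : HasMD (fun x : G => 1 * x) 1 (ContinuousLinearMap.id ℝ E) := by
    simpa using hasMD_id (E := E) (1 : G)
  exact leftField_eq_of_hasMD h2

lemma bracket_eq_second_fderiv {D : E × E →L[ℝ] E × E →L[ℝ] E}
    (hD : HasFDerivAt (fderiv ℝ (mulChart E G)) D (coordOne E G, coordOne E G))
    (X Z : GroupLieAlgebra 𝓘(ℝ, E) G) :
    (⁅X, Z⁆ : GroupLieAlgebra 𝓘(ℝ, E) G) =
      D ((X, 0) : E × E) ((0, Z) : E × E) - D ((Z, 0) : E × E) ((0, X) : E × E) := by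
  rw [bracket_eq_lieBracket_leftChart]
  have key : ∀ X Z : E, lieBracket ℝ (leftChart E G X) (leftChart E G Z) (coordOne E G) =
      D (X, 0) (0, Z) - D (Z, 0) (0, X) := by
    intro X Z
    rw [lieBracket_eq]
    simp only [(hasFDerivAt_leftChart hD _).fderiv, leftChart_coordOne]
    simp
  exact key X Z

/-- Differentiate `leftChart Z a = rightChart a (Ad(a) Z)` along `a = exp (tX)`. The left side
yields `D(X,0)(0,Z)`, the right side `D(0,X)(Z,0)` plus the derivative sought; symmetry of `D` turns
the difference into the bracket. -/
lemma hasDerivAt_adj_oneParam (X : GroupLieAlgebra 𝓘(ℝ, E) G) (Z : E) {B : E}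
    (hB : B = (⁅X, (Z : GroupLieAlgebra 𝓘(ℝ, E) G)⁆ : GroupLieAlgebra 𝓘(ℝ, E) G)) :
    HasDerivAt (fun t => adj (E := E) (oneParam X t) Z) B 0 := by
  obtain ⟨D, hD, hsymm⟩ := exists_second_fderiv_mulChart (E := E) (G := G)
  set a : ℝ → E := fun t => chartOne E G (oneParam X t) with ha_def
  have ha : HasDerivAt a X 0 := hasDerivAt_chart_oneParam X
  have ha0 : a 0 = coordOne E G := by simp only [a, oneParam_zero]
  have hL : HasDerivAt (fun t => leftChart E G Z (a t)) (D (X, 0) (0, Z)) 0 := by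
    have h := hasFDerivAt_leftChart hD Z
    rw [← ha0] at h
    exact h.comp_hasDerivAt 0 ha
  have hR : HasDerivAt (fun t => rightChart E G (a t))
      ((D (0, X)).comp (ContinuousLinearMap.inl ℝ E E)) 0 := by
    have h := hasFDerivAt_rightChart hD
    rw [← ha0] at h
    exact h.comp_hasDerivAt 0 ha
  have hR0 : rightChart E G (a 0) = ContinuousLinearMap.id ℝ E := by
    rw [ha0, rightChart_coordOne]
  have hinv : DifferentiableAt ℝ (fun t => (rightChart E G (a t)).inverse) 0 := by
    have h1 : ContDiffAt ℝ 1 (ContinuousLinearMap.inverse : (E →L[ℝ] E) → (E →L[ℝ] E))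
        (rightChart E G (a 0)) := by
      rw [hR0]
      exact contDiffAt_map_inverse (ContinuousLinearEquiv.refl ℝ E)
    exact (h1.differentiableAt (by simp)).comp (0 : ℝ) hR.differentiableAt
  have hinvertible : ∀ᶠ t in 𝓝 (0 : ℝ), (rightChart E G (a t)).IsInvertible := by
    have h1 : (range ((↑) : (E ≃L[ℝ] E) → E →L[ℝ] E)) ∈ 𝓝 (rightChart E G (a 0)) := by
      rw [hR0]
      exact ContinuousLinearEquiv.nhds (ContinuousLinearEquiv.refl ℝ E)
    exact hR.continuousAt h1
  have hev : ∀ᶠ t in 𝓝 (0 : ℝ),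
      leftChart E G Z (a t) = rightChart E G (a t) (adj (E := E) (oneParam X t) Z) := by
    have hc : Tendsto a (𝓝 0) (𝓝 (coordOne E G)) := by rw [← ha0]; exact ha.continuousAt
    have hs : ∀ᶠ t in 𝓝 (0 : ℝ), oneParam X t ∈ (chartOne E G).source := by
      have := (continuous_oneParam X).tendsto 0
      rw [oneParam_zero] at this
      exact this (chartOne_source_mem_nhds (E := E))
    filter_upwards [hc.eventually eventually_mulChart_left,
      hc.eventually eventually_mulChart_right, hs] with t h1 h2 h3
    have := leftChart_eq_rightChart_adj (E := E) (G := G) Z h1.1 h1.2 h2.2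
    simpa only [a, (chartOne E G).left_inv h3] using this
  -- Differentiability has to be known before the product rule can be used; it follows by solving
  -- for `Ad`, since `rightChart` is invertible near the identity and inversion is smooth.
  have hA : DifferentiableAt ℝ (fun t => adj (E := E) (oneParam X t) Z) 0 := by
    refine (hinv.clm_apply hL.differentiableAt).congr_of_eventuallyEq ?_
    filter_upwards [hev, hinvertible] with t h1 h2
    rw [h1, ← ContinuousLinearMap.comp_apply, h2.inverse_comp_self]
    rfl
  have hprod := (hR.clm_apply hA.hasDerivAt).congr_of_eventuallyEq hev
  have heq := hL.unique hprod
  rw [hR0, oneParam_zero, adj_one] at heq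
  refine hA.hasDerivAt.congr_deriv ?_
  have hB' : B = D (X, 0) (0, Z) - D (Z, 0) (0, X) := hB.trans (bracket_eq_second_fderiv hD X Z)
  rw [hB', heq, hsymm (Z, 0) (0, X)]
  simp

end Bracket

/-! ### Hörmander's condition and adjoint orbits -/

section Generation

variable {E : Type*} [NormedAddCommGroup E] [NormedSpace ℝ E] [CompleteSpace E]
  {G : Type*} [TopologicalSpace G] [ChartedSpace E G] [Group G] [LieGroup 𝓘(ℝ, E) ∞ G] [T2Space G]
  {ℓ : ℕ} (X : Fin ℓ → GroupLieAlgebra 𝓘(ℝ, E) G)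

/-- The subgroup generated by the one-parameter subgroups of the `X j`. -/
noncomputable def flowGroup : Subgroup G :=
  Subgroup.closure {x | ∃ j t, x = oneParam (X j) t}

lemma oneParam_mem_flowGroup (j : Fin ℓ) (t : ℝ) : oneParam (X j) t ∈ flowGroup X :=
  Subgroup.subset_closure ⟨j, t, rfl⟩

/-- The span of the orbit of the `X j` under the adjoint action of `flowGroup X`. -/
noncomputable def adjSpan : Submodule ℝ E :=
  Submodule.span ℝ {w | ∃ h ∈ flowGroup X, ∃ j, w = adj (E := E) h (X j)}

lemma adj_mem_adjSpan {h : G} (hh : h ∈ flowGroup X) {Z : E} (hZ : Z ∈ adjSpan X) :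
    adj (E := E) h Z ∈ adjSpan X := by
  have : adjSpan X ≤ (adjSpan X).comap (adj (E := E) h).toLinearMap := by
    refine Submodule.span_le.2 ?_
    rintro _ ⟨k, hk, j, rfl⟩
    refine Submodule.subset_span ⟨h * k, mul_mem hh hk, j, ?_⟩
    rw [adj_mul]; rfl
  exact this hZ

lemma mem_adjSpan (j : Fin ℓ) : (X j : E) ∈ adjSpan X :=
  Submodule.subset_span ⟨1, one_mem _, j, by rw [adj_one]; rfl⟩

variable [FiniteDimensional ℝ E]

/-- The bracket is a limit of difference quotients of `Ad(exp (t Xⱼ)) Z`. These lie in the invariant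
subspace, which is closed because the dimension is finite. -/
lemma bracket_mem_adjSpan (j : Fin ℓ) {Z B : E} (hZ : Z ∈ adjSpan X)
    (hB : B = (⁅X j, (Z : GroupLieAlgebra 𝓘(ℝ, E) G)⁆ : GroupLieAlgebra 𝓘(ℝ, E) G)) :
    B ∈ adjSpan X := by
  have h := hasDerivAt_adj_oneParam (X j) Z hB
  have hc : IsClosed (adjSpan X : Set E) := Submodule.closed_of_finiteDimensional _
  rw [hasDerivAt_iff_tendsto_slope] at h
  refine hc.mem_of_tendsto h (Eventually.of_forall fun t => ?_)
  rw [slope_def_module]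
  exact Submodule.smul_mem _ _ (Submodule.sub_mem _
    (adj_mem_adjSpan X (oneParam_mem_flowGroup X j _) hZ)
    (adj_mem_adjSpan X (oneParam_mem_flowGroup X j _) hZ))

/-- By the Jacobi identity, the elements whose bracket preserves `adjSpan X` form a Lie subalgebra
`N`. It contains the `Xⱼ`, so it is everything. Hence `adjSpan X` is closed under brackets; being a
Lie subalgebra that contains the `Xⱼ`, it is everything too. -/
lemma adjSpan_eq_top (hX : HormanderCondition X) : adjSpan X = ⊤ := by
  let N : LieSubalgebra ℝ (GroupLieAlgebra 𝓘(ℝ, E) G) :=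
    { carrier := {Y | ∀ Z : GroupLieAlgebra 𝓘(ℝ, E) G, Z ∈ adjSpan X → ⁅Y, Z⁆ ∈ adjSpan X}
      add_mem' := fun {a b} ha hb Z hZ => by
        have := Submodule.add_mem _ (ha Z hZ) (hb Z hZ)
        rw [add_lie]; exact this
      zero_mem' := fun Z hZ => by
        rw [zero_lie]; exact Submodule.zero_mem _
      smul_mem' := fun c a ha Z hZ => by
        have := Submodule.smul_mem _ c (ha Z hZ)
        rw [smul_lie]; exact this
      lie_mem' := fun {a b} ha hb Z hZ => by
        have := Submodule.sub_mem _ (ha _ (hb Z hZ)) (hb _ (ha Z hZ))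
        rw [lie_lie]; exact this }
  have hN : ∀ Y : GroupLieAlgebra 𝓘(ℝ, E) G, Y ∈ N := by
    have : N = ⊤ := by
      rw [eq_top_iff, ← hX]
      refine LieSubalgebra.lieSpan_le.2 ?_
      rintro _ ⟨j, rfl⟩ Z hZ
      exact bracket_mem_adjSpan X j hZ rfl
    intro Y; rw [this]; trivial
  let V : LieSubalgebra ℝ (GroupLieAlgebra 𝓘(ℝ, E) G) :=
    { carrier := {Y | Y ∈ adjSpan X}
      add_mem' := fun {a b} ha hb => Submodule.add_mem (adjSpan X) ha hb
      zero_mem' := Submodule.zero_mem (adjSpan X)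
      smul_mem' := fun c a ha => Submodule.smul_mem (adjSpan X) c ha
      lie_mem' := fun {a b} _ hb => hN a b hb }
  have hV : V = ⊤ := by
    rw [eq_top_iff, ← hX]
    refine LieSubalgebra.lieSpan_le.2 ?_
    rintro _ ⟨j, rfl⟩
    exact mem_adjSpan X j
  rw [eq_top_iff]
  intro Y _
  have : (Y : GroupLieAlgebra 𝓘(ℝ, E) G) ∈ V := by rw [hV]; trivial
  exact this

end Generation

/-! ### Coordinates given by products of horizontal flows -/

section Coordinates

variable {E : Type*} [NormedAddCommGroup E] [NormedSpace ℝ E] [CompleteSpace E]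
  {G : Type*} [TopologicalSpace G] [ChartedSpace E G] [Group G] [LieGroup 𝓘(ℝ, E) ∞ G] [T2Space G]

/-- The differential of the multiplication at `(e, e)` is addition. Strict derivatives are carried
along because the inverse function theorem needs them. -/
lemma hasStrictFDerivAt_chart_mul {F F' : E → G} {L L' : E →L[ℝ] E}
    (hF : Continuous F) (hF' : Continuous F') (h1 : F 0 = 1) (h1' : F' 0 = 1)
    (hL : HasStrictFDerivAt (fun e => chartOne E G (F e)) L 0)
    (hL' : HasStrictFDerivAt (fun e => chartOne E G (F' e)) L' 0) :
    HasStrictFDerivAt (fun e => chartOne E G (F e * F' e)) (L + L') 0 := by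
  have hm : HasStrictFDerivAt (mulChart E G)
      (fderiv ℝ (mulChart E G) (coordOne E G, coordOne E G))
      (chartOne E G (F 0), chartOne E G (F' 0)) := by
    rw [h1, h1']
    exact (contDiffAt_mulChart (E := E) (G := G)).hasStrictFDerivAt (by simp)
  have h := HasStrictFDerivAt.comp (f := fun e => (chartOne E G (F e), chartOne E G (F' e))) 0 hm
    (hL.prodMk hL')
  have hs : ∀ {K : E → G}, Continuous K → K 0 = 1 → ∀ᶠ e in 𝓝 0, K e ∈ (chartOne E G).source := by
    intro K hK hK0
    have := hK.tendsto 0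
    rw [hK0] at this
    exact this (chartOne_source_mem_nhds (E := E))
  refine (h.congr_of_eventuallyEq ?_).congr_fderiv ?_
  · filter_upwards [hs hF h1, hs hF' h1'] with e he he'
    simp only [mulChart, (chartOne E G).left_inv he, (chartOne E G).left_inv he']
  · ext v
    have hl := DFunLike.congr_fun (fderiv_mulChart_coordOne_inl (E := E) (G := G)) (L v)
    have hr := DFunLike.congr_fun (fderiv_mulChart_coordOne_inr (E := E) (G := G)) (L' v)
    simp only [ContinuousLinearMap.comp_apply, ContinuousLinearMap.inl_apply,
      ContinuousLinearMap.inr_apply, ContinuousLinearMap.id_apply] at hl hr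
    simp only [ContinuousLinearMap.comp_apply, ContinuousLinearMap.prod_apply,
      add_apply]
    conv_rhs => rw [← hl, ← hr]
    rw [← map_add]
    simp

lemma hasStrictFDerivAt_chart_prod {n : ℕ} {F : Fin n → E → G} {L : Fin n → E →L[ℝ] E}
    (hF : ∀ i, Continuous (F i)) (h1 : ∀ i, F i 0 = 1)
    (hL : ∀ i, HasStrictFDerivAt (fun e => chartOne E G (F i e)) (L i) 0) :
    Continuous (fun e => (List.ofFn fun i => F i e).prod) ∧
      (List.ofFn fun i => F i 0).prod = 1 ∧
      HasStrictFDerivAt (fun e => chartOne E G (List.ofFn fun i => F i e).prod) (∑ i, L i) 0 := by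
  induction n with
  | zero =>
    simp only [List.ofFn_zero, List.prod_nil, Finset.univ_eq_empty, Finset.sum_empty, true_and]
    exact ⟨continuous_const, hasStrictFDerivAt_const _ _⟩
  | succ n ih =>
    obtain ⟨h2, h3, h4⟩ := ih (F := fun i => F i.succ) (L := fun i => L i.succ)
      (fun i => hF _) (fun i => h1 _) (fun i => hL _)
    simp only [List.ofFn_succ, List.prod_cons, Fin.sum_univ_succ]
    have := topologicalGroup_of_lieGroup (G := G) 𝓘(ℝ, E) ∞
    refine ⟨(hF 0).mul h2, by rw [h3, h1, mul_one], ?_⟩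
    exact hasStrictFDerivAt_chart_mul (hF 0) h2 (h1 0) h3 (hL 0) h4

/-- In the chart the curve solves an ODE with continuous right-hand side `leftChart`, so its
derivative is continuous at `0`, which upgrades differentiability to the strict sense. -/
lemma hasStrictDerivAt_chart_oneParam (X : GroupLieAlgebra 𝓘(ℝ, E) G) :
    HasStrictDerivAt (fun t => chartOne E G (oneParam X t)) X 0 := by
  have hs : ∀ᶠ t in 𝓝 (0 : ℝ), oneParam X t ∈ (chartOne E G).source := by
    have := (continuous_oneParam X).tendsto 0
    rw [oneParam_zero] at this
    exact this (chartOne_source_mem_nhds (E := E))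
  have ha := hasDerivAt_chart_oneParam X
  have hc : Tendsto (fun t => chartOne E G (oneParam X t)) (𝓝 0) (𝓝 (coordOne E G)) := by
    have := ha.continuousAt.tendsto
    rwa [oneParam_zero] at this
  have hd : ∀ᶠ t in 𝓝 (0 : ℝ), HasDerivAt (fun t => chartOne E G (oneParam X t))
      (leftChart E G X (chartOne E G (oneParam X t))) t := by
    filter_upwards [hs, hc.eventually eventually_mulChart_left] with t h1 h2
    have hA := hasMD_chartOne (E := E) h1
    have h3 := (hA.comp_curve (hasMD_oneParam X t)).hasDerivAt
    refine h3.congr_deriv ?_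
    have hA' := hA
    rw [← (chartOne E G).left_inv h1] at hA'
    have h4 := chart_leftField X h2.2 hA'
    rw [(chartOne E G).left_inv h1] at h4
    exact h4
  obtain ⟨D, hD, -⟩ := exists_second_fderiv_mulChart (E := E) (G := G)
  have h5 := hasStrictDerivAt_of_hasDerivAt_of_continuousAt hd (by
    have h6 := (hasFDerivAt_leftChart hD X).continuousAt
    have h7 : ContinuousAt (leftChart E G X) (chartOne E G (oneParam X 0)) := by
      rwa [oneParam_zero]
    exact h7.comp (f := fun t => chartOne E G (oneParam X t)) ha.continuousAt)
  have h8 : leftChart E G X (chartOne E G (oneParam X 0)) = X := by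
    rw [oneParam_zero]
    exact leftChart_coordOne (E := E) (G := G) X
  rwa [h8] at h5

lemma contDiffAt_chart_conj (h : G) :
    ContDiffAt ℝ ∞ (fun a => chartOne E G (h * (chartOne E G).symm a * h⁻¹)) (coordOne E G) := by
  rw [← contMDiffAt_iff_contDiffAt]
  have h1 : ContMDiffAt 𝓘(ℝ, E) 𝓘(ℝ, E) ∞ (fun a => h * (chartOne E G).symm a * h⁻¹)
      (coordOne E G) :=
    (contMDiffAt_const.mul contMDiffAt_chartOne_symm).mul contMDiffAt_const
  refine ContMDiffAt.comp (I' := 𝓘(ℝ, E)) _ ?_ h1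
  simp only [chartOne_symm_coordOne, mul_one, mul_inv_cancel]
  exact contMDiffAt_extChartAt

lemma hasFDerivAt_chart_conj (h : G) :
    HasFDerivAt (fun a => chartOne E G (h * (chartOne E G).symm a * h⁻¹)) (adj (E := E) h)
      (coordOne E G) := by
  have h0 := hasMD_chartOne_symm_coordOne (E := E) (G := G)
  have h1 : HasMD (fun x : G => h * x * h⁻¹) ((chartOne E G).symm (coordOne E G))
      (adj (E := E) h) := by
    rw [chartOne_symm_coordOne]; exact hasMD_conj h
  have h2 : HasMD (E := E) (E' := E) (chartOne E G)
      (h * (chartOne E G).symm (coordOne E G) * h⁻¹) (ContinuousLinearMap.id ℝ E) := by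
    rw [chartOne_symm_coordOne, mul_one, mul_inv_cancel]; exact hasMD_chartOne_one
  exact hasMD_iff_hasFDerivAt.1
    (HasMD.comp (f := fun a => h * (chartOne E G).symm a * h⁻¹) h2
      (HasMD.comp (g := fun x : G => h * x * h⁻¹) h1 h0))

lemma hasStrictDerivAt_chart_conj_oneParam (X : GroupLieAlgebra 𝓘(ℝ, E) G) (h : G) :
    HasStrictDerivAt (fun t => chartOne E G (h * oneParam X t * h⁻¹)) (adj (E := E) h X) 0 := by
  have h1 := (contDiffAt_chart_conj (E := E) h).hasStrictFDerivAt' (hasFDerivAt_chart_conj h)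
    (by simp)
  have h1' : HasStrictFDerivAt (fun a => chartOne E G (h * (chartOne E G).symm a * h⁻¹))
      (adj (E := E) h) (chartOne E G (oneParam X 0)) := by rwa [oneParam_zero]
  have h2 := h1'.comp_hasStrictDerivAt 0 (hasStrictDerivAt_chart_oneParam X)
  refine h2.congr_of_eventuallyEq ?_
  have := (continuous_oneParam X).tendsto 0
  rw [oneParam_zero] at this
  filter_upwards [this (chartOne_source_mem_nhds (E := E))] with t ht
  simp only [Function.comp_def, (chartOne E G).left_inv ht]

variable {ℓ : ℕ} (X : Fin ℓ → GroupLieAlgebra 𝓘(ℝ, E) G)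

/-- The ordered product of conjugates of one-parameter subgroups. -/
noncomputable def flowProd {n : ℕ} (h : Fin n → G) (j : Fin n → Fin ℓ) (r : Fin n → E →L[ℝ] ℝ)
    (e : E) : G :=
  (List.ofFn fun i => h i * oneParam (X (j i)) (r i e) * (h i)⁻¹).prod

variable [FiniteDimensional ℝ E]

/-- Choose a basis `bᵢ = Ad(hᵢ) X_{jᵢ}` among the spanning vectors and let `rᵢ` be its coordinate
functionals. The product of the `hᵢ exp(rᵢ(e) X_{jᵢ}) hᵢ⁻¹` has derivative `∑ rᵢ(e) bᵢ = e` at the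
origin. -/
theorem exists_flowProd_hasStrictFDerivAt (hX : HormanderCondition X) :
    ∃ (n : ℕ) (h : Fin n → G) (j : Fin n → Fin ℓ) (r : Fin n → E →L[ℝ] ℝ),
      (∀ i, h i ∈ flowGroup X) ∧ Continuous (flowProd X h j r) ∧ flowProd X h j r 0 = 1 ∧
      HasStrictFDerivAt (fun e => chartOne E G (flowProd X h j r e))
        (ContinuousLinearMap.id ℝ E) 0 := by
  have hs : ⊤ ≤ Submodule.span ℝ {w | ∃ h ∈ flowGroup X, ∃ j, w = adj (E := E) h (X j)} :=
    (adjSpan_eq_top X hX).ge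
  have hsub := Module.Basis.ofSpan_subset hs
  let b₀ := Module.Basis.ofSpan hs
  have : Fintype ((linearIndepOn_empty ℝ id).extend
    (empty_subset {w | ∃ h ∈ flowGroup X, ∃ j, w = adj (E := E) h (X j)})) :=
    FiniteDimensional.fintypeBasisIndex b₀
  let b := b₀.reindex (Fintype.equivFin _)
  have hb : ∀ i, ∃ h ∈ flowGroup X, ∃ j, b i = adj (E := E) h (X j) := fun i => by
    refine hsub ?_
    simp only [b, Module.Basis.reindex_apply]
    exact mem_range_self _
  choose h hh j hj using hb
  let r : Fin _ → E →L[ℝ] ℝ := fun i => (b.coord i).toContinuousLinearMap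
  have := topologicalGroup_of_lieGroup (G := G) 𝓘(ℝ, E) ∞
  have key := hasStrictFDerivAt_chart_prod (E := E) (G := G)
    (F := fun i e => h i * oneParam (X (j i)) (r i e) * (h i)⁻¹)
    (L := fun i => (r i).smulRight (b i))
    (fun i => by
      have := continuous_oneParam (X (j i))
      fun_prop)
    (fun i => by simp)
    (fun i => by
      have h1 := hasStrictDerivAt_chart_conj_oneParam (X (j i)) (h i)
      rw [← hj i] at h1
      have h2 : HasStrictDerivAt (fun t => chartOne E G (h i * oneParam (X (j i)) t * (h i)⁻¹))
        (b i) (r i 0) := by rwa [map_zero]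
      have h3 := h2.hasStrictFDerivAt.comp (0 : E) (r i).hasStrictFDerivAt
      refine h3.congr_fderiv ?_
      ext v
      simp)
  refine ⟨_, h, j, r, hh, key.1, key.2.1, key.2.2.congr_fderiv ?_⟩
  ext v
  simp only [sum_apply, ContinuousLinearMap.smulRight_apply,
    ContinuousLinearMap.id_apply]
  exact b.sum_repr v

lemma image_flowProd_mem_nhds {n : ℕ} {h : Fin n → G} {j : Fin n → Fin ℓ} {r : Fin n → E →L[ℝ] ℝ}
    (hc : Continuous (flowProd X h j r)) (h1 : flowProd X h j r 0 = 1)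
    (hd : HasStrictFDerivAt (fun e => chartOne E G (flowProd X h j r e))
        (ContinuousLinearMap.id ℝ E) 0) {U : Set E} (hU : U ∈ 𝓝 0) :
    flowProd X h j r '' U ∈ 𝓝 (1 : G) := by
  have hmap := hd.map_nhds_eq_of_surj (by simp)
  rw [h1] at hmap
  have hsrc : flowProd X h j r ⁻¹' (chartOne E G).source ∈ 𝓝 (0 : E) := by
    have := hc.tendsto 0
    rw [h1] at this
    exact this (chartOne_source_mem_nhds (E := E))
  have himg := image_mem_map (m := fun e => chartOne E G (flowProd X h j r e)) (inter_mem hU hsrc)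
  rw [hmap] at himg
  have hcont : ContinuousAt (chartOne E G) (1 : G) := continuousAt_extChartAt _
  filter_upwards [hcont himg, chartOne_source_mem_nhds (E := E)] with x hx hxs
  obtain ⟨e, ⟨he, hes⟩, hex⟩ := hx
  exact ⟨e, he, (chartOne E G).injOn hes hxs hex⟩

end Coordinates

/-! ### Differentiability of characters -/

section Character

variable {E : Type*} [NormedAddCommGroup E] [NormedSpace ℝ E] [CompleteSpace E]
  {G : Type*} [TopologicalSpace G] [ChartedSpace E G] [Group G] [LieGroup 𝓘(ℝ, E) ∞ G] [T2Space G]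
  {ℓ : ℕ} (X : Fin ℓ → GroupLieAlgebra 𝓘(ℝ, E) G)

lemma exists_log_character_oneParam {χ : G →* ℝ} (hχ : Continuous χ) (hpos : ∀ x, 0 < χ x)
    (Z : GroupLieAlgebra 𝓘(ℝ, E) G) :
    ∃ a : ℝ, ∀ t, Real.log (χ (oneParam Z t)) = t * a := by
  let L : ℝ →+ ℝ :=
    { toFun := fun t => Real.log (χ (oneParam Z t))
      map_zero' := by simp
      map_add' := fun s t => by
        rw [oneParam_add, map_mul, Real.log_mul (hpos _).ne' (hpos _).ne'] }
  have hL : Continuous L :=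
    (hχ.comp (continuous_oneParam Z)).log fun t => (hpos _).ne'
  let L' := L.toRealLinearMap hL
  refine ⟨L' 1, fun t => ?_⟩
  have : L' t = t * L' 1 := by
    rw [← smul_eq_mul, ← map_smul, smul_eq_mul, mul_one]
  exact this

variable [FiniteDimensional ℝ E]

/-- Differentiability must be proved: otherwise `lieDeriv Z χ 1` could be the default value `0`
instead of the drift coefficient. In the coordinates of `flowProd` the character is the exponential
of a linear form. -/
lemma mdifferentiableAt_character (hX : HormanderCondition X) {χ : G →* ℝ} (hχ : Continuous χ)
    (hpos : ∀ x, 0 < χ x) : MDifferentiableAt 𝓘(ℝ, E) 𝓘(ℝ, ℝ) χ 1 := by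
  obtain ⟨n, h, j, r, -, hc, h1, hd⟩ := exists_flowProd_hasStrictFDerivAt X hX
  choose a ha using fun j => exists_log_character_oneParam hχ hpos (X j)
  let Λ : E →L[ℝ] ℝ := ∑ i, a (j i) • r i
  -- The values of `χ` commute, so the conjugating factors `h i` cancel.
  have hΛ : ∀ e, χ (flowProd X h j r e) = Real.exp (Λ e) := by
    intro e
    have hexp : ∀ i t, χ (oneParam (X (j i)) t) = Real.exp (t * a (j i)) := fun i t => by
      rw [← ha, Real.exp_log (hpos _)]
    simp only [flowProd, map_list_prod, List.map_ofFn, List.prod_ofFn, Function.comp_def, map_mul,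
      Λ, sum_apply, Real.exp_sum]
    refine Finset.prod_congr rfl fun i _ => ?_
    rw [hexp, mul_right_comm, ← map_mul, mul_inv_cancel, map_one, one_mul]
    simp [mul_comm]
  have hd' : HasStrictFDerivAt (fun e => chartOne E G (flowProd X h j r e))
    ((ContinuousLinearEquiv.refl ℝ E : E ≃L[ℝ] E) : E →L[ℝ] E) 0 := hd
  let Φ := hd'.localInverse _ _ _
  have hΦ := hd'.to_localInverse
  have hΦr := hd'.eventually_right_inverse
  have hΦ0 := hd'.localInverse_apply_image
  rw [h1] at hΦ hΦr hΦ0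
  have hsrc : ∀ᶠ y in 𝓝 (coordOne E G), flowProd X h j r (Φ y) ∈ (chartOne E G).source := by
    have h2 : Tendsto (fun y => flowProd X h j r (Φ y)) (𝓝 (coordOne E G)) (𝓝 1) := by
      have h3 := hΦ.hasFDerivAt.continuousAt.tendsto
      rw [hΦ0] at h3
      have h4 := hc.tendsto 0
      rw [h1] at h4
      exact h4.comp h3
    exact h2 (chartOne_source_mem_nhds (E := E))
  have hcoord : ∀ᶠ y in 𝓝 (coordOne E G), χ ((chartOne E G).symm y) = Real.exp (Λ (Φ y)) := by
    filter_upwards [hsrc, hΦr] with y hy hy'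
    rw [← hΛ, ← (chartOne E G).left_inv hy, hy']
  have hcc : ContinuousAt (chartOne E G) (1 : G) := continuousAt_extChartAt _
  have hfinal : χ =ᶠ[𝓝 1] fun x => Real.exp (Λ (Φ (chartOne E G x))) := by
    filter_upwards [hcc.eventually hcoord, chartOne_source_mem_nhds (E := E)] with x hx hxs
    rwa [(chartOne E G).left_inv hxs] at hx
  have hdiff : HasMD (fun y => Real.exp (Λ (Φ y))) (chartOne E G 1) _ :=
    hasMD_iff_hasFDerivAt.2 ((Λ.hasFDerivAt.comp _ hΦ.hasFDerivAt).exp)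
  exact (hasMD_congr (hdiff.comp hasMD_chartOne_one) hfinal).mdifferentiableAt

lemma character_oneParam (hX : HormanderCondition X) {χ : G →* ℝ} (hχ : Continuous χ)
    (hpos : ∀ x, 0 < χ x) (Z : GroupLieAlgebra 𝓘(ℝ, E) G) (t : ℝ) :
    χ (oneParam Z t) = Real.exp (t * lieDeriv Z χ 1) := by
  obtain ⟨a, ha⟩ := exists_log_character_oneParam hχ hpos Z
  have hexp : ∀ t, χ (oneParam Z t) = Real.exp (t * a) := fun t => by
    rw [← ha, Real.exp_log (hpos _)]
  have h1 := hasDerivAt_comp_mul_oneParam_zero Z (mdifferentiableAt_character X hX hχ hpos)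
  simp only [one_mul, hexp] at h1
  have h2 : HasDerivAt (fun t => Real.exp (t * a)) a 0 := by
    simpa using ((hasDerivAt_id (0 : ℝ)).mul_const a).exp
  rw [hexp, h1.unique h2]

lemma hasDerivAt_character (hX : HormanderCondition X) {χ : G →* ℝ} (hχ : Continuous χ)
    (hpos : ∀ x, 0 < χ x) (Z : GroupLieAlgebra 𝓘(ℝ, E) G) (x : G) :
    HasDerivAt (fun t => χ (x * oneParam Z t)) (χ x * lieDeriv Z χ 1) 0 := by
  simp only [map_mul, character_oneParam X hX hχ hpos]
  have := (((hasDerivAt_id (0 : ℝ)).mul_const (lieDeriv Z χ 1)).exp).const_mul (χ x)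
  simpa using this

end Character

/-! ### Differentiation along flows and integration by parts -/

/-- A continuous one-parameter subgroup. -/
structure IsOneParam {G : Type*} [TopologicalSpace G] [Group G] (θ : ℝ → G) : Prop where
  continuous : Continuous θ
  map_zero : θ 0 = 1
  map_add : ∀ s t, θ (s + t) = θ s * θ t

/-- `w'` is the derivative of the compactly supported function `w` along the flow
`x ↦ x * θ t`, both being continuous. -/
structure TestPair {G : Type*} [TopologicalSpace G] [Group G] (θ : ℝ → G) (w w' : G → ℝ) :
    Prop where
  continuous : Continuous w
  continuous_deriv : Continuous w'
  hasCompactSupport : HasCompactSupport w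
  hasDerivAt : ∀ x, HasDerivAt (fun t => w (x * θ t)) (w' x) 0

/-- `g` is the derivative of `f` along the flow `x ↦ x * θ t`, in integrated form. -/
def FlowDeriv {G : Type*} [MeasurableSpace G] [Group G] (ρ : Measure G) (θ : ℝ → G)
    (f g : G → ℝ) : Prop :=
  ∀ t, ∀ᵐ x ∂ρ, f (x * θ t) - f x = ∫ s in (0 : ℝ)..t, g (x * θ s)

section Flow

variable {G : Type*} [TopologicalSpace G] [Group G] [IsTopologicalGroup G]
  {θ : ℝ → G} {w w' : G → ℝ}

lemma IsOneParam.map_neg (hθ : IsOneParam θ) (t : ℝ) : θ (-t) = (θ t)⁻¹ := by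
  rw [eq_inv_iff_mul_eq_one, ← hθ.map_add, neg_add_cancel, hθ.map_zero]

lemma IsOneParam.mul_neg_cancel (hθ : IsOneParam θ) (x : G) (t : ℝ) : x * θ (-t) * θ t = x := by
  rw [hθ.map_neg, inv_mul_cancel_right]

lemma IsOneParam.mul_cancel_neg (hθ : IsOneParam θ) (x : G) (t : ℝ) : x * θ t * θ (-t) = x := by
  rw [hθ.map_neg, mul_inv_cancel_right]

lemma TestPair.hasDerivAt_flow (hθ : IsOneParam θ) (h : TestPair θ w w') (x : G) (t : ℝ) :
    HasDerivAt (fun t => w (x * θ t)) (w' (x * θ t)) t := by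
  have h1 : HasDerivAt (fun s => w (x * θ t * θ s)) (w' (x * θ t)) (t - t) := by
    rw [sub_self]; exact h.hasDerivAt (x * θ t)
  have h2 := HasDerivAt.comp_sub_const t t h1
  refine h2.congr_of_eventuallyEq (Eventually.of_forall fun s => ?_)
  simp only [mul_assoc, ← hθ.map_add, add_sub_cancel]

lemma TestPair.deriv_eq_zero (hθ : IsOneParam θ) (h : TestPair θ w w') {x : G}
    (hx : x ∉ tsupport w) : w' x = 0 := by
  have h1 : ∀ᶠ y in 𝓝 x, w y = 0 := by
    filter_upwards [(isClosed_tsupport w).isOpen_compl.mem_nhds hx] with y hy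
    exact image_eq_zero_of_notMem_tsupport hy
  have h2 : Tendsto (fun t => x * θ t) (𝓝 0) (𝓝 x) := by
    have h3 : ContinuousAt (fun t => x * θ t) 0 :=
      (continuous_const.mul hθ.continuous).continuousAt
    simpa only [ContinuousAt, hθ.map_zero, mul_one] using h3
  refine (h.hasDerivAt x).unique ?_
  exact (hasDerivAt_const (0 : ℝ) (0 : ℝ)).congr_of_eventuallyEq (h2.eventually h1)

lemma TestPair.hasCompactSupport_deriv (hθ : IsOneParam θ) (h : TestPair θ w w') :
    HasCompactSupport w' :=
  HasCompactSupport.of_support_subset_isCompact h.hasCompactSupport fun x hx => by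
    by_contra hx'
    exact hx (h.deriv_eq_zero hθ hx')

/-- The compact set swept by `K` under the flow up to time `T`. -/
def sweep (θ : ℝ → G) (K : Set G) (T : ℝ) : Set G := K * θ '' Icc (-T) T

lemma isCompact_sweep (hθ : IsOneParam θ) {K : Set G} (hK : IsCompact K) (T : ℝ) :
    IsCompact (sweep θ K T) :=
  hK.mul (isCompact_Icc.image hθ.continuous)

lemma mul_mem_sweep {K : Set G} {T s : ℝ} {x : G} (hx : x ∈ K) (hs : |s| ≤ T) :
    x * θ s ∈ sweep θ K T :=
  mul_mem_mul hx ⟨s, abs_le.1 hs, rfl⟩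

lemma mem_sweep_of_mul_mem (hθ : IsOneParam θ) {K : Set G} {T s : ℝ} {x : G}
    (hx : x * θ (-s) ∈ K) (hs : |s| ≤ T) : x ∈ sweep θ K T := by
  have := mul_mem_sweep (θ := θ) hx hs
  rwa [hθ.mul_neg_cancel] at this

variable [T2Space G] [LocallyCompactSpace G] [SecondCountableTopology G]
  [MeasurableSpace G] [BorelSpace G]
  {ρ : Measure G} [IsFiniteMeasureOnCompacts ρ]
  {f g : G → ℝ}

/-- One integrable majorant serves all times `|s| ≤ T`: the supports of the translated functions
stay in a fixed compact sweep. -/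
lemma exists_bound_translate (hθ : IsOneParam θ) (hf : LocallyIntegrable f ρ)
    (hw : Continuous w) (hwc : HasCompactSupport w) (T : ℝ) :
    ∃ B : G → ℝ, Integrable B ρ ∧ ∀ x s, |s| ≤ T → ‖f x * w (x * θ (-s))‖ ≤ B x := by
  obtain ⟨C, hC⟩ := hwc.exists_bound_of_continuous hw
  have hK := isCompact_sweep hθ hwc T
  refine ⟨(sweep θ (tsupport w) T).indicator fun x => ‖f x‖ * C, ?_, fun x s hs => ?_⟩
  · rw [integrable_indicator_iff hK.measurableSet]
    exact ((hf.integrableOn_isCompact hK).norm).mul_const C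
  · by_cases hx : x * θ (-s) ∈ tsupport w
    · rw [indicator_of_mem (mem_sweep_of_mul_mem hθ hx hs), norm_mul]
      gcongr
      exact hC _
    · rw [image_eq_zero_of_notMem_tsupport hx, mul_zero, norm_zero]
      refine indicator_nonneg (fun y _ => ?_) x
      exact mul_nonneg (norm_nonneg _) ((norm_nonneg _).trans (hC y))

lemma aestronglyMeasurable_mul_translate (hf : LocallyIntegrable f ρ) (hw : Continuous w) (z : G) :
    AEStronglyMeasurable (fun x => f x * w (x * z)) ρ :=
  hf.aestronglyMeasurable.mul (hw.comp (continuous_mul_const z)).aestronglyMeasurable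

lemma integrable_mul_translate (hθ : IsOneParam θ) (hf : LocallyIntegrable f ρ)
    (hw : Continuous w) (hwc : HasCompactSupport w) (s : ℝ) :
    Integrable (fun x => f x * w (x * θ (-s))) ρ := by
  obtain ⟨B, hB, hb⟩ := exists_bound_translate hθ hf hw hwc |s|
  exact hB.mono' (aestronglyMeasurable_mul_translate hf hw _)
    (Eventually.of_forall fun x => hb x s le_rfl)

lemma continuous_integral_translate (hθ : IsOneParam θ) (hf : LocallyIntegrable f ρ)
    (hw : Continuous w) (hwc : HasCompactSupport w) :
    Continuous fun s => ∫ x, f x * w (x * θ (-s)) ∂ρ := by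
  refine continuous_iff_continuousAt.2 fun s => ?_
  obtain ⟨B, hB, hb⟩ := exists_bound_translate hθ hf hw hwc (|s| + 1)
  have hnear : ∀ᶠ r in 𝓝 s, |r| ≤ |s| + 1 := by
    filter_upwards [Metric.ball_mem_nhds s one_pos] with r hr
    rw [Metric.mem_ball, Real.dist_eq] at hr
    linarith [abs_sub_abs_le_abs_sub r s]
  refine continuousAt_of_dominated (bound := B) ?_ ?_ hB ?_
  · exact Eventually.of_forall fun r => aestronglyMeasurable_mul_translate hf hw _
  · filter_upwards [hnear] with r hr
    exact Eventually.of_forall fun x => hb x r hr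
  · refine Eventually.of_forall fun x => Continuous.continuousAt ?_
    have := hθ.continuous
    fun_prop

lemma hasDerivAt_integral_translate (hθ : IsOneParam θ) (hf : LocallyIntegrable f ρ)
    (h : TestPair θ w w') (t : ℝ) :
    HasDerivAt (fun s => ∫ x, f x * w (x * θ (-s)) ∂ρ) (∫ x, f x * -w' (x * θ (-t)) ∂ρ) t := by
  obtain ⟨B, hB, hb⟩ := exists_bound_translate hθ hf h.continuous_deriv
    (h.hasCompactSupport_deriv hθ) (|t| + 1)
  refine (hasDerivAt_integral_of_dominated_loc_of_deriv_le (bound := B)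
    (F' := fun s x => f x * -w' (x * θ (-s)))
    (Metric.ball_mem_nhds t one_pos) ?_ ?_ ?_ ?_ hB ?_).2
  · exact Eventually.of_forall fun r => aestronglyMeasurable_mul_translate hf h.continuous _
  · exact integrable_mul_translate hθ hf h.continuous h.hasCompactSupport t
  · exact aestronglyMeasurable_mul_translate hf h.continuous_deriv.neg _
  · refine Eventually.of_forall fun x r hr => ?_
    rw [Metric.mem_ball, Real.dist_eq] at hr
    rw [mul_neg, norm_neg]
    exact hb x r (by linarith [abs_sub_abs_le_abs_sub r t])
  · refine Eventually.of_forall fun x r _ => ?_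
    have h1 := (h.hasDerivAt_flow hθ x (-r)).scomp r (hasDerivAt_neg r)
    have h2 := h1.const_mul (f x)
    simpa [Function.comp_def] using h2

/-- By Tonelli and right invariance, each time slice is an integral over a translate of `K`, and
this translate stays in the sweep. -/
lemma setLIntegral_lintegral_flow_le [ρ.IsMulRightInvariant] (hθ : IsOneParam θ) {u : G → ℝ≥0∞}
    (hu : Measurable u) {K : Set G} (hK : IsCompact K) {T t : ℝ} (ht : |t| ≤ T) :
    ∫⁻ x in K, (∫⁻ s in uIoc 0 t, u (x * θ s)) ∂ρ ≤
      ENNReal.ofReal |t| * ∫⁻ x in sweep θ K T, u x ∂ρ := by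
  have hθc := hθ.continuous
  rw [lintegral_lintegral_swap]
  swap
  · exact (hu.comp (by fun_prop : Measurable fun p : G × ℝ => p.1 * θ p.2)).aemeasurable
  calc ∫⁻ s in uIoc 0 t, (∫⁻ x in K, u (x * θ s) ∂ρ)
      ≤ ∫⁻ s in uIoc 0 t, ∫⁻ x in sweep θ K T, u x ∂ρ := by
        refine setLIntegral_mono' measurableSet_uIoc fun s hs => ?_
        have hs' : |s| ≤ T := by
          have := Set.abs_sub_left_of_mem_uIcc (uIoc_subset_uIcc hs)
          simp only [sub_zero] at this
          exact this.trans ht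
        rw [← lintegral_indicator hK.measurableSet,
          ← lintegral_indicator (isCompact_sweep hθ hK T).measurableSet,
          ← lintegral_mul_right_eq_self ((sweep θ K T).indicator u) (θ s)]
        refine lintegral_mono fun x => ?_
        by_cases hx : x ∈ K
        · rw [indicator_of_mem hx, indicator_of_mem (mul_mem_sweep hx hs')]
        · rw [indicator_of_notMem hx]; exact zero_le
    _ = ENNReal.ofReal |t| * ∫⁻ x in sweep θ K T, u x ∂ρ := by
        rw [lintegral_const, mul_comm, Measure.restrict_apply_univ, Real.volume_uIoc, sub_zero]

lemma integrable_flow_prod [ρ.IsMulRightInvariant] (hθ : IsOneParam θ) (hg : Measurable g)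
    (hgl : LocallyIntegrable g ρ) {K : Set G} (hK : IsCompact K) (t : ℝ) :
    Integrable (fun p : G × ℝ => g (p.1 * θ p.2))
      ((ρ.restrict K).prod (volume.restrict (uIoc 0 t))) := by
  have hθc := hθ.continuous
  have hm : Measurable fun p : G × ℝ => g (p.1 * θ p.2) :=
    hg.comp (by fun_prop : Measurable fun p : G × ℝ => p.1 * θ p.2)
  refine ⟨hm.aestronglyMeasurable, ?_⟩
  rw [hasFiniteIntegral_iff_enorm, lintegral_prod _ hm.enorm.aemeasurable]
  refine (setLIntegral_lintegral_flow_le hθ hg.enorm hK le_rfl).trans_lt ?_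
  refine ENNReal.mul_lt_top ENNReal.ofReal_lt_top ?_
  have := (hgl.integrableOn_isCompact (isCompact_sweep hθ hK |t|)).hasFiniteIntegral
  rwa [hasFiniteIntegral_iff_enorm] at this

lemma ae_of_forall_isCompact {p : G → Prop}
    (h : ∀ K : Set G, IsCompact K → ∀ᵐ x ∂ρ.restrict K, p x) : ∀ᵐ x ∂ρ, p x := by
  have h1 : ∀ n, ∀ᵐ x ∂ρ.restrict (compactCovering G n), p x :=
    fun n => h _ (isCompact_compactCovering G n)
  have h2 := (ae_restrict_iUnion_iff (μ := ρ) (compactCovering G) p).2 h1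
  rwa [iUnion_compactCovering, Measure.restrict_univ] at h2

lemma ae_intervalIntegrable_flow [ρ.IsMulRightInvariant] (hθ : IsOneParam θ) (hg : Measurable g)
    (hgl : LocallyIntegrable g ρ) (t : ℝ) :
    ∀ᵐ x ∂ρ, IntervalIntegrable (fun s => g (x * θ s)) volume 0 t := by
  refine ae_of_forall_isCompact fun K hK => ?_
  filter_upwards [(integrable_flow_prod hθ hg hgl hK t).prod_right_ae] with x hx
  rw [intervalIntegrable_iff]
  exact hx

lemma integral_flow_mul [ρ.IsMulRightInvariant] (hθ : IsOneParam θ) (s : ℝ) :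
    ∫ x, g (x * θ s) * w x ∂ρ = ∫ x, g x * w (x * θ (-s)) ∂ρ := by
  rw [← integral_mul_right_eq_self (μ := ρ) (fun x => g x * w (x * θ (-s))) (θ s)]
  simp only [hθ.mul_cancel_neg]

lemma integral_intervalIntegral_flow_mul [ρ.IsMulRightInvariant] (hθ : IsOneParam θ)
    (hg : Measurable g) (hgl : LocallyIntegrable g ρ) (hw : Continuous w)
    (hwc : HasCompactSupport w) (t : ℝ) :
    Integrable (fun x => (∫ s in (0 : ℝ)..t, g (x * θ s)) * w x) ρ ∧
    ∫ x, (∫ s in (0 : ℝ)..t, g (x * θ s)) * w x ∂ρ =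
      ∫ s in (0 : ℝ)..t, ∫ x, g x * w (x * θ (-s)) ∂ρ := by
  obtain ⟨C, hC⟩ := hwc.exists_bound_of_continuous hw
  set K := tsupport w with hKdef
  have hK : IsCompact K := hwc
  have hint : Integrable (fun p : G × ℝ => g (p.1 * θ p.2) * w p.1)
      ((ρ.restrict K).prod (volume.restrict (uIoc 0 t))) :=
    (integrable_flow_prod hθ hg hgl hK t).mul_bdd (c := C)
      (hw.comp continuous_fst).aestronglyMeasurable (Eventually.of_forall fun p => hC _)
  have hsupp : ∀ F : G → ℝ, ∫ x in K, F x * w x ∂ρ = ∫ x, F x * w x ∂ρ := fun F =>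
    setIntegral_eq_integral_of_forall_compl_eq_zero fun x hx => by
      rw [image_eq_zero_of_notMem_tsupport hx, mul_zero]
  constructor
  · have h1 := hint.integral_prod_left
    have h2 : IntegrableOn (fun x => (∫ s in (0 : ℝ)..t, g (x * θ s)) * w x) K ρ := by
      rcases le_total 0 t with h | h
      · refine h1.congr (Eventually.of_forall fun x => ?_)
        simp only [intervalIntegral.integral_of_le h, uIoc_of_le h, integral_mul_const]
      · refine h1.neg.congr (Eventually.of_forall fun x => ?_)
        simp only [intervalIntegral.integral_of_ge h, uIoc_of_ge h, integral_mul_const,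
          Pi.neg_apply, neg_mul]
    refine (integrableOn_iff_integrable_of_support_subset fun x hx => ?_).1 h2
    by_contra hx'
    exact hx (by simp only [image_eq_zero_of_notMem_tsupport hx', mul_zero])
  · simp_rw [← integral_flow_mul (ρ := ρ) (g := g) (w := w) hθ]
    have hsw := integral_integral_swap (f := fun x s => g (x * θ s) * w x) hint
    simp only [integral_mul_const, hsupp] at hsw
    rcases le_total 0 t with h | h
    · simp only [intervalIntegral.integral_of_le h]
      simpa only [uIoc_of_le h] using hsw
    · simp only [intervalIntegral.integral_of_ge h, neg_mul, integral_neg]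
      rw [neg_inj]
      simpa only [uIoc_of_ge h] using hsw

/-- Right invariance moves the flow from `f` to the test function. The function `t ↦ ∫ f(x) w(x
θ(-t)) dρ` then has two expressions, and their derivatives at `t = 0` are compared. -/
lemma FlowDeriv.integral_mul_deriv [ρ.IsMulRightInvariant] (hθ : IsOneParam θ)
    (h : FlowDeriv ρ θ f g) (hf : LocallyIntegrable f ρ)
    (hg : Measurable g) (hgl : LocallyIntegrable g ρ) (hw : TestPair θ w w') :
    ∫ x, f x * w' x ∂ρ = -∫ x, g x * w x ∂ρ := by
  have h1 : ∀ t, (∫ x, f x * w (x * θ (-t)) ∂ρ) - ∫ x, f x * w x ∂ρ =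
      ∫ s in (0 : ℝ)..t, ∫ x, g x * w (x * θ (-s)) ∂ρ := by
    intro t
    rw [← (integral_intervalIntegral_flow_mul hθ hg hgl hw.continuous hw.hasCompactSupport t).2,
      ← integral_flow_mul hθ t, ← integral_sub]
    · refine integral_congr_ae ?_
      filter_upwards [h t] with x hx
      rw [← hx]; ring
    · have h2 := (integrable_mul_translate hθ hf hw.continuous hw.hasCompactSupport t).comp_mul_right
        (θ t)
      simpa only [hθ.mul_cancel_neg] using h2
    · simpa [hθ.map_zero] using
        integrable_mul_translate hθ hf hw.continuous hw.hasCompactSupport 0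
  have h2 := (hasDerivAt_integral_translate hθ hf hw 0).sub_const (∫ x, f x * w x ∂ρ)
  have hc := continuous_integral_translate hθ hgl hw.continuous hw.hasCompactSupport
  have h3 := intervalIntegral.integral_hasDerivAt_right (hc.intervalIntegrable 0 0)
    (hc.stronglyMeasurableAtFilter _ _) hc.continuousAt
  have h4 := h2.congr_of_eventuallyEq (Eventually.of_forall fun t => (h1 t).symm)
  have h5 := h4.unique h3
  simp only [neg_zero, hθ.map_zero, mul_one, mul_neg, integral_neg] at h5
  rw [← h5, neg_neg]

end Flow

/-! ### Squares and translation estimates along orbits -/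

/-- A primitive of an integrable function is absolutely continuous, so the product rule for
absolutely continuous functions applies. -/
lemma sq_primitive_sub {γ : ℝ → ℝ} {t : ℝ} (hγ : IntervalIntegrable γ volume 0 t) (c : ℝ) :
    (c + ∫ s in (0 : ℝ)..t, γ s) ^ 2 - c ^ 2 =
      ∫ s in (0 : ℝ)..t, 2 * (c + ∫ r in (0 : ℝ)..s, γ r) * γ s := by
  have hP : AbsolutelyContinuousOnInterval (fun s => ∫ r in (0 : ℝ)..s, γ r) 0 t :=
    hγ.absolutelyContinuousOnInterval_intervalIntegral (by simp)
  have hc : AbsolutelyContinuousOnInterval (fun _ : ℝ => c) 0 t :=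
    (LipschitzWith.const c).lipschitzOnWith.absolutelyContinuousOnInterval
  have hQ := hc.fun_add hP
  have h := hQ.integral_deriv_mul_eq_sub hQ
  simp only [intervalIntegral.integral_same, add_zero] at h
  rw [sq, sq, ← h]
  refine intervalIntegral.integral_congr_ae ?_
  filter_upwards [hγ.ae_hasDerivAt_integral] with s hs hs'
  have h1 := ((hs (uIoc_subset_uIcc hs') 0 (by simp)).const_add c).deriv
  rw [h1]; ring

lemma enorm_intervalIntegral_sq_le {γ : ℝ → ℝ} (hγ : Measurable γ) (t : ℝ) :
    ‖∫ s in (0 : ℝ)..t, γ s‖ₑ ^ 2 ≤ ENNReal.ofReal |t| * ∫⁻ s in uIoc 0 t, ‖γ s‖ₑ ^ 2 := by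
  have h1 : ‖∫ s in (0 : ℝ)..t, γ s‖ₑ ≤ ∫⁻ s in uIoc 0 t, ‖γ s‖ₑ := by
    rw [← ofReal_norm, intervalIntegral.norm_intervalIntegral_eq, ofReal_norm]
    exact enorm_integral_le_lintegral_enorm _
  have h2 := ENNReal.lintegral_mul_le_Lp_mul_Lq (volume.restrict (uIoc 0 t))
    Real.HolderConjugate.two_two (f := fun _ => 1) (g := fun s => ‖γ s‖ₑ) aemeasurable_const
    hγ.enorm.aemeasurable
  simp only [Pi.mul_apply, one_mul, one_pow, lintegral_const, Measure.restrict_apply_univ,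
    Real.volume_uIoc, sub_zero, ENNReal.rpow_two] at h2
  calc ‖∫ s in (0 : ℝ)..t, γ s‖ₑ ^ 2
      ≤ (ENNReal.ofReal |t| ^ (1 / 2 : ℝ) * (∫⁻ s in uIoc 0 t, ‖γ s‖ₑ ^ 2) ^ (1 / 2 : ℝ)) ^ 2 := by
        gcongr; exact h1.trans h2
    _ = _ := by
        rw [mul_pow, ← ENNReal.rpow_natCast, ← ENNReal.rpow_natCast, ← ENNReal.rpow_mul,
          ← ENNReal.rpow_mul]
        norm_num

section Flow

variable {G : Type*} [TopologicalSpace G] [Group G] [IsTopologicalGroup G]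
  [T2Space G] [LocallyCompactSpace G] [SecondCountableTopology G]
  [MeasurableSpace G] [BorelSpace G]
  {ρ : Measure G} [IsFiniteMeasureOnCompacts ρ] [ρ.IsMulRightInvariant]
  {θ : ℝ → G} {f g : G → ℝ}

lemma measurable_primitive_flow (hθ : IsOneParam θ) (hg : Measurable g) :
    Measurable fun p : G × ℝ => ∫ r in (0 : ℝ)..p.2, g (p.1 * θ r) := by
  have hθc := hθ.continuous
  -- Rescaling to the fixed interval `(0, 1]` leaves a parametric integral over one measure, whose
  -- measurability is standard.
  have h1 : (fun p : G × ℝ => ∫ r in (0 : ℝ)..p.2, g (p.1 * θ r)) =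
      fun p : G × ℝ => p.2 * ∫ r in Ioc (0 : ℝ) 1, g (p.1 * θ (p.2 * r)) := by
    ext p
    have := intervalIntegral.mul_integral_comp_mul_left (f := fun r => g (p.1 * θ r)) (a := 0)
      (b := 1) p.2
    rw [mul_zero, mul_one] at this
    rw [← this, intervalIntegral.integral_of_le zero_le_one]
  rw [h1]
  refine measurable_snd.mul ?_
  have h2 : StronglyMeasurable
      (Function.uncurry fun (p : G × ℝ) (r : ℝ) => g (p.1 * θ (p.2 * r))) :=
    (hg.comp (by fun_prop : Measurable fun q : (G × ℝ) × ℝ => q.1.1 * θ (q.1.2 * q.2))).stronglyMeasurable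
  exact h2.integral_prod_right.measurable

/-- The chain rule holds orbit by orbit. It requires, for almost every `x`, the integrated identity
at almost every time `s`; the hypothesis has the quantifiers in the other order, and Fubini
exchanges them. -/
lemma FlowDeriv.sq (hθ : IsOneParam θ) (h : FlowDeriv ρ θ f g) (hf : Measurable f)
    (hg : Measurable g) (hgl : LocallyIntegrable g ρ) :
    FlowDeriv ρ θ (fun x => f x ^ 2) (fun x => 2 * f x * g x) := by
  intro t
  have hθc := hθ.continuous
  have hmeas : MeasurableSet {p : G × ℝ | f (p.1 * θ p.2) - f p.1 =
      ∫ r in (0 : ℝ)..p.2, g (p.1 * θ r)} := by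
    refine measurableSet_eq_fun ?_ (measurable_primitive_flow hθ hg)
    exact (hf.comp (by fun_prop : Measurable fun p : G × ℝ => p.1 * θ p.2)).sub
      (hf.comp measurable_fst)
  have hae : ∀ᵐ x ∂ρ, ∀ᵐ s : ℝ, f (x * θ s) - f x = ∫ r in (0 : ℝ)..s, g (x * θ r) :=
    (Measure.ae_ae_comm hmeas).2 (Eventually.of_forall h)
  filter_upwards [hae, h t, ae_intervalIntegrable_flow hθ hg hgl t] with x h1 h2 h3
  have h4 := sq_primitive_sub h3 (f x)
  rw [← h2, add_sub_cancel] at h4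
  rw [h4]
  refine intervalIntegral.integral_congr_ae ?_
  filter_upwards [h1] with s hs _
  rw [← hs, add_sub_cancel]

lemma FlowDeriv.sub_const (h : FlowDeriv ρ θ f g) (a : ℝ) :
    FlowDeriv ρ θ (fun x => f x - a) g := by
  intro t
  filter_upwards [h t] with x hx
  rw [← hx]; ring

/-- A function with square integrable derivative along a flow is close to its translates. -/
lemma FlowDeriv.setLIntegral_translate_le (hθ : IsOneParam θ) (h : FlowDeriv ρ θ f g)
    (hg : Measurable g) {K : Set G} (hK : IsCompact K) {T t : ℝ} (ht : |t| ≤ T) :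
    ∫⁻ x in K, ‖f (x * θ t) - f x‖ₑ ^ 2 ∂ρ ≤
      ENNReal.ofReal (T ^ 2) * ∫⁻ x in sweep θ K T, ‖g x‖ₑ ^ 2 ∂ρ := by
  have hθc := hθ.continuous
  calc ∫⁻ x in K, ‖f (x * θ t) - f x‖ₑ ^ 2 ∂ρ
      ≤ ∫⁻ x in K, ENNReal.ofReal |t| * (∫⁻ s in uIoc 0 t, ‖g (x * θ s)‖ₑ ^ 2) ∂ρ := by
        refine lintegral_mono_ae (ae_restrict_of_ae ?_)
        filter_upwards [h t] with x hx
        rw [hx]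
        exact enorm_intervalIntegral_sq_le
          (hg.comp (by fun_prop : Measurable fun s => x * θ s)) t
    _ = ENNReal.ofReal |t| * ∫⁻ x in K, (∫⁻ s in uIoc 0 t, ‖g (x * θ s)‖ₑ ^ 2) ∂ρ :=
        lintegral_const_mul' _ _ ENNReal.ofReal_ne_top
    _ ≤ ENNReal.ofReal |t| * (ENNReal.ofReal |t| * ∫⁻ x in sweep θ K T, ‖g x‖ₑ ^ 2 ∂ρ) := by
        gcongr
        exact setLIntegral_lintegral_flow_le hθ (hg.enorm.pow_const 2) hK ht
    _ ≤ ENNReal.ofReal (T ^ 2) * ∫⁻ x in sweep θ K T, ‖g x‖ₑ ^ 2 ∂ρ := by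
        rw [← mul_assoc, ← ENNReal.ofReal_mul (abs_nonneg t)]
        gcongr
        nlinarith [abs_nonneg t]

end Flow

/-! ### From distributional derivatives to derivatives along the flow -/

section Weak

variable {E : Type*} [NormedAddCommGroup E] [NormedSpace ℝ E] [CompleteSpace E]
  {G : Type*} [TopologicalSpace G] [ChartedSpace E G] [Group G] [LieGroup 𝓘(ℝ, E) ∞ G] [T2Space G]

lemma isOneParam_oneParam (Z : GroupLieAlgebra 𝓘(ℝ, E) G) : IsOneParam (oneParam Z) :=
  ⟨continuous_oneParam Z, oneParam_zero Z, oneParam_add Z⟩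

lemma continuous_lieDeriv {Z : GroupLieAlgebra 𝓘(ℝ, E) G} {u : G → ℝ}
    (hu : ContMDiff 𝓘(ℝ, E) 𝓘(ℝ, ℝ) 1 u) : Continuous (lieDeriv Z u) := by
  have h1 := (contMDiff_mulInvariantVectorField_one Z).continuous
  have h2 := hu.continuous_tangentMap le_rfl
  have h3 := h2.comp h1
  have h4 := (continuous_snd.comp (tangentBundleModelSpaceHomeomorph 𝓘(ℝ, ℝ)).continuous).comp h3
  exact h4

lemma testPair_lieDeriv (Z : GroupLieAlgebra 𝓘(ℝ, E) G) {φ : G → ℝ}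
    (hφ : ContMDiff 𝓘(ℝ, E) 𝓘(ℝ, ℝ) 1 φ) (hc : HasCompactSupport φ) :
    TestPair (oneParam Z) φ (lieDeriv Z φ) :=
  ⟨hφ.continuous, continuous_lieDeriv hφ, hc,
    fun x => hasDerivAt_comp_mul_oneParam_zero Z (hφ.mdifferentiable (by simp) x)⟩

variable [FiniteDimensional ℝ E]
  [IsTopologicalGroup G] [LocallyCompactSpace G] [SecondCountableTopology G]
  [MeasurableSpace G] [BorelSpace G]
  {ρ : Measure G} [IsFiniteMeasureOnCompacts ρ] [ρ.IsMulRightInvariant]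
  {f g : G → ℝ}

lemma lieDeriv_translate (Z : GroupLieAlgebra 𝓘(ℝ, E) G) {φ : G → ℝ}
    (hφ : ContMDiff 𝓘(ℝ, E) 𝓘(ℝ, ℝ) 1 φ) (s : ℝ) (x : G) :
    lieDeriv Z (fun y => φ (y * oneParam Z s)) x = lieDeriv Z φ (x * oneParam Z s) := by
  have h1 : ContMDiff 𝓘(ℝ, E) 𝓘(ℝ, ℝ) 1 (fun y => φ (y * oneParam Z s)) :=
    hφ.comp ((contMDiff_mul_right (I := 𝓘(ℝ, E)) (n := ∞)).of_le (by simp))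
  have h2 := hasDerivAt_comp_mul_oneParam_zero Z (h1.mdifferentiable (by simp) x)
  have h3 := hasDerivAt_comp_mul_oneParam_zero Z
    (hφ.mdifferentiable (by simp) (x * oneParam Z s))
  simp only [mul_assoc, oneParam_comm Z s] at h2 h3
  exact h2.unique h3

/-- The field `Z` commutes with right translation by its own flow, so testing against `φ(x
exp(-sZ))` gives the derivative of `s ↦ ∫ f(x) φ(x exp(-sZ)) dρ` as the same integral with `g`.
Integrating in `s` and changing variables, the desired identity holds against every `φ`, hence
almost everywhere. -/
lemma flowDeriv_of_weak (Z : GroupLieAlgebra 𝓘(ℝ, E) G) (hf : LocallyIntegrable f ρ)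
    (hg : Measurable g) (hgl : LocallyIntegrable g ρ)
    (h : ∀ φ : G → ℝ, ContMDiff 𝓘(ℝ, E) 𝓘(ℝ, ℝ) ∞ φ → HasCompactSupport φ →
      ∫ x, f x * lieDeriv Z φ x ∂ρ = -∫ x, g x * φ x ∂ρ) :
    FlowDeriv ρ (oneParam Z) f g := by
  intro t
  have hθ := isOneParam_oneParam Z
  have htrans : LocallyIntegrable (fun x => f (x * oneParam Z t)) ρ := by
    have h1 := (locallyIntegrable_map_homeomorph (μ := ρ) (Homeomorph.mulRight (oneParam Z t))
      (f := f)).1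
    simp only [Homeomorph.coe_mulRight, map_mul_right_eq_self] at h1
    exact h1 hf
  have hprim : LocallyIntegrable (fun x => ∫ s in (0 : ℝ)..t, g (x * oneParam Z s)) ρ := by
    refine (locallyIntegrable_iff).2 fun K hK => ?_
    have h1 := (integrable_flow_prod hθ hg hgl hK t).integral_prod_left
    rcases le_total 0 t with h | h
    · simp only [uIoc_of_le h] at h1
      simp only [intervalIntegral.integral_of_le h]
      exact h1
    · simp only [uIoc_of_ge h] at h1
      simp only [intervalIntegral.integral_of_ge h]
      exact h1.neg
  have hzero := ae_eq_zero_of_integral_contMDiff_smul_eq_zero 𝓘(ℝ, E) (μ := ρ)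
    (f := fun x => f (x * oneParam Z t) - f x - ∫ s in (0 : ℝ)..t, g (x * oneParam Z s))
    ((htrans.sub hf).sub hprim) ?_
  · filter_upwards [hzero] with x hx
    linarith
  intro φ hφ hc
  have hφ1 : ContMDiff 𝓘(ℝ, E) 𝓘(ℝ, ℝ) 1 φ := hφ.of_le (by simp)
  have hpair := testPair_lieDeriv Z hφ1 hc
  have hprod := integral_intervalIntegral_flow_mul hθ hg hgl hpair.continuous hc t
  have hI1 : Integrable (fun x => f (x * oneParam Z t) * φ x) ρ := by
    have h2 := (integrable_mul_translate hθ hf hpair.continuous hc t).comp_mul_right (oneParam Z t)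
    simpa only [hθ.mul_cancel_neg] using h2
  have hI0 : Integrable (fun x => f x * φ x) ρ := by
    simpa [hθ.map_zero] using integrable_mul_translate hθ hf hpair.continuous hc 0
  have hderiv : ∀ s, HasDerivAt (fun s => ∫ x, f x * φ (x * oneParam Z (-s)) ∂ρ)
      (∫ x, g x * φ (x * oneParam Z (-s)) ∂ρ) s := by
    intro s
    refine (hasDerivAt_integral_translate hθ hf hpair s).congr_deriv ?_
    have hs := h (fun y => φ (y * oneParam Z (-s)))
      (hφ.comp (contMDiff_mul_right (I := 𝓘(ℝ, E)) (n := ∞)))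
      (hc.comp_homeomorph (Homeomorph.mulRight (oneParam Z (-s))))
    simp only [lieDeriv_translate Z hφ1] at hs
    simp only [mul_neg, integral_neg, hs, neg_neg]
  have hFTC := intervalIntegral.integral_eq_sub_of_hasDerivAt (a := 0) (b := t)
    (fun s _ => hderiv s)
    ((continuous_integral_translate hθ hgl hpair.continuous hc).intervalIntegrable 0 t)
  have hexp : ∀ x, φ x • (f (x * oneParam Z t) - f x - ∫ s in (0 : ℝ)..t, g (x * oneParam Z s)) =
      f (x * oneParam Z t) * φ x - f x * φ x -
        (∫ s in (0 : ℝ)..t, g (x * oneParam Z s)) * φ x := by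
    intro x; rw [smul_eq_mul]; ring
  simp only [hexp]
  have hI10 : Integrable (fun x => f (x * oneParam Z t) * φ x - f x * φ x) ρ := hI1.sub hI0
  rw [integral_sub hI10 hprod.1, integral_sub hI1 hI0, hprod.2, hFTC,
    integral_flow_mul hθ t]
  simp [hθ.map_zero]

end Weak

lemma enorm_add_sq_le (a b : ℝ) : ‖a + b‖ₑ ^ 2 ≤ 2 * ‖a‖ₑ ^ 2 + 2 * ‖b‖ₑ ^ 2 := by
  have h : ∀ c : ℝ, ‖c‖ₑ ^ 2 = ENNReal.ofReal (c ^ 2) := fun c => by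
    rw [← ofReal_norm, ← ENNReal.ofReal_pow (norm_nonneg _), Real.norm_eq_abs, sq_abs]
  rw [h, h, h, show (2 : ℝ≥0∞) = ENNReal.ofReal 2 by simp, ← ENNReal.ofReal_mul zero_le_two,
    ← ENNReal.ofReal_mul zero_le_two, ← ENNReal.ofReal_add (by positivity) (by positivity)]
  exact ENNReal.ofReal_le_ofReal (by nlinarith [sq_nonneg (a - b)])

/-! ### Control of translations and the local Poincaré inequality -/

section Controlled

variable {E : Type*} [NormedAddCommGroup E] [NormedSpace ℝ E] [CompleteSpace E]
  {G : Type*} [TopologicalSpace G] [ChartedSpace E G] [Group G] [LieGroup 𝓘(ℝ, E) ∞ G] [T2Space G]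
  [MeasurableSpace G]
  {ℓ : ℕ} (X : Fin ℓ → GroupLieAlgebra 𝓘(ℝ, E) G) (ρ : Measure G)

/-- `g` is the horizontal gradient of the measurable function `f`, in integrated form. -/
structure FlowGrad (f : G → ℝ) (g : Fin ℓ → G → ℝ) : Prop where
  measurable : Measurable f
  measurable_grad : ∀ j, Measurable (g j)
  flowDeriv : ∀ j, FlowDeriv ρ (oneParam (X j)) f (g j)

/-- Right translations by elements of `A` are controlled in `L²` on compact sets by the horizontal
gradient. -/
def Controlled (A : Set G) : Prop :=
  ∀ K : Set G, IsCompact K → ∃ K' : Set G, IsCompact K' ∧ ∃ C : ℝ≥0∞, C ≠ ⊤ ∧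
    ∀ f g, FlowGrad X ρ f g → ∀ z ∈ A,
      ∫⁻ x in K, ‖f (x * z) - f x‖ₑ ^ 2 ∂ρ ≤ C * ∫⁻ x in K', ∑ j, ‖g j x‖ₑ ^ 2 ∂ρ

variable {X ρ}

lemma Controlled.mono {A B : Set G} (hB : Controlled X ρ B) (h : A ⊆ B) : Controlled X ρ A := by
  intro K hK
  obtain ⟨K', hK', C, hC, h1⟩ := hB K hK
  exact ⟨K', hK', C, hC, fun f g hfg z hz => h1 f g hfg z (h hz)⟩

lemma Controlled.union {A B : Set G} (hA : Controlled X ρ A) (hB : Controlled X ρ B) :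
    Controlled X ρ (A ∪ B) := by
  intro K hK
  obtain ⟨K₁, hK₁, C₁, hC₁, h₁⟩ := hA K hK
  obtain ⟨K₂, hK₂, C₂, hC₂, h₂⟩ := hB K hK
  refine ⟨K₁ ∪ K₂, hK₁.union hK₂, C₁ + C₂, ENNReal.add_ne_top.2 ⟨hC₁, hC₂⟩, ?_⟩
  rintro f g hfg z (hz | hz)
  · refine (h₁ f g hfg z hz).trans ?_
    gcongr
    · exact le_self_add
    · exact subset_union_left
  · refine (h₂ f g hfg z hz).trans ?_
    gcongr
    · exact le_add_self
    · exact subset_union_right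

lemma controlled_one : Controlled X ρ {(1 : G)} := by
  intro K hK
  refine ⟨K, hK, 0, by simp, fun f g _ z hz => ?_⟩
  simp [mem_singleton_iff.1 hz]

variable [IsTopologicalGroup G] [LocallyCompactSpace G] [SecondCountableTopology G]
  [BorelSpace G] [IsFiniteMeasureOnCompacts ρ] [ρ.IsMulRightInvariant]

lemma controlled_oneParam (j : Fin ℓ) (T : ℝ) :
    Controlled X ρ (oneParam (X j) '' Icc (-T) T) := by
  intro K hK
  have hθ := isOneParam_oneParam (X j)
  refine ⟨sweep (oneParam (X j)) K T, isCompact_sweep hθ hK T, ENNReal.ofReal (T ^ 2), by simp, ?_⟩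
  rintro f g hfg _ ⟨t, ht, rfl⟩
  refine ((hfg.flowDeriv j).setLIntegral_translate_le hθ (hfg.measurable_grad j) hK
    (abs_le.2 ht)).trans ?_
  gcongr with x
  exact Finset.single_le_sum (f := fun j => ‖g j x‖ₑ ^ 2) (fun _ _ => zero_le) (Finset.mem_univ j)

lemma setLIntegral_translate {K : Set G} (hK : IsCompact K) (u : G → ℝ≥0∞) (z : G) :
    ∫⁻ x in K, u (x * z) ∂ρ = ∫⁻ x in K * {z}, u x ∂ρ := by
  rw [← lintegral_indicator hK.measurableSet,
    ← lintegral_indicator (hK.mul isCompact_singleton).measurableSet,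
    ← lintegral_mul_right_eq_self ((K * {z}).indicator u) z]
  refine lintegral_congr fun x => ?_
  by_cases hx : x ∈ K
  · rw [indicator_of_mem hx, indicator_of_mem (by simpa [mul_singleton] using hx)]
  · rw [indicator_of_notMem hx, indicator_of_notMem (by simpa [mul_singleton] using hx)]

/-- Split `f(xab) - f(x)` at `f(xa)`. The first difference is estimated on `K a ⊆ K L`, so `A` must
be relatively compact for the choice of `K'` and `C` to be uniform. -/
lemma Controlled.mul {A B L : Set G} (hA : Controlled X ρ A) (hB : Controlled X ρ B)
    (hL : IsCompact L) (hAL : A ⊆ L) : Controlled X ρ (A * B) := by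
  intro K hK
  obtain ⟨K₁, hK₁, C₁, hC₁, h₁⟩ := hA K hK
  obtain ⟨K₂, hK₂, C₂, hC₂, h₂⟩ := hB (K * L) (hK.mul hL)
  refine ⟨K₁ ∪ K₂, hK₁.union hK₂, 2 * C₂ + 2 * C₁,
    ENNReal.add_ne_top.2 ⟨ENNReal.mul_ne_top ENNReal.ofNat_ne_top hC₂, ENNReal.mul_ne_top ENNReal.ofNat_ne_top hC₁⟩, ?_⟩
  rintro f g hfg _ ⟨a, ha, b, hb, rfl⟩
  have hfm := hfg.measurable
  calc ∫⁻ x in K, ‖f (x * (a * b)) - f x‖ₑ ^ 2 ∂ρ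
      ≤ ∫⁻ x in K, (2 * ‖f (x * a * b) - f (x * a)‖ₑ ^ 2 + 2 * ‖f (x * a) - f x‖ₑ ^ 2) ∂ρ := by
        refine lintegral_mono fun x => ?_
        have := enorm_add_sq_le (f (x * a * b) - f (x * a)) (f (x * a) - f x)
        rw [sub_add_sub_cancel] at this
        simpa only [mul_assoc] using this
    _ = 2 * ∫⁻ x in K, ‖f (x * a * b) - f (x * a)‖ₑ ^ 2 ∂ρ +
          2 * ∫⁻ x in K, ‖f (x * a) - f x‖ₑ ^ 2 ∂ρ := by
        rw [lintegral_add_right, lintegral_const_mul', lintegral_const_mul'] <;> try simp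
        fun_prop
    _ ≤ 2 * (C₂ * ∫⁻ x in K₂, ∑ j, ‖g j x‖ₑ ^ 2 ∂ρ) +
          2 * (C₁ * ∫⁻ x in K₁, ∑ j, ‖g j x‖ₑ ^ 2 ∂ρ) := by
        gcongr
        · rw [setLIntegral_translate hK (fun y => ‖f (y * b) - f y‖ₑ ^ 2) a]
          refine (lintegral_mono_set ?_).trans (h₂ f g hfg b hb)
          exact mul_subset_mul_left (singleton_subset_iff.2 (hAL ha))
        · exact h₁ f g hfg a ha
    _ ≤ 2 * (C₂ * ∫⁻ x in K₁ ∪ K₂, ∑ j, ‖g j x‖ₑ ^ 2 ∂ρ) +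
          2 * (C₁ * ∫⁻ x in K₁ ∪ K₂, ∑ j, ‖g j x‖ₑ ^ 2 ∂ρ) := by
        gcongr
        · exact subset_union_right
        · exact subset_union_left
    _ = _ := by ring

lemma controlled_inv_singleton {a : G} (ha : Controlled X ρ {a}) : Controlled X ρ {a⁻¹} := by
  intro K hK
  obtain ⟨K', hK', C, hC, h⟩ := ha (K * {a⁻¹}) (hK.mul isCompact_singleton)
  refine ⟨K', hK', C, hC, fun f g hfg z hz => ?_⟩
  rw [mem_singleton_iff.1 hz]
  refine le_trans (le_of_eq ?_) (h f g hfg a rfl)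
  rw [← setLIntegral_translate hK (fun y => ‖f (y * a) - f y‖ₑ ^ 2) a⁻¹]
  refine lintegral_congr fun x => ?_
  rw [inv_mul_cancel_right, ← enorm_neg, neg_sub]

lemma controlled_singleton_of_mem {a : G} (ha : a ∈ flowGroup X) : Controlled X ρ {a} := by
  induction ha using Subgroup.closure_induction with
  | mem x hx =>
    obtain ⟨j, t, rfl⟩ := hx
    exact (controlled_oneParam j |t|).mono
      (singleton_subset_iff.2 ⟨t, abs_le.1 le_rfl, rfl⟩)
  | one => exact controlled_one
  | mul x y _ _ hx hy =>
    have := hx.mul hy isCompact_singleton subset_rfl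
    rwa [singleton_mul_singleton] at this
  | inv x _ hx => exact controlled_inv_singleton hx

variable (X ρ) in
/-- Relatively compact controlled sets. -/
def CompactlyControlled (A : Set G) : Prop := Controlled X ρ A ∧ ∃ L, IsCompact L ∧ A ⊆ L

lemma CompactlyControlled.mono {A B : Set G} (hB : CompactlyControlled X ρ B) (h : A ⊆ B) :
    CompactlyControlled X ρ A :=
  ⟨hB.1.mono h, hB.2.imp fun _ hL => ⟨hL.1, h.trans hL.2⟩⟩

lemma CompactlyControlled.union {A B : Set G} (hA : CompactlyControlled X ρ A)
    (hB : CompactlyControlled X ρ B) : CompactlyControlled X ρ (A ∪ B) := by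
  obtain ⟨hA, L, hL, hAL⟩ := hA
  obtain ⟨hB, L', hL', hBL⟩ := hB
  exact ⟨hA.union hB, L ∪ L', hL.union hL', union_subset_union hAL hBL⟩

lemma CompactlyControlled.mul {A B : Set G} (hA : CompactlyControlled X ρ A)
    (hB : CompactlyControlled X ρ B) : CompactlyControlled X ρ (A * B) := by
  obtain ⟨hA, L, hL, hAL⟩ := hA
  obtain ⟨hB, L', hL', hBL⟩ := hB
  exact ⟨hA.mul hB hL hAL, L * L', hL.mul hL', mul_subset_mul hAL hBL⟩

lemma compactlyControlled_singleton {a : G} (ha : a ∈ flowGroup X) :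
    CompactlyControlled X ρ {a} :=
  ⟨controlled_singleton_of_mem ha, _, isCompact_singleton, subset_rfl⟩

lemma compactlyControlled_list_prod {n : ℕ} {A : Fin n → Set G}
    (hA : ∀ i, CompactlyControlled X ρ (A i)) :
    CompactlyControlled X ρ {z | ∃ s : Fin n → G, (∀ i, s i ∈ A i) ∧ z = (List.ofFn s).prod} := by
  induction n with
  | zero =>
    refine (compactlyControlled_singleton (one_mem _)).mono ?_
    rintro z ⟨s, -, rfl⟩
    simp
  | succ n ih =>
    refine ((hA 0).mul (ih fun i => hA i.succ)).mono ?_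
    rintro z ⟨s, hs, rfl⟩
    rw [List.ofFn_succ, List.prod_cons]
    exact mul_mem_mul (hs 0) ⟨fun i => s i.succ, fun i => hs _, rfl⟩

variable [FiniteDimensional ℝ E]

lemma exists_compactlyControlled_nhds_one (hX : HormanderCondition X) :
    ∃ U ∈ 𝓝 (1 : G), CompactlyControlled X ρ U := by
  obtain ⟨n, h, j, r, hh, hc, h1, hd⟩ := exists_flowProd_hasStrictFDerivAt X hX
  refine ⟨flowProd X h j r '' Metric.closedBall 0 1,
    image_flowProd_mem_nhds X hc h1 hd (Metric.closedBall_mem_nhds 0 one_pos), ?_⟩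
  -- For `‖e‖ ≤ 1` the flow time `r i e` is at most `‖r i‖` in absolute value.
  have hA : ∀ i, CompactlyControlled X ρ
      ({h i} * oneParam (X (j i)) '' Icc (-‖r i‖) ‖r i‖ * {(h i)⁻¹}) := fun i =>
    ((compactlyControlled_singleton (hh i)).mul ⟨controlled_oneParam _ _, _,
      isCompact_Icc.image (continuous_oneParam _), subset_rfl⟩).mul
      (compactlyControlled_singleton (inv_mem (hh i)))
  refine (compactlyControlled_list_prod hA).mono ?_
  rintro _ ⟨e, he, rfl⟩
  refine ⟨_, fun i => ?_, rfl⟩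
  refine mul_mem_mul (mul_mem_mul rfl ⟨r i e, abs_le.1 ?_, rfl⟩) rfl
  have h2 := (r i).le_opNorm e
  rw [mem_closedBall_zero_iff] at he
  rw [← Real.norm_eq_abs]
  exact h2.trans (mul_le_of_le_one_right (norm_nonneg _) he)

/-- The points with a controlled neighbourhood form an open and closed set: if `y` is such a point,
with neighbourhood `N`, and `y⁻¹ z` is interior to `U`, then `N * U` is a controlled neighbourhood
of `z`. -/
lemma exists_compactlyControlled_nhds [ConnectedSpace G] (hX : HormanderCondition X) (z : G) :
    ∃ N ∈ 𝓝 z, CompactlyControlled X ρ N := by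
  obtain ⟨U, hU, hUc⟩ := exists_compactlyControlled_nhds_one (ρ := ρ) hX
  set S : Set G := {z | ∃ N ∈ 𝓝 z, CompactlyControlled X ρ N} with hS
  have hopen : IsOpen S := by
    rw [isOpen_iff_mem_nhds]
    rintro z ⟨N, hN, hc⟩
    filter_upwards [eventually_mem_nhds_iff.2 hN] with y hy using ⟨N, hy, hc⟩
  have hclosed : IsClosed S := by
    refine isClosed_of_closure_subset fun z hz => ?_
    have h1 : Tendsto (fun y : G => y⁻¹ * z) (𝓝 z) (𝓝 1) := by
      have : ContinuousAt (fun y : G => y⁻¹ * z) z := by fun_prop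
      simpa [ContinuousAt] using this
    obtain ⟨y, hy, N, hN, hNc⟩ := mem_closure_iff_nhds.1 hz _ (h1 (eventually_mem_nhds_iff.2 hU))
    refine ⟨N * U, ?_, hNc.mul hUc⟩
    have h2 : Tendsto (fun x : G => y⁻¹ * x) (𝓝 z) (𝓝 (y⁻¹ * z)) :=
      (continuous_const_mul y⁻¹).tendsto z
    have hy' : U ∈ 𝓝 (y⁻¹ * z) := hy
    filter_upwards [h2 hy'] with x hx
    exact ⟨y, mem_of_mem_nhds hN, y⁻¹ * x, hx, by simp⟩
  have huniv : S = univ := IsClopen.eq_univ ⟨hclosed, hopen⟩ ⟨1, U, hU, hUc⟩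
  have : z ∈ S := by rw [huniv]; trivial
  exact this

lemma IsCompact.controlled [ConnectedSpace G] (hX : HormanderCondition X) {K : Set G}
    (hK : IsCompact K) : Controlled X ρ K := by
  suffices CompactlyControlled X ρ K from this.1
  refine hK.induction_on ?_ (fun _ _ h h' => h'.mono h) (fun _ _ h h' => h.union h') fun z _ => ?_
  · exact (compactlyControlled_singleton (one_mem _)).mono (empty_subset _)
  · obtain ⟨N, hN, h⟩ := exists_compactlyControlled_nhds (ρ := ρ) hX z
    exact ⟨N, mem_nhdsWithin_of_mem_nhds hN, h⟩

/-- Local Poincaré inequality. -/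
theorem exists_local_poincare [ConnectedSpace G] (hX : HormanderCondition X) {K : Set G}
    (hK : IsCompact K) : ∃ K' : Set G, IsCompact K' ∧ ∃ C : ℝ≥0∞, C ≠ ⊤ ∧
      ∀ f g, FlowGrad X ρ f g → ∃ a : ℝ,
        ∫⁻ x in K, ‖f x - a‖ₑ ^ 2 ∂ρ ≤ C * ∫⁻ x in K', ∑ j, ‖g j x‖ₑ ^ 2 ∂ρ := by
  obtain ⟨U, hU, hU1⟩ := exists_compact_mem_nhds (1 : G)
  -- Adding a neighbourhood of `e` ensures that `L` has positive Haar measure, so that averages over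
  -- it make sense.
  set L := K ∪ U with hL
  have hLc : IsCompact L := hK.union hU
  let lam : Measure G := Measure.haar
  have hpos : lam L ≠ 0 := by
    have : L ∈ 𝓝 (1 : G) := mem_of_superset hU1 subset_union_right
    exact (Measure.measure_pos_of_mem_nhds lam this).ne'
  have hfin : lam L ≠ ⊤ := hLc.measure_ne_top
  have hL' : IsCompact (L⁻¹ * L) := hLc.inv.mul hLc
  obtain ⟨K', hK', C, hC, h⟩ := IsCompact.controlled (ρ := ρ) hX hL' L hLc
  refine ⟨K', hK', (lam L)⁻¹ * (C * lam (L⁻¹ * L)), ENNReal.mul_ne_top (by simpa using hpos)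
    (ENNReal.mul_ne_top hC hL'.measure_ne_top), fun f g hfg => ?_⟩
  have hfm := hfg.measurable
  have hmeas : Measurable fun p : G × G => ‖f p.1 - f p.2‖ₑ ^ 2 := by fun_prop
  have hmeas' : Measurable fun y => ∫⁻ x in L, ‖f x - f y‖ₑ ^ 2 ∂ρ :=
    (hmeas.comp measurable_swap).lintegral_prod_right'
  -- The constant is a value `f y`, where `y` does at least as well as the average over `L`. The
  -- averaging measure is a left Haar measure because the substitution `y = x z` below is a left
  -- translation in `z`, whereas `ρ` is right invariant.
  obtain ⟨y, -, hy⟩ := exists_le_setLAverage (μ := lam) hpos hfin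
    (f := fun y => ∫⁻ x in L, ‖f x - f y‖ₑ ^ 2 ∂ρ) hmeas'.aemeasurable
  refine ⟨f y, (lintegral_mono_set subset_union_left).trans (hy.trans ?_)⟩
  rw [setLAverage_eq, ENNReal.div_eq_inv_mul, mul_assoc]
  gcongr
  calc ∫⁻ y in L, (∫⁻ x in L, ‖f x - f y‖ₑ ^ 2 ∂ρ) ∂lam
      = ∫⁻ x in L, (∫⁻ y in L, ‖f x - f y‖ₑ ^ 2 ∂lam) ∂ρ :=
        lintegral_lintegral_swap (hmeas.comp measurable_swap).aemeasurable
    _ ≤ ∫⁻ x in L, (∫⁻ z in L⁻¹ * L, ‖f (x * z) - f x‖ₑ ^ 2 ∂lam) ∂ρ := by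
        refine setLIntegral_mono' hLc.measurableSet fun x hx => ?_
        rw [← lintegral_indicator hLc.measurableSet, ← lintegral_indicator hL'.measurableSet,
          ← lintegral_mul_left_eq_self (μ := lam) (L.indicator fun y => ‖f x - f y‖ₑ ^ 2) x]
        refine lintegral_mono fun z => ?_
        by_cases hz : x * z ∈ L
        · have hz' : z ∈ L⁻¹ * L := ⟨x⁻¹, inv_mem_inv.2 hx, x * z, hz, by simp⟩
          rw [indicator_of_mem hz, indicator_of_mem hz', ← enorm_neg, neg_sub]
        · rw [indicator_of_notMem hz]; exact zero_le
    _ = ∫⁻ z in L⁻¹ * L, (∫⁻ x in L, ‖f (x * z) - f x‖ₑ ^ 2 ∂ρ) ∂lam := by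
        refine lintegral_lintegral_swap (Measurable.aemeasurable ?_)
        have : Measurable fun p : G × G => f (p.1 * p.2) := hfm.comp measurable_mul
        exact ((this.sub (hfm.comp measurable_fst)).enorm).pow_const 2
    _ ≤ ∫⁻ z in L⁻¹ * L, (C * ∫⁻ x in K', ∑ j, ‖g j x‖ₑ ^ 2 ∂ρ) ∂lam :=
        setLIntegral_mono' hL'.measurableSet fun z hz => h f g hfg z hz
    _ = C * (lam (L⁻¹ * L) * ∫⁻ x in K', ∑ j, ‖g j x‖ₑ ^ 2 ∂ρ) := by
        rw [lintegral_const, Measure.restrict_apply_univ]; ring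
    _ = _ := by ring

end Controlled

/-! ### Relative compactness of Carnot–Carathéodory balls -/

section Ball

variable {E : Type*} [NormedAddCommGroup E] [NormedSpace ℝ E] [CompleteSpace E]
  {G : Type*} [TopologicalSpace G] [ChartedSpace E G] [Group G] [LieGroup 𝓘(ℝ, E) ∞ G] [T2Space G]
  [IsTopologicalGroup G]
  {ℓ : ℕ} {X : Fin ℓ → GroupLieAlgebra 𝓘(ℝ, E) G}

lemma lieDeriv_mul_left (Z : GroupLieAlgebra 𝓘(ℝ, E) G) {φ : G → ℝ}
    (hφ : ContMDiff 𝓘(ℝ, E) 𝓘(ℝ, ℝ) 1 φ) (h x : G) :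
    lieDeriv Z (fun y => φ (h * y)) x = lieDeriv Z φ (h * x) := by
  have h1 : ContMDiff 𝓘(ℝ, E) 𝓘(ℝ, ℝ) 1 (fun y => φ (h * y)) :=
    hφ.comp ((contMDiff_mul_left (I := 𝓘(ℝ, E)) (n := ∞)).of_le (by simp))
  have h2 := hasDerivAt_comp_mul_oneParam_zero Z (h1.mdifferentiable (by simp) x)
  have h3 := hasDerivAt_comp_mul_oneParam_zero Z (hφ.mdifferentiable (by simp) (h * x))
  simp only [mul_assoc] at h2 h3
  exact h2.unique h3

lemma IsHorizontalCurve.ae_hasDerivAt {γ : ℝ → G} {a : ℝ → EuclideanSpace ℝ (Fin ℓ)}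
    (hγ : IsHorizontalCurve X γ a) {φ : G → ℝ} (hφ : ContMDiff 𝓘(ℝ, E) 𝓘(ℝ, ℝ) ∞ φ) :
    ∀ᵐ t ∂(volume.restrict (Icc (0 : ℝ) 1)),
      HasDerivAt (φ ∘ γ) (∑ j, a t j * lieDeriv (X j) φ (γ t)) t := by
  filter_upwards [hγ.hasMFDerivAt] with t ht
  have h1 : HasMD γ t ((1 : ℝ →L[ℝ] ℝ).smulRight (∑ j, a t j • leftField (X j) (γ t))) := ht
  obtain ⟨B, h2, hB⟩ : ∃ B : E →L[ℝ] ℝ, HasMD φ (γ t) B ∧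
      ∀ j, lieDeriv (X j) φ (γ t) = B (leftField (X j) (γ t)) :=
    ⟨_, (hφ.mdifferentiable (by simp) (γ t)).hasMD, fun _ => rfl⟩
  refine (h2.comp_curve h1).hasDerivAt.congr_deriv ?_
  simp only [map_sum, map_smul, smul_eq_mul, hB]

lemma IsHorizontalCurve.abs_sub_le {γ : ℝ → G} {a : ℝ → EuclideanSpace ℝ (Fin ℓ)}
    (hγ : IsHorizontalCurve X γ a) {φ : G → ℝ} (hφ : ContMDiff 𝓘(ℝ, E) 𝓘(ℝ, ℝ) ∞ φ) {C : ℝ}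
    (hC : ∀ j x, |lieDeriv (X j) φ x| ≤ C) {s t : ℝ} (hs : 0 ≤ s) (hst : s ≤ t) (ht : t ≤ 1) :
    |φ (γ t) - φ (γ s)| ≤ ℓ * C * ∫ r in s..t, ‖a r‖ := by
  have hsub : Icc s t ⊆ Icc 0 1 := Icc_subset_Icc hs ht
  have hac : AbsolutelyContinuousOnInterval (φ ∘ γ) s t :=
    (hγ.absolutelyContinuous φ hφ).mono (by rwa [uIcc_of_le hst, uIcc_of_le zero_le_one])
  have hint : IntervalIntegrable (fun r => ‖a r‖) volume s t := by
    rw [intervalIntegrable_iff_integrableOn_Icc_of_le hst]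
    exact (hγ.integrableOn.mono_set hsub).norm
  have h1 := hac.integral_deriv_eq_sub
  rw [← Function.comp_apply (f := φ), ← Function.comp_apply (f := φ) (x := s), ← h1,
    ← Real.norm_eq_abs, ← intervalIntegral.integral_const_mul]
  refine intervalIntegral.norm_integral_le_of_norm_le hst ?_ (hint.const_mul _)
  have h2 := ae_restrict_of_ae_restrict_of_subset (Ioc_subset_Icc_self.trans hsub)
    (hγ.ae_hasDerivAt hφ)
  filter_upwards [(ae_restrict_iff' measurableSet_Ioc).1 h2] with r hr hr'
  rw [(hr hr').deriv]
  calc ‖∑ j, a r j * lieDeriv (X j) φ (γ r)‖ ≤ ∑ _j : Fin ℓ, C * ‖a r‖ := by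
        refine (norm_sum_le _ _).trans (Finset.sum_le_sum fun j _ => ?_)
        rw [norm_mul, mul_comm]
        exact mul_le_mul (hC j _) (PiLp.norm_apply_le _ j) (norm_nonneg _)
          ((abs_nonneg _).trans (hC j (γ r)))
    _ = ℓ * C * ‖a r‖ := by simp [mul_assoc]

variable [FiniteDimensional ℝ E]

lemma exists_bump_one :
    ∃ (φ : G → ℝ), ContMDiff 𝓘(ℝ, E) 𝓘(ℝ, ℝ) ∞ φ ∧ HasCompactSupport φ ∧ φ 1 = 1 ∧
      ∀ x, 0 ≤ φ x := by
  obtain ⟨b⟩ : Nonempty (SmoothBumpFunction 𝓘(ℝ, E) (1 : G)) := inferInstance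
  exact ⟨b, b.contMDiff, b.hasCompactSupport, b.eq_one, fun x => b.nonneg⟩

lemma exists_bound_lieDeriv {φ : G → ℝ} (hφ : ContMDiff 𝓘(ℝ, E) 𝓘(ℝ, ℝ) 1 φ)
    (hc : HasCompactSupport φ) (X : Fin ℓ → GroupLieAlgebra 𝓘(ℝ, E) G) :
    ∃ C, 0 ≤ C ∧ ∀ j x, |lieDeriv (X j) φ x| ≤ C := by
  have h1 : ∀ j, ∃ C, ∀ x, ‖lieDeriv (X j) φ x‖ ≤ C := fun j =>
    ((testPair_lieDeriv (X j) hφ hc).hasCompactSupport_deriv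
      (isOneParam_oneParam _)).exists_bound_of_continuous (continuous_lieDeriv hφ)
  choose C hC using h1
  refine ⟨∑ j, |C j|, by positivity, fun j x => ((hC j x).trans (le_abs_self _)).trans ?_⟩
  exact Finset.single_le_sum (f := fun j => |C j|) (fun _ _ => abs_nonneg _) (Finset.mem_univ j)

/-- Carnot–Carathéodory balls are relatively compact. -/
theorem exists_isCompact_ccBall_subset (X : Fin ℓ → GroupLieAlgebra 𝓘(ℝ, E) G) (R : ℝ) :
    ∃ K : Set G, IsCompact K ∧ ccBall X R ⊆ K := by
  obtain ⟨φ, hφ, hc, h1, -⟩ := exists_bump_one (E := E) (G := G)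
  have hφ1 : ContMDiff 𝓘(ℝ, E) 𝓘(ℝ, ℝ) 1 φ := hφ.of_le (by simp)
  obtain ⟨C, hC0, hC⟩ := exists_bound_lieDeriv hφ1 hc X
  set K := tsupport φ with hK
  have h1K : (1 : G) ∈ K := subset_tsupport φ (by simp [h1])
  have hKc : ∀ n : ℕ, IsCompact (K ^ n) := fun n => by
    induction n with
    | zero => simp
    | succ n ih => rw [pow_succ]; exact ih.mul hc
  -- Along a piece of length at most `δ`, the bump function translated to equal `1` at its start
  -- changes by at most `ℓ C δ < 1`, so the endpoint stays in the translated support.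
  set δ : ℝ := 1 / (ℓ * C + 1) with hδ
  have hδ0 : 0 < δ := by positivity
  have hδ1 : ℓ * C * δ < 1 := by
    rw [hδ, mul_one_div, div_lt_one (by positivity)]; linarith
  have hstep : ∀ {γ : ℝ → G} {a : ℝ → EuclideanSpace ℝ (Fin ℓ)}, IsHorizontalCurve X γ a →
      ∀ s t : ℝ, 0 ≤ s → s ≤ t → t ≤ 1 → ∫ r in s..t, ‖a r‖ ≤ δ → (γ s)⁻¹ * γ t ∈ K := by
    intro γ a hγ s t hs hst ht hle
    have h2 := hγ.abs_sub_le (φ := fun y => φ ((γ s)⁻¹ * y))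
      (hφ.comp (contMDiff_mul_left (I := 𝓘(ℝ, E)) (n := ∞))) (C := C)
      (fun j x => by rw [lieDeriv_mul_left _ hφ1]; exact hC j _) hs hst ht
    have h3 : (ℓ * C) * ∫ r in s..t, ‖a r‖ < 1 :=
      lt_of_le_of_lt (mul_le_mul_of_nonneg_left hle (by positivity)) hδ1
    simp only [inv_mul_cancel, h1] at h2
    refine subset_tsupport φ fun h0 => ?_
    rw [h0] at h2
    norm_num at h2
    linarith
  have hind : ∀ {γ : ℝ → G} {a : ℝ → EuclideanSpace ℝ (Fin ℓ)}, IsHorizontalCurve X γ a →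
      ∀ (n : ℕ) (t : ℝ), 0 ≤ t → t ≤ 1 → ∫ r in (0 : ℝ)..t, ‖a r‖ ≤ (n + 1) * δ →
      (γ 0)⁻¹ * γ t ∈ K ^ (n + 1) := by
    intro γ a hγ n
    have hint : ∀ s t, 0 ≤ s → s ≤ t → t ≤ 1 → IntervalIntegrable (fun r => ‖a r‖) volume s t := by
      intro s t hs hst ht
      rw [intervalIntegrable_iff_integrableOn_Icc_of_le hst]
      exact (hγ.integrableOn.mono_set (Icc_subset_Icc hs ht)).norm
    induction n with
    | zero =>
      intro t h0 ht hle
      simpa using hstep hγ 0 t le_rfl h0 ht (by simpa using hle)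
    | succ n ih =>
      intro t h0 ht hle
      have hcont : ContinuousOn (fun s => ∫ r in (0 : ℝ)..s, ‖a r‖) (Icc 0 t) := by
        have := intervalIntegral.continuousOn_primitive_interval' (hint 0 t le_rfl h0 ht)
          (left_mem_uIcc)
        rwa [uIcc_of_le h0] at this
      rw [pow_succ]
      rcases le_total (∫ r in (0 : ℝ)..t, ‖a r‖) ((n + 1) * δ) with h | h
      · exact ⟨_, ih t h0 ht h, 1, h1K, mul_one _⟩
      -- The length is a continuous function of the endpoint, so the curve can be cut at the time
      -- `s` where it equals `(n + 1) δ`; the remaining piece has length at most `δ`.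
      · have hmem : (n + 1) * δ ∈ Icc (∫ r in (0 : ℝ)..0, ‖a r‖) (∫ r in (0 : ℝ)..t, ‖a r‖) := by
          refine ⟨?_, h⟩
          rw [intervalIntegral.integral_same]; positivity
        obtain ⟨s, ⟨hs0, hst⟩, hs⟩ := intermediate_value_Icc h0 hcont hmem
        simp only at hs
        have h5 := intervalIntegral.integral_add_adjacent_intervals
          (hint 0 s le_rfl hs0 (hst.trans ht)) (hint s t hs0 hst ht)
        refine ⟨_, ih s hs0 (hst.trans ht) hs.le, _, hstep hγ s t hs0 hst ht ?_, by simp [mul_assoc]⟩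
        push_cast at hle
        linarith
  obtain ⟨N, hN⟩ := exists_nat_ge (R / δ)
  -- The inverse appears because the curves run from `x` to `1`, so that `x⁻¹` is what lies in the
  -- power of `K`.
  refine ⟨(K ^ (N + 1))⁻¹, (hKc _).inv, fun x hx => ?_⟩
  have hx' : ccDist X x 1 < ENNReal.ofReal R := hx
  simp only [ccDist, iInf_lt_iff] at hx'
  obtain ⟨γ, a, ⟨hγ, h0, h1'⟩, hlt⟩ := hx'
  have hle : ∫ r in (0 : ℝ)..1, ‖a r‖ ≤ (N + 1) * δ := by
    rw [intervalIntegral.integral_of_le zero_le_one, ← integral_Icc_eq_integral_Ioc,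
      integral_norm_eq_lintegral_enorm hγ.integrableOn.aestronglyMeasurable]
    have hR : 0 < R := ENNReal.ofReal_pos.1 (pos_of_gt hlt)
    refine (ENNReal.toReal_le_of_le_ofReal hR.le hlt.le).trans ?_
    rw [div_le_iff₀ hδ0] at hN
    linarith
  have := hind hγ N 1 zero_le_one le_rfl hle
  rw [h0, h1', mul_one] at this
  exact Set.mem_inv.2 this

end Ball

/-! ### Cutoff functions with uniformly bounded gradient -/

section Cutoff

variable {G : Type*} [TopologicalSpace G] [Group G] [IsTopologicalGroup G]
  [T2Space G] [LocallyCompactSpace G] [SecondCountableTopology G]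
  [MeasurableSpace G] [BorelSpace G]
  {ρ : Measure G} [IsFiniteMeasureOnCompacts ρ] [ρ.IsMulRightInvariant]
  {θ : ℝ → G} {k k' : G → ℝ}

lemma _root_.HasCompactSupport.comp_mul_right {k : G → ℝ} (hk : HasCompactSupport k) (x : G) :
    HasCompactSupport fun y => k (y * x) :=
  hk.comp_homeomorph (Homeomorph.mulRight x)

lemma integrable_comp_mul_right (hk : Continuous k) (hc : HasCompactSupport k) (x : G) :
    Integrable (fun y => k (y * x)) ρ :=
  (hk.comp (continuous_mul_const x)).integrable_of_hasCompactSupport (hc.comp_mul_right x)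

lemma abs_setIntegral_comp_mul_right_le (hk : Continuous k) (hc : HasCompactSupport k)
    (A : Set G) (x : G) : |∫ y in A, k (y * x) ∂ρ| ≤ ∫ y, |k y| ∂ρ := by
  calc |∫ y in A, k (y * x) ∂ρ| ≤ ∫ y in A, |k (y * x)| ∂ρ := abs_integral_le_integral_abs
    _ ≤ ∫ y, |k (y * x)| ∂ρ :=
        setIntegral_le_integral (integrable_comp_mul_right hk hc x).abs
          (Eventually.of_forall fun _ => abs_nonneg _)
    _ = ∫ y, |k y| ∂ρ := integral_mul_right_eq_self (fun y => |k y|) x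

lemma setIntegral_comp_mul_right_eq {K A : Set G} (hk : ∀ x ∉ K, k x = 0) {x : G}
    (hx : K * {x⁻¹} ⊆ A) : ∫ y in A, k (y * x) ∂ρ = ∫ y, k y ∂ρ := by
  rw [setIntegral_eq_integral_of_forall_compl_eq_zero, integral_mul_right_eq_self k x]
  intro y hy
  refine hk _ fun h => hy (hx ?_)
  exact ⟨y * x, h, x⁻¹, rfl, by simp⟩

lemma TestPair.integral_deriv_eq_zero (hθ : IsOneParam θ) (h : TestPair θ k k') :
    ∫ x, k' x ∂ρ = 0 := by
  have h1 : FlowDeriv ρ θ (fun _ => 1) (fun _ => 0) := fun t =>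
    Eventually.of_forall fun x => by simp
  simpa using h1.integral_mul_deriv hθ (locallyIntegrable_const 1) measurable_const
    (locallyIntegrable_const 0) h

lemma TestPair.setIntegral_translate (hθ : IsOneParam θ) (h : TestPair θ k k') {A : Set G}
    (hA : IsCompact A) :
    TestPair θ (fun x => ∫ y in A, k (y * x) ∂ρ) (fun x => ∫ y in A, k' (y * x) ∂ρ) := by
  have hk := h.continuous
  have hk' := h.continuous_deriv
  refine ⟨continuous_parametric_integral_of_continuous (by fun_prop) hA,
    continuous_parametric_integral_of_continuous (by fun_prop) hA, ?_, fun x => ?_⟩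
  · refine HasCompactSupport.intro (hA.inv.mul h.hasCompactSupport) fun x hx => ?_
    refine setIntegral_eq_zero_of_forall_eq_zero fun y hy => ?_
    refine image_eq_zero_of_notMem_tsupport fun h => hx ?_
    exact ⟨y⁻¹, inv_mem_inv.2 hy, y * x, h, by simp⟩
  · obtain ⟨C, hC⟩ := (h.hasCompactSupport_deriv hθ).exists_bound_of_continuous hk'
    have hfin : IsFiniteMeasure (ρ.restrict A) := ⟨by simpa using hA.measure_lt_top⟩
    have h1 := hasDerivAt_integral_of_dominated_loc_of_deriv_le (μ := ρ.restrict A)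
      (F := fun t y => k (y * x * θ t)) (F' := fun t y => k' (y * x * θ t)) (x₀ := (0 : ℝ))
      (bound := fun _ => C) univ_mem
      (Eventually.of_forall fun t => Continuous.aestronglyMeasurable (by fun_prop))
      (by simpa only [hθ.map_zero, mul_one] using
        (integrable_comp_mul_right hk h.hasCompactSupport x).restrict (s := A))
      (Continuous.aestronglyMeasurable (by fun_prop))
      (Eventually.of_forall fun y t _ => hC _) (integrable_const C)
      (Eventually.of_forall fun y t _ => h.hasDerivAt_flow hθ (y * x) t)
    simpa only [hθ.map_zero, mul_one, mul_assoc] using h1.2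

lemma TestPair.const_mul (h : TestPair θ k k') (c : ℝ) :
    TestPair θ (fun x => c * k x) (fun x => c * k' x) :=
  ⟨continuous_const.mul h.continuous, continuous_const.mul h.continuous_deriv,
    h.hasCompactSupport.mul_left, fun x => (h.hasDerivAt x).const_mul c⟩

/-- Cutoff functions with horizontal gradients bounded independently of the compact set. -/
lemma exists_cutoff [ρ.IsOpenPosMeasure] {ι : Type*} [Finite ι] {θ : ι → ℝ → G}
    (hθ : ∀ j, IsOneParam (θ j)) {k : G → ℝ} {k' : ι → G → ℝ} (hk : Continuous k)
    (hc : HasCompactSupport k) (hk0 : ∀ x, 0 ≤ k x) (hk1 : k 1 ≠ 0)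
    (h : ∀ j, TestPair (θ j) k (k' j)) :
    ∃ L : ℝ, ∀ B : Set G, IsCompact B → ∃ (η : G → ℝ) (η' : ι → G → ℝ),
      (∀ j, TestPair (θ j) η (η' j)) ∧ Continuous η ∧ HasCompactSupport η ∧
      (∀ x, |η x| ≤ 1) ∧ (∀ j x, |η' j x| ≤ L) ∧ ∀ x ∈ B, η x = 1 ∧ ∀ j, η' j x = 0 := by
  cases nonempty_fintype ι
  set I := ∫ x, k x ∂ρ with hI
  have hIpos : 0 < I := hk.integral_pos_of_hasCompactSupport_nonneg_nonzero hc hk0 hk1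
  refine ⟨∑ j, I⁻¹ * ∫ y, |k' j y| ∂ρ, fun B hB => ?_⟩
  -- The cutoff is `η(x) = I⁻¹ ∫_A k(y x) dρ(y)`. Its derivatives fall on `k`, since the fields
  -- commute with left translation, and are bounded by `I⁻¹ ∫ |k'|` whatever `A` is. For `x ∈ B` the
  -- set `A` contains the whole support of `y ↦ k(y x)`; right invariance then gives `η = 1`, and
  -- `η' = 0` because `∫ k' = 0`.
  set A := tsupport k * B⁻¹ with hA
  have hAc : IsCompact A := hc.mul hB.inv
  have hsub : ∀ x ∈ B, tsupport k * {x⁻¹} ⊆ A := fun x hx =>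
    mul_subset_mul_left (singleton_subset_iff.2 (inv_mem_inv.2 hx))
  refine ⟨fun x => I⁻¹ * ∫ y in A, k (y * x) ∂ρ, fun j x => I⁻¹ * ∫ y in A, k' j (y * x) ∂ρ,
    fun j => ((h j).setIntegral_translate (hθ j) hAc).const_mul _, ?_, ?_, fun x => ?_,
    fun j x => ?_, fun x hx => ⟨?_, fun j => ?_⟩⟩
  · exact continuous_const.mul (continuous_parametric_integral_of_continuous (by fun_prop) hAc)
  · refine HasCompactSupport.intro (hAc.inv.mul hc) fun x hx => ?_
    rw [setIntegral_eq_zero_of_forall_eq_zero, mul_zero]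
    intro y hy
    refine image_eq_zero_of_notMem_tsupport fun h => hx ?_
    exact ⟨y⁻¹, inv_mem_inv.2 hy, y * x, h, by simp⟩
  · rw [abs_mul, abs_of_pos (inv_pos.2 hIpos), inv_mul_le_iff₀ hIpos, mul_one]
    refine (abs_setIntegral_comp_mul_right_le hk hc A x).trans (le_of_eq ?_)
    simp only [abs_of_nonneg (hk0 _), hI]
  · rw [abs_mul, abs_of_pos (inv_pos.2 hIpos)]
    refine le_trans ?_ (Finset.single_le_sum (f := fun j => I⁻¹ * ∫ y, |k' j y| ∂ρ)
      (fun j _ => by positivity) (Finset.mem_univ j))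
    gcongr
    exact abs_setIntegral_comp_mul_right_le (h j).continuous_deriv
      ((h j).hasCompactSupport_deriv (hθ j)) A x
  · beta_reduce
    rw [setIntegral_comp_mul_right_eq (fun _ => image_eq_zero_of_notMem_tsupport) (hsub x hx),
      inv_mul_cancel₀ hIpos.ne']
  · beta_reduce
    rw [setIntegral_comp_mul_right_eq (fun _ => (h j).deriv_eq_zero (hθ j)) (hsub x hx),
      (h j).integral_deriv_eq_zero (hθ j), mul_zero]

end Cutoff

/-! ### The weighted inequality from the Lyapunov condition -/

section Lyapunov

variable {G : Type*} [TopologicalSpace G] [Group G] [IsTopologicalGroup G]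
  [T2Space G] [LocallyCompactSpace G] [SecondCountableTopology G]
  [MeasurableSpace G] [BorelSpace G]
  {ρ : Measure G} [IsFiniteMeasureOnCompacts ρ]

lemma integrable_mul_of_hasCompactSupport {u w : G → ℝ} (hu : LocallyIntegrable u ρ)
    (hw : Continuous w) (hc : HasCompactSupport w) : Integrable (fun x => u x * w x) ρ := by
  simpa only [smul_eq_mul, mul_comm] using hu.integrable_smul_left_of_hasCompactSupport hw hc

lemma locallyIntegrable_of_sq {u : G → ℝ} (hu : Measurable u)
    (h : LocallyIntegrable (fun x => u x ^ 2) ρ) : LocallyIntegrable u ρ := by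
  refine ((locallyIntegrable_const (1 : ℝ)).add h).mono hu.aestronglyMeasurable
    (Eventually.of_forall fun x => ?_)
  simp only [Pi.add_apply, Real.norm_eq_abs]
  rw [abs_of_nonneg (by positivity : 0 ≤ 1 + u x ^ 2)]
  nlinarith [sq_abs (u x), sq_nonneg (|u x| - 1)]

lemma locallyIntegrable_two_mul_mul {u w : G → ℝ} (hu : Measurable u) (hw : Measurable w)
    (h : LocallyIntegrable (fun x => u x ^ 2) ρ) (h' : LocallyIntegrable (fun x => w x ^ 2) ρ) :
    LocallyIntegrable (fun x => 2 * u x * w x) ρ := by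
  refine (h.add h').mono ((hu.const_mul 2).mul hw).aestronglyMeasurable
    (Eventually.of_forall fun x => ?_)
  simp only [Pi.add_apply, Real.norm_eq_abs]
  rw [abs_of_nonneg (by positivity : 0 ≤ u x ^ 2 + w x ^ 2), abs_le]
  constructor <;> nlinarith [sq_nonneg (u x - w x), sq_nonneg (u x + w x)]

variable [ρ.IsMulRightInvariant]

lemma TestPair.sq_mul_mul {θ : ℝ → G} {η η' m m' p p' : G → ℝ} (hθ : IsOneParam θ)
    (h : TestPair θ η η')
    (hm : Continuous m) (hm' : Continuous m') (hp : Continuous p) (hp' : Continuous p')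
    (hdm : ∀ x, HasDerivAt (fun t => m (x * θ t)) (m' x) 0)
    (hdp : ∀ x, HasDerivAt (fun t => p (x * θ t)) (p' x) 0) :
    TestPair θ (fun x => η x ^ 2 * (m x * p x))
      (fun x => 2 * η x * η' x * (m x * p x) + η x ^ 2 * (m' x * p x + m x * p' x)) := by
  have h1 := h.continuous
  have h2 := h.continuous_deriv
  refine ⟨by fun_prop, by fun_prop, ?_, fun x => ?_⟩
  · refine h.hasCompactSupport.mono' fun x hx => subset_tsupport _ fun h0 => hx ?_
    simp [h0]
  · refine (((h.hasDerivAt x).pow 2).mul ((hdm x).mul (hdp x))).congr_deriv ?_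
    simp [hθ.map_zero]

variable {ι : Type*} [Fintype ι] {θ : ι → ℝ → G} {h : G → ℝ} {g : ι → G → ℝ}
  {m : G → ℝ} {p q : ι → G → ℝ} {a : ι → ℝ} {η : G → ℝ} {η' : ι → G → ℝ}

/-- Integration by parts against `η² m p`, where `m` satisfies `m' = m (a - p)`. -/
lemma integral_parts_eq_zero {θ : ℝ → G} {g p q η' : G → ℝ} {a : ℝ} (hθ : IsOneParam θ)
    (hh : Measurable h) (hg : Measurable g) (hd : FlowDeriv ρ θ h g)
    (hh2 : LocallyIntegrable (fun x => h x ^ 2) ρ) (hg2 : LocallyIntegrable (fun x => g x ^ 2) ρ)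
    (hm : Continuous m) (hp : Continuous p) (hq : Continuous q)
    (hdm : ∀ x, HasDerivAt (fun t => m (x * θ t)) (m x * (a - p x)) 0)
    (hdp : ∀ x, HasDerivAt (fun t => p (x * θ t)) (q x) 0) (hη : TestPair θ η η') :
    Integrable (fun x => h x ^ 2 * (2 * η x * η' x * (m x * p x) +
        η x ^ 2 * (m x * (a - p x) * p x + m x * q x)) +
        2 * h x * g x * (η x ^ 2 * (m x * p x))) ρ ∧
      ∫ x, (h x ^ 2 * (2 * η x * η' x * (m x * p x) +
        η x ^ 2 * (m x * (a - p x) * p x + m x * q x)) +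
        2 * h x * g x * (η x ^ 2 * (m x * p x))) ∂ρ = 0 := by
  have hw := hη.sq_mul_mul hθ hm (m' := fun x => m x * (a - p x)) (by fun_prop) hp hq hdm hdp
  have hhl := locallyIntegrable_of_sq hh hh2
  have hgl := locallyIntegrable_of_sq hg hg2
  have hhg := locallyIntegrable_two_mul_mul hh hg hh2 hg2
  have h1 := (hd.sq hθ hh hg hgl).integral_mul_deriv hθ hh2 ((hh.const_mul 2).mul hg) hhg hw
  have i1 := integrable_mul_of_hasCompactSupport hh2 hw.continuous_deriv
    (hw.hasCompactSupport_deriv hθ)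
  have i2 := integrable_mul_of_hasCompactSupport hhg hw.continuous hw.hasCompactSupport
  exact ⟨i1.add i2, by rw [integral_add i1 i2, h1]; ring⟩

/-- Each of the two cross terms uses a quarter of `η² h² p²`. The total of one half is exactly what
the hypothesis can spare: `(1 - ε)/2 = 1 - 1/2 - ε/2`. -/
lemma young_pointwise (h η b p g : ℝ) :
    2 * h ^ 2 * η * b * p + 2 * h * g * η ^ 2 * p - 1 / 2 * (η ^ 2 * h ^ 2 * p ^ 2) ≤
      4 * (h ^ 2 * b ^ 2) + 4 * (η ^ 2 * g ^ 2) := by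
  nlinarith [sq_nonneg (1 / 2 * h * η * p - 2 * h * b), sq_nonneg (1 / 2 * h * η * p - 2 * η * g)]

/-- A localized weighted inequality from a Lyapunov condition outside a compact set. -/
lemma lintegral_le_of_lyapunov (hθ : ∀ j, IsOneParam (θ j))
    (hh : Measurable h) (hg : ∀ j, Measurable (g j)) (hd : ∀ j, FlowDeriv ρ (θ j) h (g j))
    (hh2 : LocallyIntegrable (fun x => h x ^ 2) ρ)
    (hg2 : ∀ j, LocallyIntegrable (fun x => g j x ^ 2) ρ)
    (hm : Continuous m) (hm0 : ∀ x, 0 < m x) (hp : ∀ j, Continuous (p j))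
    (hq : ∀ j, Continuous (q j))
    (hdm : ∀ j x, HasDerivAt (fun t => m (x * θ j t)) (m x * (a j - p j x)) 0)
    (hdp : ∀ j x, HasDerivAt (fun t => p j (x * θ j t)) (q j x) 0)
    {c C₁ ε : ℝ} (hc : 0 ≤ c) (hC₁ : 0 ≤ C₁) (hε : 0 ≤ ε) {K : Set G} (hK : MeasurableSet K)
    (hW : ∀ x, c ≤ (1 - ε) / 2 * ∑ j, p j x ^ 2 - ∑ j, (q j x + a j * p j x) +
      K.indicator (fun _ => C₁) x)
    (hη : ∀ j, TestPair (θ j) η (η' j)) (hηc : Continuous η) (hηs : HasCompactSupport η)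
    (hη1 : ∀ x, |η x| ≤ 1) {L : ℝ} (hη' : ∀ j x, |η' j x| ≤ L) {B : Set G}
    (hBm : MeasurableSet B) (hB : ∀ x ∈ B, η x = 1 ∧ ∀ j, η' j x = 0) :
    ∫⁻ x in B, ENNReal.ofReal (h x ^ 2 * (c + ε / 2 * ∑ j, p j x ^ 2) * m x) ∂ρ ≤
      ∫⁻ x, ENNReal.ofReal (4 * (∑ j, g j x ^ 2) * m x) ∂ρ +
      ∫⁻ x in Bᶜ, ENNReal.ofReal (4 * (Fintype.card ι * L ^ 2) * h x ^ 2 * m x) ∂ρ +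
      ∫⁻ x in K, ENNReal.ofReal (C₁ * h x ^ 2 * m x) ∂ρ := by
  have hη'c := fun j => (hη j).continuous_deriv
  have hparts := fun j => integral_parts_eq_zero (hθ j) hh (hg j) (hd j) hh2 (hg2 j) hm (hp j)
    (hq j) (hdm j) (hdp j) (hη j)
  have hcs : ∀ u : G → ℝ, HasCompactSupport fun x => η x ^ 2 * u x := fun u =>
    hηs.mono' fun x hx => subset_tsupport _ fun h0 => hx (by simp [h0])
  have hcs' : ∀ j, HasCompactSupport fun x => η' j x ^ 2 * m x := fun j =>
    ((hη j).hasCompactSupport_deriv (hθ j)).mono' fun x hx =>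
      subset_tsupport _ fun h0 => hx (by simp [h0])
  -- `T` collects the integrations by parts and has integral zero. The proof compares pointwise `Ψ ≤
  -- Φ - T`, with `Ψ` the localized left side and `Φ` the localized right side.
  set T : G → ℝ := fun x => ∑ j, (h x ^ 2 * (2 * η x * η' j x * (m x * p j x) +
        η x ^ 2 * (m x * (a j - p j x) * p j x + m x * q j x)) +
        2 * h x * g j x * (η x ^ 2 * (m x * p j x))) with hT
  have hTi : Integrable T ρ := integrable_finsetSum _ fun j _ => (hparts j).1
  have hT0 : ∫ x, T x ∂ρ = 0 := by
    rw [hT, integral_finsetSum _ fun j _ => (hparts j).1]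
    exact Finset.sum_eq_zero fun j _ => (hparts j).2
  set Ψ : G → ℝ := fun x => h x ^ 2 * (η x ^ 2 * ((c + ε / 2 * ∑ j, p j x ^ 2) * m x)) with hΨ
  have hΨi : Integrable Ψ ρ :=
    integrable_mul_of_hasCompactSupport hh2 (by fun_prop) (hcs _)
  set Φ : G → ℝ := fun x => (∑ j, (4 * (h x ^ 2 * (η' j x ^ 2 * m x)) +
    4 * (g j x ^ 2 * (η x ^ 2 * m x)))) +
    K.indicator (fun x => C₁ * (h x ^ 2 * (η x ^ 2 * m x))) x with hΦ
  have hΦi : Integrable Φ ρ := by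
    refine Integrable.add (integrable_finsetSum _ fun j _ => Integrable.add ?_ ?_) ?_
    · exact (integrable_mul_of_hasCompactSupport hh2 (by fun_prop) (hcs' j)).const_mul 4
    · exact (integrable_mul_of_hasCompactSupport (hg2 j) (by fun_prop) (hcs _)).const_mul 4
    · exact ((integrable_mul_of_hasCompactSupport hh2 (by fun_prop) (hcs _)).const_mul C₁).indicator
        hK
  have hΦ0 : ∀ x, 0 ≤ Φ x := fun x => by
    have := (hm0 x).le
    refine add_nonneg (Finset.sum_nonneg fun j _ => by positivity) ?_
    exact indicator_nonneg (fun y _ => by have := (hm0 y).le; positivity) x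
  have hΨ0 : ∀ x, 0 ≤ Ψ x := fun x => by
    have := (hm0 x).le
    have : 0 ≤ ∑ j, p j x ^ 2 := Finset.sum_nonneg fun j _ => sq_nonneg _
    positivity
  have hle : ∀ x, Ψ x ≤ Φ x - T x := by
    intro x
    have hmx := (hm0 x).le
    have e1 : K.indicator (fun x => C₁ * (h x ^ 2 * (η x ^ 2 * m x))) x =
        h x ^ 2 * (η x ^ 2 * m x) * K.indicator (fun _ => C₁) x := by
      by_cases hx : x ∈ K
      · simp only [indicator_of_mem hx]; ring
      · simp only [indicator_of_notMem hx, mul_zero]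
    -- The first two terms on the right are bounded below by the Lyapunov condition, with `(ε/2) ∑
    -- pⱼ²` moved to its left side; the third is nonnegative by Young's inequality.
    have e2 : Φ x - T x = h x ^ 2 * (η x ^ 2 * m x) * K.indicator (fun _ => C₁) x +
        h x ^ 2 * (η x ^ 2 * m x) * ((1 / 2) * (∑ j, p j x ^ 2) - ∑ j, (q j x + a j * p j x)) +
        m x * ∑ j, (4 * (h x ^ 2 * η' j x ^ 2) + 4 * (η x ^ 2 * g j x ^ 2) -
          (2 * h x ^ 2 * η x * η' j x * p j x + 2 * h x * g j x * η x ^ 2 * p j x -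
            1 / 2 * (η x ^ 2 * h x ^ 2 * p j x ^ 2))) := by
      simp only [hΦ, hT, e1]
      rw [add_sub_right_comm, ← Finset.sum_sub_distrib, add_comm, add_assoc, Finset.mul_sum,
        Finset.mul_sum, ← Finset.sum_sub_distrib, Finset.mul_sum, ← Finset.sum_add_distrib]
      congr 1
      exact Finset.sum_congr rfl fun j _ => by ring
    have e3 : 0 ≤ m x * ∑ j, (4 * (h x ^ 2 * η' j x ^ 2) + 4 * (η x ^ 2 * g j x ^ 2) -
          (2 * h x ^ 2 * η x * η' j x * p j x + 2 * h x * g j x * η x ^ 2 * p j x -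
            1 / 2 * (η x ^ 2 * h x ^ 2 * p j x ^ 2))) :=
      mul_nonneg hmx (Finset.sum_nonneg fun j _ => sub_nonneg.2 (young_pointwise _ _ _ _ _))
    have e4 := mul_le_mul_of_nonneg_left (hW x)
      (by positivity : 0 ≤ h x ^ 2 * (η x ^ 2 * m x))
    rw [e2]
    simp only [hΨ]
    linarith
  have hint : ∫ x, Ψ x ∂ρ ≤ ∫ x, Φ x ∂ρ := by
    have := integral_mono hΨi (hΦi.sub hTi) hle
    simp only [Pi.sub_apply] at this
    rwa [integral_sub hΦi hTi, hT0, sub_zero] at this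
  have hpt : ∀ x, ENNReal.ofReal (Φ x) ≤ ENNReal.ofReal (4 * (∑ j, g j x ^ 2) * m x) +
      Bᶜ.indicator (fun x => ENNReal.ofReal (4 * (Fintype.card ι * L ^ 2) * h x ^ 2 * m x)) x +
      K.indicator (fun x => ENNReal.ofReal (C₁ * h x ^ 2 * m x)) x := by
    intro x
    have hmx := (hm0 x).le
    have hηx : η x ^ 2 ≤ 1 := by rw [← sq_abs]; exact pow_le_one₀ (abs_nonneg _) (hη1 x)
    have e0 : Φ x = 4 * (∑ j, g j x ^ 2) * m x * η x ^ 2 + 4 * (∑ j, η' j x ^ 2) * h x ^ 2 * m x +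
        K.indicator (fun x => C₁ * (h x ^ 2 * (η x ^ 2 * m x))) x := by
      simp only [hΦ, Finset.mul_sum, Finset.sum_mul, Finset.sum_add_distrib]
      rw [add_comm (∑ j, 4 * (h x ^ 2 * (η' j x ^ 2 * m x)))]
      congr 2 <;> exact Finset.sum_congr rfl fun j _ => by ring
    have e1 : 0 ≤ ∑ j, g j x ^ 2 := Finset.sum_nonneg fun j _ => sq_nonneg _
    rw [e0]
    refine ENNReal.ofReal_add_le.trans (add_le_add (ENNReal.ofReal_add_le.trans
      (add_le_add ?_ ?_)) ?_)
    · exact ENNReal.ofReal_le_ofReal (mul_le_of_le_one_right (by positivity) hηx)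
    · by_cases hx : x ∈ B
      · simp [(hB x hx).2]
      · rw [indicator_of_mem (mem_compl hx)]
        refine ENNReal.ofReal_le_ofReal ?_
        gcongr
        calc ∑ j, η' j x ^ 2 ≤ ∑ _j : ι, L ^ 2 := Finset.sum_le_sum fun j _ => by
              rw [← sq_abs]; exact pow_le_pow_left₀ (abs_nonneg _) (hη' j x) 2
          _ = Fintype.card ι * L ^ 2 := by simp
    · by_cases hx : x ∈ K
      · simp only [indicator_of_mem hx]
        refine ENNReal.ofReal_le_ofReal ?_
        rw [mul_assoc C₁]
        gcongr
        exact mul_le_of_le_one_left hmx hηx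
      · simp [indicator_of_notMem hx]
  have hm' := hm.measurable
  have hgm : Measurable fun x => ENNReal.ofReal (4 * (∑ j, g j x ^ 2) * m x) := by fun_prop
  have hhm : Measurable fun x =>
      ENNReal.ofReal (4 * (Fintype.card ι * L ^ 2) * h x ^ 2 * m x) := by fun_prop
  calc ∫⁻ x in B, ENNReal.ofReal (h x ^ 2 * (c + ε / 2 * ∑ j, p j x ^ 2) * m x) ∂ρ
      = ∫⁻ x in B, ENNReal.ofReal (Ψ x) ∂ρ := by
        refine setLIntegral_congr_fun hBm fun x hx => ?_
        simp only [hΨ, (hB x hx).1]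
        congr 1; ring
    _ ≤ ∫⁻ x, ENNReal.ofReal (Ψ x) ∂ρ := setLIntegral_le_lintegral _ _
    _ = ENNReal.ofReal (∫ x, Ψ x ∂ρ) :=
        (ofReal_integral_eq_lintegral_ofReal hΨi (Eventually.of_forall hΨ0)).symm
    _ ≤ ENNReal.ofReal (∫ x, Φ x ∂ρ) := ENNReal.ofReal_le_ofReal hint
    _ = ∫⁻ x, ENNReal.ofReal (Φ x) ∂ρ :=
        ofReal_integral_eq_lintegral_ofReal hΦi (Eventually.of_forall hΦ0)
    _ ≤ _ := lintegral_mono hpt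
    _ = _ := by
        have hsum : Measurable fun x => ENNReal.ofReal (4 * (∑ j, g j x ^ 2) * m x) +
            Bᶜ.indicator
              (fun x => ENNReal.ofReal (4 * (Fintype.card ι * L ^ 2) * h x ^ 2 * m x)) x :=
          hgm.add (hhm.indicator hBm.compl)
        rw [lintegral_add_left hsum, lintegral_add_left hgm,
          lintegral_indicator hBm.compl, lintegral_indicator hK]

/-- The global weighted inequality, the cutoff functions exhausting the group. -/
lemma lintegral_le_of_lyapunov_of_cutoff (hθ : ∀ j, IsOneParam (θ j))
    (hh : Measurable h) (hg : ∀ j, Measurable (g j)) (hd : ∀ j, FlowDeriv ρ (θ j) h (g j))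
    (hh2 : LocallyIntegrable (fun x => h x ^ 2) ρ)
    (hg2 : ∀ j, LocallyIntegrable (fun x => g j x ^ 2) ρ)
    (hm : Continuous m) (hm0 : ∀ x, 0 < m x) (hp : ∀ j, Continuous (p j))
    (hq : ∀ j, Continuous (q j))
    (hdm : ∀ j x, HasDerivAt (fun t => m (x * θ j t)) (m x * (a j - p j x)) 0)
    (hdp : ∀ j x, HasDerivAt (fun t => p j (x * θ j t)) (q j x) 0)
    {c C₁ ε : ℝ} (hc : 0 ≤ c) (hC₁ : 0 ≤ C₁) (hε : 0 ≤ ε) {K : Set G} (hK : MeasurableSet K)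
    (hW : ∀ x, c ≤ (1 - ε) / 2 * ∑ j, p j x ^ 2 - ∑ j, (q j x + a j * p j x) +
      K.indicator (fun _ => C₁) x)
    {L : ℝ} (hcut : ∀ B : Set G, IsCompact B → ∃ (η : G → ℝ) (η' : ι → G → ℝ),
      (∀ j, TestPair (θ j) η (η' j)) ∧ Continuous η ∧ HasCompactSupport η ∧
      (∀ x, |η x| ≤ 1) ∧ (∀ j x, |η' j x| ≤ L) ∧ ∀ x ∈ B, η x = 1 ∧ ∀ j, η' j x = 0)
    (hfin : ∫⁻ x, ENNReal.ofReal (h x ^ 2 * m x) ∂ρ ≠ ⊤) :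
    ∫⁻ x, ENNReal.ofReal (h x ^ 2 * (c + ε / 2 * ∑ j, p j x ^ 2) * m x) ∂ρ ≤
      ∫⁻ x, ENNReal.ofReal (4 * (∑ j, g j x ^ 2) * m x) ∂ρ +
      ∫⁻ x in K, ENNReal.ofReal (C₁ * h x ^ 2 * m x) ∂ρ := by
  have hBm : ∀ n, MeasurableSet (compactCovering G n) := fun n =>
    (isCompact_compactCovering G n).measurableSet
  have hstep : ∀ n,
      ∫⁻ x in compactCovering G n,
        ENNReal.ofReal (h x ^ 2 * (c + ε / 2 * ∑ j, p j x ^ 2) * m x) ∂ρ ≤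
      ∫⁻ x, ENNReal.ofReal (4 * (∑ j, g j x ^ 2) * m x) ∂ρ +
      ∫⁻ x in (compactCovering G n)ᶜ,
        ENNReal.ofReal (4 * (Fintype.card ι * L ^ 2) * h x ^ 2 * m x) ∂ρ +
      ∫⁻ x in K, ENNReal.ofReal (C₁ * h x ^ 2 * m x) ∂ρ := fun n => by
    obtain ⟨η, η', h1, h2, h3, h4, h5, h6⟩ := hcut _ (isCompact_compactCovering G n)
    exact lintegral_le_of_lyapunov hθ hh hg hd hh2 hg2 hm hm0 hp hq hdm hdp hc hC₁ hε hK hW h1 h2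
      h3 h4 h5 (hBm n) h6
  have hlim1 : Tendsto (fun n => ∫⁻ x in compactCovering G n,
      ENNReal.ofReal (h x ^ 2 * (c + ε / 2 * ∑ j, p j x ^ 2) * m x) ∂ρ) atTop
      (𝓝 (∫⁻ x, ENNReal.ofReal (h x ^ 2 * (c + ε / 2 * ∑ j, p j x ^ 2) * m x) ∂ρ)) := by
    have h1 := tendsto_measure_iUnion_atTop (μ := ρ.withDensity fun x =>
      ENNReal.ofReal (h x ^ 2 * (c + ε / 2 * ∑ j, p j x ^ 2) * m x))
      (fun _ _ h => compactCovering_subset G h)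
    simpa only [iUnion_compactCovering, withDensity_apply _ (hBm _), withDensity_apply _
      MeasurableSet.univ, Measure.restrict_univ, Function.comp_def] using h1
  -- The cutoff gradients need not become small: they live outside the exhausting compact sets, and
  -- the tails of the finite integral `∫ h² m` tend to zero.
  have hlim2 : Tendsto (fun n => ∫⁻ x in (compactCovering G n)ᶜ,
      ENNReal.ofReal (4 * (Fintype.card ι * L ^ 2) * h x ^ 2 * m x) ∂ρ) atTop (𝓝 0) := by
    have h1 := tendsto_measure_iInter_atTop (μ := ρ.withDensity fun x =>
      ENNReal.ofReal (4 * (Fintype.card ι * L ^ 2) * h x ^ 2 * m x))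
      (s := fun n => (compactCovering G n)ᶜ)
      (fun n => (hBm n).compl.nullMeasurableSet)
      (fun _ _ h => compl_subset_compl.2 (compactCovering_subset G h)) ⟨0, ?_⟩
    · simpa only [← compl_iUnion, iUnion_compactCovering, withDensity_apply _ (hBm _).compl,
        compl_univ, measure_empty, Function.comp_def] using h1
    · rw [withDensity_apply _ (hBm 0).compl]
      refine ne_top_of_le_ne_top ?_ (setLIntegral_le_lintegral _ _)
      have h2 : ∀ x, ENNReal.ofReal (4 * (Fintype.card ι * L ^ 2) * h x ^ 2 * m x) =
          ENNReal.ofReal (4 * (Fintype.card ι * L ^ 2)) * ENNReal.ofReal (h x ^ 2 * m x) :=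
        fun x => by rw [← ENNReal.ofReal_mul (by positivity)]; ring_nf
      simp only [h2]
      rw [lintegral_const_mul' _ _ ENNReal.ofReal_ne_top]
      exact ENNReal.mul_ne_top ENNReal.ofReal_ne_top hfin
  have hlim3 := (hlim2.const_add
    (∫⁻ x, ENNReal.ofReal (4 * (∑ j, g j x ^ 2) * m x) ∂ρ)).add_const
    (∫⁻ x in K, ENNReal.ofReal (C₁ * h x ^ 2 * m x) ∂ρ)
  rw [add_zero] at hlim3
  exact le_of_tendsto_of_tendsto' hlim1 hlim3 hstep

end Lyapunov

lemma enorm_sq_eq_ofReal (x : ℝ) : ‖x‖ₑ ^ 2 = ENNReal.ofReal (x ^ 2) := by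
  rw [Real.enorm_eq_ofReal_abs, ← ENNReal.ofReal_pow (abs_nonneg x), sq_abs]

/-! ### Comparison of `ρ` with the weighted measure on compact sets -/

section Density

variable {G : Type*} [TopologicalSpace G] [T2Space G] [LocallyCompactSpace G]
  [MeasurableSpace G] [BorelSpace G] {ρ : Measure G} {m : G → ℝ}

lemma lintegral_withDensity_ofReal (hm : Measurable m) (F : G → ℝ≥0∞) :
    ∫⁻ x, F x ∂(ρ.withDensity fun x => ENNReal.ofReal (m x)) =
      ∫⁻ x, ENNReal.ofReal (m x) * F x ∂ρ :=
  lintegral_withDensity_eq_lintegral_mul_non_measurable ρ hm.ennreal_ofReal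
    (Eventually.of_forall fun _ => ENNReal.ofReal_lt_top) F

lemma setLIntegral_withDensity_ofReal (hm : Measurable m) (F : G → ℝ≥0∞) {K : Set G}
    (hK : MeasurableSet K) :
    ∫⁻ x in K, F x ∂(ρ.withDensity fun x => ENNReal.ofReal (m x)) =
      ∫⁻ x in K, ENNReal.ofReal (m x) * F x ∂ρ :=
  setLIntegral_withDensity_eq_setLIntegral_mul_non_measurable ρ hm.ennreal_ofReal F hK
    (Eventually.of_forall fun _ => ENNReal.ofReal_lt_top)

lemma exists_setLIntegral_withDensity_le (hm : Continuous m) {K : Set G} (hK : IsCompact K) :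
    ∃ C : ℝ≥0∞, C ≠ ⊤ ∧ ∀ F : G → ℝ≥0∞,
      ∫⁻ x in K, F x ∂(ρ.withDensity fun x => ENNReal.ofReal (m x)) ≤ C * ∫⁻ x in K, F x ∂ρ := by
  obtain ⟨C, hC⟩ := hK.exists_bound_of_continuousOn hm.continuousOn
  refine ⟨ENNReal.ofReal C, ENNReal.ofReal_ne_top, fun F => ?_⟩
  rw [setLIntegral_withDensity_ofReal hm.measurable F hK.measurableSet,
    ← lintegral_const_mul' _ _ ENNReal.ofReal_ne_top]
  refine setLIntegral_mono' hK.measurableSet fun x hx => ?_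
  gcongr
  exact (le_abs_self _).trans (hC x hx)

lemma exists_setLIntegral_le_withDensity (hm : Continuous m) (hm0 : ∀ x, 0 < m x) {K : Set G}
    (hK : IsCompact K) :
    ∃ C : ℝ≥0∞, C ≠ ⊤ ∧ ∀ F : G → ℝ≥0∞,
      ∫⁻ x in K, F x ∂ρ ≤ C * ∫⁻ x in K, F x ∂(ρ.withDensity fun x => ENNReal.ofReal (m x)) := by
  obtain ⟨C, hC⟩ := hK.exists_bound_of_continuousOn
    (hm.inv₀ fun x => (hm0 x).ne').continuousOn
  refine ⟨ENNReal.ofReal C, ENNReal.ofReal_ne_top, fun F => ?_⟩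
  rw [setLIntegral_withDensity_ofReal hm.measurable F hK.measurableSet,
    ← lintegral_const_mul' _ _ ENNReal.ofReal_ne_top]
  refine setLIntegral_mono' hK.measurableSet fun x hx => ?_
  have h1 : (m x)⁻¹ ≤ C := (le_abs_self _).trans (hC x hx)
  have h2 : 1 ≤ ENNReal.ofReal C * ENNReal.ofReal (m x) := by
    rw [← ENNReal.ofReal_mul ((inv_pos.2 (hm0 x)).le.trans h1), ENNReal.one_le_ofReal]
    have := mul_le_mul_of_nonneg_right h1 (hm0 x).le
    rwa [inv_mul_cancel₀ (hm0 x).ne'] at this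
  rw [← mul_assoc]
  exact le_mul_of_one_le_left' h2

lemma locallyIntegrable_sq_of_withDensity (hm : Continuous m) (hm0 : ∀ x, 0 < m x) {h : G → ℝ}
    (hh : Measurable h)
    (hfin : ∫⁻ x, ‖h x‖ₑ ^ 2 ∂(ρ.withDensity fun x => ENNReal.ofReal (m x)) ≠ ⊤) :
    LocallyIntegrable (fun x => h x ^ 2) ρ := by
  refine locallyIntegrable_iff.2 fun K hK => ⟨(hh.pow_const 2).aestronglyMeasurable, ?_⟩
  obtain ⟨C, hC, hle⟩ := exists_setLIntegral_le_withDensity (ρ := ρ) hm hm0 hK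
  simp only [hasFiniteIntegral_iff_enorm, enorm_pow]
  refine (hle _).trans_lt (ENNReal.mul_lt_top hC.lt_top ?_)
  exact (setLIntegral_le_lintegral _ _).trans_lt hfin.lt_top

end Density

/-! ### The weighted estimate on the group -/

section Weighted

variable {E : Type*} [NormedAddCommGroup E] [NormedSpace ℝ E] [CompleteSpace E]
  [FiniteDimensional ℝ E]
  {G : Type*} [TopologicalSpace G] [ChartedSpace E G] [Group G] [LieGroup 𝓘(ℝ, E) ∞ G] [T2Space G]
  [IsTopologicalGroup G] [LocallyCompactSpace G] [SecondCountableTopology G]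
  [MeasurableSpace G] [BorelSpace G]
  {ρ : Measure G} [IsFiniteMeasureOnCompacts ρ] [ρ.IsMulRightInvariant] [ρ.IsOpenPosMeasure]
  {ℓ : ℕ} {X : Fin ℓ → GroupLieAlgebra 𝓘(ℝ, E) G} {χ : G →* ℝ} {v : G → ℝ}

lemma contMDiff_lieDeriv {Z : GroupLieAlgebra 𝓘(ℝ, E) G} {u : G → ℝ}
    (hu : ContMDiff 𝓘(ℝ, E) 𝓘(ℝ, ℝ) 2 u) : ContMDiff 𝓘(ℝ, E) 𝓘(ℝ, ℝ) 1 (lieDeriv Z u) := by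
  have h1 := contMDiff_mulInvariantVectorField_one Z
  have h2 := hu.contMDiff_tangentMap (m := 1) (by norm_num)
  have h3 := (contMDiff_snd_tangentBundle_modelSpace (n := 1) ℝ 𝓘(ℝ, ℝ)).comp (h2.comp h1)
  exact h3

lemma continuous_horGrad (X : Fin ℓ → GroupLieAlgebra 𝓘(ℝ, E) G)
    (hv : ContMDiff 𝓘(ℝ, E) 𝓘(ℝ, ℝ) 1 v) : Continuous (horGrad X v) := by
  have := fun j => continuous_lieDeriv (Z := X j) hv
  unfold horGrad
  fun_prop

lemma norm_horGrad_sq (X : Fin ℓ → GroupLieAlgebra 𝓘(ℝ, E) G) (u : G → ℝ) (x : G) :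
    ‖horGrad X u x‖ ^ 2 = ∑ j, lieDeriv (X j) u x ^ 2 := by
  rw [EuclideanSpace.real_norm_sq_eq]; rfl

lemma hasDerivAt_weight (hX : HormanderCondition X) (hχ : Continuous χ) (hpos : ∀ x, 0 < χ x)
    (hv : ContMDiff 𝓘(ℝ, E) 𝓘(ℝ, ℝ) 2 v) (Z : GroupLieAlgebra 𝓘(ℝ, E) G) (x : G) :
    HasDerivAt (fun t => χ (x * oneParam Z t) * Real.exp (-v (x * oneParam Z t)))
      (χ x * Real.exp (-v x) * (lieDeriv Z χ 1 - lieDeriv Z v x)) 0 := by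
  have h1 := hasDerivAt_character X hX hχ hpos Z x
  have h2 := (hasDerivAt_comp_mul_oneParam_zero Z (hv.mdifferentiable (by simp) x)).neg.exp
  refine (h1.mul h2).congr_deriv ?_
  simp only [oneParam_zero, mul_one, Pi.neg_apply]
  ring

/-- The measure with density `χ e⁻ᵛ`. -/
noncomputable def weightedMeasure (ρ : Measure G) (χ v : G → ℝ) : Measure G :=
  ρ.withDensity fun x => ENNReal.ofReal (χ x * Real.exp (-v x))

/-- Outside a compact set, the weighted norm is controlled by the horizontal gradient. -/
theorem exists_lyapunov_bound (hX : HormanderCondition X) (hχ : Continuous χ)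
    (hpos : ∀ x, 0 < χ x) (hv : ContMDiff 𝓘(ℝ, E) 𝓘(ℝ, ℝ) 2 v) {c R ε : ℝ} (hc : 0 < c)
    (hε : 0 < ε) (hcond : ∀ x, x ∉ ccBall X R →
      c ≤ (1 - ε) / 2 * ‖horGrad X v x‖ ^ 2 + subLaplacian X χ v x) :
    ∃ K : Set G, IsCompact K ∧ ∃ C : ℝ≥0∞, C ≠ ⊤ ∧ ∀ h g, FlowGrad X ρ h g →
      ∫⁻ x, ‖h x‖ₑ ^ 2 ∂(weightedMeasure ρ χ v) ≠ ⊤ →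
      ∫⁻ x, ∑ j, ‖g j x‖ₑ ^ 2 ∂(weightedMeasure ρ χ v) ≠ ⊤ →
      ∫⁻ x, ‖h x * (1 + ‖horGrad X v x‖)‖ₑ ^ 2 ∂(weightedMeasure ρ χ v) ≤
        C * (∫⁻ x, ∑ j, ‖g j x‖ₑ ^ 2 ∂(weightedMeasure ρ χ v) +
          ∫⁻ x in K, ‖h x‖ₑ ^ 2 ∂(weightedMeasure ρ χ v)) := by
  set m : G → ℝ := fun x => χ x * Real.exp (-v x) with hm_def
  have hm : Continuous m := hχ.mul (Real.continuous_exp.comp hv.continuous.neg)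
  have hm0 : ∀ x, 0 < m x := fun x => mul_pos (hpos x) (Real.exp_pos _)
  have hv1 : ContMDiff 𝓘(ℝ, E) 𝓘(ℝ, ℝ) 1 v := hv.of_le (by norm_num)
  have hp : ∀ j, Continuous (lieDeriv (X j) v) := fun j => continuous_lieDeriv hv1
  have hq : ∀ j, Continuous (lieDeriv (X j) (lieDeriv (X j) v)) := fun j =>
    continuous_lieDeriv (contMDiff_lieDeriv hv)
  obtain ⟨K, hK, hKR⟩ := exists_isCompact_ccBall_subset X R
  obtain ⟨k, hk, hks, hk1, hk0⟩ := exists_bump_one (E := E) (G := G)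
  obtain ⟨L, hcut⟩ := exists_cutoff (ρ := ρ) (fun j => isOneParam_oneParam (X j)) hk.continuous hks
    hk0 (by simp [hk1]) fun j => testPair_lieDeriv (X j) (hk.of_le (by simp)) hks
  set W : G → ℝ := fun x => (1 - ε) / 2 * ∑ j, lieDeriv (X j) v x ^ 2 -
    ∑ j, (lieDeriv (X j) (lieDeriv (X j) v) x + lieDeriv (X j) χ 1 * lieDeriv (X j) v x) with hW
  have hWc : Continuous W := by fun_prop
  obtain ⟨C₀, hC₀⟩ := hK.exists_bound_of_continuousOn hWc.continuousOn
  -- On `K`, where nothing is assumed, `W ≥ -|C₀|` by compactness, so adding `c + |C₀|` restores the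
  -- bound.
  have hWle : ∀ x, c ≤ W x + K.indicator (fun _ => c + |C₀|) x := by
    intro x
    by_cases hx : x ∈ K
    · rw [indicator_of_mem hx]
      have h1 := neg_le_of_abs_le (hC₀ x hx)
      have h2 := le_abs_self C₀
      linarith
    · rw [indicator_of_notMem hx, add_zero]
      have := hcond x fun h => hx (hKR h)
      rw [norm_horGrad_sq, subLaplacian, ← sub_eq_add_neg] at this
      exact this
  -- With this `δ`, `c + (ε/2) s² ≥ δ (1 + s²) ≥ (δ/2) (1 + s)²`, whence the factor `2 δ⁻¹`.
  set δ := min c (ε / 2) with hδ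
  have hδ0 : 0 < δ := lt_min hc (by positivity)
  -- A common bound for the constant `4` of the gradient term and the constant `c + |C₀|` of the
  -- term on `K`.
  set C₁ := 4 + (c + |C₀|) with hC₁
  have hC₁0 : 0 < C₁ := by positivity
  refine ⟨K, hK, ENNReal.ofReal (2 * δ⁻¹ * C₁), ENNReal.ofReal_ne_top, fun h g hhg hh2 hg2 => ?_⟩
  have hgj : ∀ j, ∫⁻ x, ‖g j x‖ₑ ^ 2 ∂(weightedMeasure ρ χ v) ≠ ⊤ := fun j =>
    ne_top_of_le_ne_top hg2 (lintegral_mono fun x =>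
      Finset.single_le_sum (f := fun j => ‖g j x‖ₑ ^ 2) (fun _ _ => zero_le) (Finset.mem_univ j))
  have hfin : ∫⁻ x, ENNReal.ofReal (h x ^ 2 * m x) ∂ρ ≠ ⊤ := by
    rw [weightedMeasure, lintegral_withDensity_ofReal hm.measurable] at hh2
    convert hh2 using 4 with x
    rw [enorm_sq_eq_ofReal, ← ENNReal.ofReal_mul (hm0 x).le, mul_comm]
  have key := lintegral_le_of_lyapunov_of_cutoff (fun j => isOneParam_oneParam (X j))
    hhg.measurable hhg.measurable_grad hhg.flowDeriv
    (locallyIntegrable_sq_of_withDensity hm hm0 hhg.measurable hh2)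
    (fun j => locallyIntegrable_sq_of_withDensity hm hm0 (hhg.measurable_grad j) (hgj j))
    hm hm0 hp hq (fun j x => hasDerivAt_weight hX hχ hpos hv (X j) x)
    (fun j x => hasDerivAt_comp_mul_oneParam_zero (X j)
      ((contMDiff_lieDeriv hv).mdifferentiable (by simp) x))
    hc.le (by positivity : 0 ≤ c + |C₀|) hε.le hK.measurableSet hWle hcut hfin
  rw [weightedMeasure, lintegral_withDensity_ofReal hm.measurable,
    lintegral_withDensity_ofReal hm.measurable,
    setLIntegral_withDensity_ofReal hm.measurable _ hK.measurableSet]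
  calc ∫⁻ x, ENNReal.ofReal (m x) * ‖h x * (1 + ‖horGrad X v x‖)‖ₑ ^ 2 ∂ρ
      ≤ ∫⁻ x, ENNReal.ofReal (2 * δ⁻¹) * ENNReal.ofReal
          (h x ^ 2 * (c + ε / 2 * ∑ j, lieDeriv (X j) v x ^ 2) * m x) ∂ρ := by
        refine lintegral_mono fun x => ?_
        rw [enorm_sq_eq_ofReal, ← ENNReal.ofReal_mul (hm0 x).le,
          ← ENNReal.ofReal_mul (by positivity), ← norm_horGrad_sq]
        refine ENNReal.ofReal_le_ofReal ?_
        have h1 : (1 + ‖horGrad X v x‖) ^ 2 ≤ 2 * (1 + ‖horGrad X v x‖ ^ 2) := by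
          nlinarith [sq_nonneg (1 - ‖horGrad X v x‖)]
        have h2 : δ * (1 + ‖horGrad X v x‖ ^ 2) ≤ c + ε / 2 * ‖horGrad X v x‖ ^ 2 := by
          nlinarith [min_le_left c (ε / 2), min_le_right c (ε / 2), sq_nonneg ‖horGrad X v x‖]
        have h3 : 2 * (1 + ‖horGrad X v x‖ ^ 2) ≤
            2 * δ⁻¹ * (c + ε / 2 * ‖horGrad X v x‖ ^ 2) := by
          rw [mul_assoc, ← inv_mul_cancel_left₀ hδ0.ne' (1 + ‖horGrad X v x‖ ^ 2)]
          gcongr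
        have h4 := mul_le_mul_of_nonneg_left (h1.trans h3)
          (mul_nonneg (hm0 x).le (sq_nonneg (h x)))
        calc _ = m x * h x ^ 2 * (1 + ‖horGrad X v x‖) ^ 2 := by ring
          _ ≤ _ := h4
          _ = _ := by ring
    _ ≤ ENNReal.ofReal (2 * δ⁻¹) *
          (∫⁻ x, ENNReal.ofReal (4 * (∑ j, g j x ^ 2) * m x) ∂ρ +
            ∫⁻ x in K, ENNReal.ofReal ((c + |C₀|) * h x ^ 2 * m x) ∂ρ) := by
        rw [lintegral_const_mul' _ _ ENNReal.ofReal_ne_top]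
        gcongr
    _ ≤ ENNReal.ofReal (2 * δ⁻¹) *
          (ENNReal.ofReal C₁ * ∫⁻ x, ENNReal.ofReal (m x) * ∑ j, ‖g j x‖ₑ ^ 2 ∂ρ +
            ENNReal.ofReal C₁ * ∫⁻ x in K, ENNReal.ofReal (m x) * ‖h x‖ₑ ^ 2 ∂ρ) := by
        rw [← lintegral_const_mul' _ _ ENNReal.ofReal_ne_top,
          ← lintegral_const_mul' _ _ ENNReal.ofReal_ne_top]
        gcongr with x x
        · simp only [enorm_sq_eq_ofReal]
          rw [← ENNReal.ofReal_sum_of_nonneg (fun j _ => sq_nonneg _),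
            ← ENNReal.ofReal_mul (hm0 x).le, ← ENNReal.ofReal_mul hC₁0.le]
          refine ENNReal.ofReal_le_ofReal ?_
          have h1 : 0 ≤ (∑ j, g j x ^ 2) * m x :=
            mul_nonneg (Finset.sum_nonneg fun j _ => sq_nonneg _) (hm0 x).le
          nlinarith [mul_nonneg (by positivity : 0 ≤ c + |C₀|) h1]
        · rw [enorm_sq_eq_ofReal, ← ENNReal.ofReal_mul (hm0 x).le, ← ENNReal.ofReal_mul hC₁0.le]
          refine ENNReal.ofReal_le_ofReal ?_
          nlinarith [mul_nonneg (sq_nonneg (h x)) (hm0 x).le]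
    _ = _ := by rw [← mul_add, ← mul_assoc, ← ENNReal.ofReal_mul (by positivity)]

end Weighted

/-! ### Replacing a constant by the mean -/

section Average

variable {α : Type*} [MeasurableSpace α] {μ : Measure α}

lemma eLpNorm_two_sq {F : Type*} [NormedAddCommGroup F] (f : α → F) :
    eLpNorm f 2 μ ^ 2 = ∫⁻ x, ‖f x‖ₑ ^ 2 ∂μ := by
  have := eLpNorm_nnreal_pow_eq_lintegral (μ := μ) (f := f) (p := 2) (by norm_num)
  simpa using this

/-- In a weighted `L²` estimate a constant may be replaced by the average. -/
lemma eLpNorm_sub_average_mul_le [IsFiniteMeasure μ] {f w : α → ℝ} (hf : MemLp f 2 μ)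
    (hw : AEStronglyMeasurable w μ) (hw1 : ∀ x, 1 ≤ w x) (a : ℝ) :
    eLpNorm (fun x => |f x - ⨍ y, f y ∂μ| * w x) 2 μ ≤
      (1 + (μ univ)⁻¹ * μ univ ^ (1 / 2 : ℝ) * eLpNorm w 2 μ) *
        eLpNorm (fun x => (f x - a) * w x) 2 μ := by
  rcases eq_or_ne μ 0 with rfl | hμ
  · simp
  have hμ0 : μ univ ≠ 0 := by simpa using hμ
  set b := ⨍ y, f y ∂μ with hb
  have hfa : AEStronglyMeasurable (fun x => f x - a) μ := hf.1.sub aestronglyMeasurable_const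
  have h1 : eLpNorm (fun x => f x - a) 2 μ ≤ eLpNorm (fun x => (f x - a) * w x) 2 μ := by
    refine eLpNorm_mono fun x => ?_
    rw [norm_mul]
    exact le_mul_of_one_le_right (norm_nonneg _) ((hw1 x).trans (le_abs_self _))
  -- The mean `b` differs from `a` by the mean of `f - a`, which Hölder's inequality bounds by its
  -- `L²` norm.
  have h2 : ‖a - b‖ₑ ≤ (μ univ)⁻¹ * μ univ ^ (1 / 2 : ℝ) * eLpNorm (fun x => f x - a) 2 μ := by
    have hint : Integrable f μ := hf.integrable one_le_two
    have e1 : b - a = (μ.real univ)⁻¹ * ∫ x, (f x - a) ∂μ := by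
      have hne : μ.real univ ≠ 0 := (ENNReal.toReal_pos hμ0 (measure_ne_top _ _)).ne'
      rw [integral_sub hint (integrable_const a), hb, average_eq, integral_const, smul_eq_mul,
        smul_eq_mul, mul_sub, inv_mul_cancel_left₀ hne]
    have e2 : ‖(μ.real univ)⁻¹‖ₑ = (μ univ)⁻¹ := by
      rw [Real.enorm_eq_ofReal (by positivity), Measure.real, ← ENNReal.toReal_inv,
        ENNReal.ofReal_toReal (ENNReal.inv_ne_top.2 hμ0)]
    rw [← enorm_neg, neg_sub, e1, enorm_mul, e2, mul_assoc]
    gcongr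
    calc ‖∫ x, (f x - a) ∂μ‖ₑ ≤ ∫⁻ x, ‖f x - a‖ₑ ∂μ := enorm_integral_le_lintegral_enorm _
      _ = eLpNorm (fun x => f x - a) 1 μ := eLpNorm_one_eq_lintegral_enorm.symm
      _ ≤ _ := by
        refine (eLpNorm_le_eLpNorm_mul_rpow_measure_univ one_le_two hfa).trans ?_
        rw [mul_comm]
        norm_num
  calc eLpNorm (fun x => |f x - b| * w x) 2 μ
      = eLpNorm ((fun x => (f x - a) * w x) + (a - b) • w) 2 μ := by
        refine eLpNorm_congr_norm_ae (Eventually.of_forall fun x => ?_)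
        simp only [Pi.add_apply, Pi.smul_apply, smul_eq_mul, ← add_mul, sub_add_sub_cancel, norm_mul,
          norm_abs_eq_norm, Real.norm_eq_abs]
    _ ≤ eLpNorm (fun x => (f x - a) * w x) 2 μ + eLpNorm ((a - b) • w) 2 μ :=
        eLpNorm_add_le (hfa.mul hw) (hw.const_smul _) one_le_two
    _ = eLpNorm (fun x => (f x - a) * w x) 2 μ + ‖a - b‖ₑ * eLpNorm w 2 μ := by
        rw [eLpNorm_const_smul]
    _ ≤ eLpNorm (fun x => (f x - a) * w x) 2 μ + (μ univ)⁻¹ * μ univ ^ (1 / 2 : ℝ) *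
          eLpNorm (fun x => (f x - a) * w x) 2 μ * eLpNorm w 2 μ := by
        gcongr
        exact h2.trans (by gcongr)
    _ = _ := by ring

end Average

/-! ### The global Poincaré inequality -/

section Poincare

variable {E : Type*} [NormedAddCommGroup E] [NormedSpace ℝ E] [CompleteSpace E]
  [FiniteDimensional ℝ E]
  {G : Type*} [TopologicalSpace G] [ChartedSpace E G] [Group G] [LieGroup 𝓘(ℝ, E) ∞ G] [T2Space G]
  [IsTopologicalGroup G] [LocallyCompactSpace G] [SecondCountableTopology G]
  [MeasurableSpace G] [BorelSpace G]
  {ρ : Measure G} [IsFiniteMeasureOnCompacts ρ] [ρ.IsMulRightInvariant] [ρ.IsOpenPosMeasure]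
  {ℓ : ℕ} {X : Fin ℓ → GroupLieAlgebra 𝓘(ℝ, E) G} {χ : G →* ℝ} {v : G → ℝ}

lemma FlowGrad.sub_const {f : G → ℝ} {g : Fin ℓ → G → ℝ} (h : FlowGrad X ρ f g) (a : ℝ) :
    FlowGrad X ρ (fun x => f x - a) g :=
  ⟨h.measurable.sub_const a, h.measurable_grad, fun j => (h.flowDeriv j).sub_const a⟩

/-- The weighted estimate for `h = 1` with zero gradient bounds the weight by a multiple of `μ(K)`,
which is finite. -/
lemma lintegral_weight_ne_top (hX : HormanderCondition X) (hχ : Continuous χ)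
    (hpos : ∀ x, 0 < χ x) (hv : ContMDiff 𝓘(ℝ, E) 𝓘(ℝ, ℝ) 2 v)
    [IsFiniteMeasure (weightedMeasure ρ χ v)] {c R ε : ℝ} (hc : 0 < c)
    (hε : 0 < ε) (hcond : ∀ x, x ∉ ccBall X R →
      c ≤ (1 - ε) / 2 * ‖horGrad X v x‖ ^ 2 + subLaplacian X χ v x) :
    ∫⁻ x, ‖1 + ‖horGrad X v x‖‖ₑ ^ 2 ∂(weightedMeasure ρ χ v) ≠ ⊤ := by
  obtain ⟨K, -, C, hC, h⟩ := exists_lyapunov_bound (ρ := ρ) hX hχ hpos hv hc hε hcond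
  have h1 := h (fun _ => 1) (fun _ _ => 0)
    ⟨measurable_const, fun _ => measurable_const, fun j t => Eventually.of_forall fun x => by simp⟩
  simp only [enorm_one, one_pow, lintegral_const, one_mul, enorm_zero, ne_eq, OfNat.ofNat_ne_zero,
    not_false_eq_true, zero_pow, Finset.sum_const_zero, zero_mul, zero_add] at h1
  refine ne_top_of_le_ne_top (ENNReal.mul_ne_top hC ?_) (h1 (measure_ne_top _ _) (by simp))
  exact measure_ne_top _ _

/-- Apply the weighted estimate to `f - a`, where `a` comes from the local inequality on its
exceptional compact set. On compact sets `ρ` and the weighted measure are comparable, the density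
being continuous and positive. -/
theorem exists_weighted_poincare [ConnectedSpace G] (hX : HormanderCondition X) (hχ : Continuous χ)
    (hpos : ∀ x, 0 < χ x) (hv : ContMDiff 𝓘(ℝ, E) 𝓘(ℝ, ℝ) 2 v)
    [IsFiniteMeasure (weightedMeasure ρ χ v)] {c R ε : ℝ} (hc : 0 < c)
    (hε : 0 < ε) (hcond : ∀ x, x ∉ ccBall X R →
      c ≤ (1 - ε) / 2 * ‖horGrad X v x‖ ^ 2 + subLaplacian X χ v x) :
    ∃ C : ℝ≥0∞, C ≠ ⊤ ∧ ∀ f g, FlowGrad X ρ f g →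
      ∫⁻ x, ‖f x‖ₑ ^ 2 ∂(weightedMeasure ρ χ v) ≠ ⊤ →
      ∫⁻ x, ∑ j, ‖g j x‖ₑ ^ 2 ∂(weightedMeasure ρ χ v) ≠ ⊤ →
      ∃ a : ℝ, ∫⁻ x, ‖(f x - a) * (1 + ‖horGrad X v x‖)‖ₑ ^ 2 ∂(weightedMeasure ρ χ v) ≤
        C * ∫⁻ x, ∑ j, ‖g j x‖ₑ ^ 2 ∂(weightedMeasure ρ χ v) := by
  obtain ⟨K, hK, C, hC, hlyap⟩ := exists_lyapunov_bound (ρ := ρ) hX hχ hpos hv hc hε hcond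
  obtain ⟨K', hK', C', hC', hloc⟩ := exists_local_poincare (ρ := ρ) hX hK
  have hm : Continuous fun x => χ x * Real.exp (-v x) :=
    hχ.mul (Real.continuous_exp.comp hv.continuous.neg)
  obtain ⟨C₂, hC₂, h2⟩ := exists_setLIntegral_withDensity_le (ρ := ρ) hm hK
  obtain ⟨C₃, hC₃, h3⟩ := exists_setLIntegral_le_withDensity (ρ := ρ) hm
    (fun x => mul_pos (hpos x) (Real.exp_pos _)) hK'
  refine ⟨C * (1 + C₂ * (C' * C₃)), by finiteness, fun f g hfg hf hg => ?_⟩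
  obtain ⟨a, ha⟩ := hloc f g hfg
  refine ⟨a, ?_⟩
  have hfin : ∫⁻ x, ‖f x - a‖ₑ ^ 2 ∂(weightedMeasure ρ χ v) ≠ ⊤ := by
    refine ne_top_of_le_ne_top (b := 2 * ∫⁻ x, ‖f x‖ₑ ^ 2 ∂(weightedMeasure ρ χ v) +
      2 * ‖-a‖ₑ ^ 2 * weightedMeasure ρ χ v univ) (by finiteness) ?_
    rw [← lintegral_const, ← lintegral_const_mul' _ _ (by simp),
      ← lintegral_add_right _ measurable_const]
    exact lintegral_mono fun x => by rw [sub_eq_add_neg]; exact enorm_add_sq_le _ _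
  refine (hlyap _ g (hfg.sub_const a) hfin hg).trans ?_
  rw [mul_assoc, add_mul, one_mul]
  gcongr
  calc ∫⁻ x in K, ‖f x - a‖ₑ ^ 2 ∂(weightedMeasure ρ χ v)
      ≤ C₂ * ∫⁻ x in K, ‖f x - a‖ₑ ^ 2 ∂ρ := h2 _
    _ ≤ C₂ * (C' * (C₃ * ∫⁻ x in K', ∑ j, ‖g j x‖ₑ ^ 2 ∂(weightedMeasure ρ χ v))) := by
        gcongr; exact ha.trans (by gcongr; exact h3 _)
    _ ≤ C₂ * (C' * (C₃ * ∫⁻ x, ∑ j, ‖g j x‖ₑ ^ 2 ∂(weightedMeasure ρ χ v))) := by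
        gcongr; exact Measure.restrict_le_self
    _ = _ := by ring

/-- Measurable representatives are chosen because the Fubini arguments along orbits need joint
measurability of `(x, t) ↦ f(x θ t)`. -/
lemma IsWeakHorGrad.exists_flowGrad {f : G → ℝ} {g : G → EuclideanSpace ℝ (Fin ℓ)}
    (h : IsWeakHorGrad X ρ f g) : ∃ (f₀ : G → ℝ) (g₀ : G → EuclideanSpace ℝ (Fin ℓ)),
      f =ᵐ[ρ] f₀ ∧ g =ᵐ[ρ] g₀ ∧ FlowGrad X ρ f₀ fun j x => g₀ x j := by
  have hf := h.locallyIntegrable.aestronglyMeasurable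
  have hg := h.locallyIntegrable_grad.aestronglyMeasurable
  have hgm : ∀ j, Measurable fun x => hg.mk g x j := fun j => by
    have := hg.stronglyMeasurable_mk.measurable
    fun_prop
  refine ⟨hf.mk f, hg.mk g, hf.ae_eq_mk, hg.ae_eq_mk, hf.stronglyMeasurable_mk.measurable, hgm,
    fun j => ?_⟩
  refine flowDeriv_of_weak (X j) ?_ (hgm j) ?_ fun φ hφ hc => ?_
  · exact h.locallyIntegrable.mono hf.stronglyMeasurable_mk.aestronglyMeasurable
      (hf.ae_eq_mk.mono fun x hx => by rw [hx])
  · refine h.locallyIntegrable_grad.mono (hgm j).aestronglyMeasurable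
      (hg.ae_eq_mk.mono fun x hx => ?_)
    rw [hx]
    exact PiLp.norm_apply_le _ j
  · have h1 : ∫ x, hf.mk f x * lieDeriv (X j) φ x ∂ρ = ∫ x, f x * lieDeriv (X j) φ x ∂ρ :=
      integral_congr_ae (hf.ae_eq_mk.mono fun x hx => by simp only [hx])
    have h2 : ∫ x, hg.mk g x j * φ x ∂ρ = ∫ x, g x j * φ x ∂ρ :=
      integral_congr_ae (hg.ae_eq_mk.mono fun x hx => by simp only [hx])
    rw [h1, h2, h.integral_eq φ hφ hc j]

lemma enorm_sq_eq_sum (y : EuclideanSpace ℝ (Fin ℓ)) : ‖y‖ₑ ^ 2 = ∑ j, ‖y j‖ₑ ^ 2 := by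
  have h : ‖y‖ₑ ^ 2 = ENNReal.ofReal (‖y‖ ^ 2) := by
    rw [← ofReal_norm, ENNReal.ofReal_pow (norm_nonneg _)]
  simp only [h, enorm_sq_eq_ofReal, EuclideanSpace.real_norm_sq_eq]
  exact ENNReal.ofReal_sum_of_nonneg fun j _ => sq_nonneg _

theorem exists_sobolev_poincare [ConnectedSpace G] (hX : HormanderCondition X) (hχ : Continuous χ)
    (hpos : ∀ x, 0 < χ x) (hv : ContMDiff 𝓘(ℝ, E) 𝓘(ℝ, ℝ) 2 v)
    [IsFiniteMeasure (weightedMeasure ρ χ v)] {c R ε : ℝ} (hc : 0 < c)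
    (hε : 0 < ε) (hcond : ∀ x, x ∉ ccBall X R →
      c ≤ (1 - ε) / 2 * ‖horGrad X v x‖ ^ 2 + subLaplacian X χ v x) :
    ∃ C : ℝ, 0 < C ∧ ∀ (f : G → ℝ) (g : G → EuclideanSpace ℝ (Fin ℓ)),
      MemSobolev X ρ (weightedMeasure ρ χ v) f g →
      eLpNorm (fun x => |f x - ⨍ y, f y ∂(weightedMeasure ρ χ v)| *
          (1 + ‖horGrad X v x‖)) 2 (weightedMeasure ρ χ v)
        ≤ ENNReal.ofReal C * eLpNorm (fun x => ‖g x‖) 2 (weightedMeasure ρ χ v) := by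
  obtain ⟨D, hD, hDle⟩ := exists_weighted_poincare (ρ := ρ) hX hχ hpos hv hc hε hcond
  have hw := lintegral_weight_ne_top (ρ := ρ) hX hχ hpos hv hc hε hcond
  set μ := weightedMeasure ρ χ v with hμ
  have hac : μ ≪ ρ := withDensity_absolutelyContinuous _ _
  have hwm : AEStronglyMeasurable (fun x => 1 + ‖horGrad X v x‖) μ :=
    (continuous_const.add (continuous_horGrad X (hv.of_le (by norm_num))).norm).aestronglyMeasurable
  rw [← eLpNorm_two_sq] at hw
  set A : ℝ≥0∞ := 1 + (μ univ)⁻¹ * μ univ ^ (1 / 2 : ℝ) *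
    eLpNorm (fun x => 1 + ‖horGrad X v x‖) 2 μ with hA
  rcases eq_or_ne μ 0 with h0 | h0
  · exact ⟨1, one_pos, fun f g _ => by rw [h0]; simp⟩
  have hw' : eLpNorm (fun x => 1 + ‖horGrad X v x‖) 2 μ ≠ ⊤ := fun h => hw (by rw [h]; simp)
  have hAtop : A ≠ ⊤ := by
    have h1 : μ univ ≠ 0 := by simpa using h0
    have h2 : μ univ ^ (1 / 2 : ℝ) ≠ ⊤ :=
      ENNReal.rpow_ne_top_of_nonneg (by norm_num) (measure_ne_top _ _)
    exact ENNReal.add_ne_top.2 ⟨ENNReal.one_ne_top,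
      ENNReal.mul_ne_top (ENNReal.mul_ne_top (ENNReal.inv_ne_top.2 h1) h2) hw'⟩
  have hDtop : D ^ (1 / 2 : ℝ) ≠ ⊤ := ENNReal.rpow_ne_top_of_nonneg (by norm_num) hD
  -- `D` bounds squared norms, hence its square root; `A` is the price of passing to the mean, and
  -- the added `1` only ensures positivity.
  refine ⟨(A * D ^ (1 / 2 : ℝ)).toReal + 1, by positivity, fun f g hfg => ?_⟩
  obtain ⟨f₀, g₀, hf, hg, hfg₀⟩ := hfg.isWeakHorGrad.exists_flowGrad
  have hf' : f =ᵐ[μ] f₀ := hac.ae_le hf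
  have hg' : g =ᵐ[μ] g₀ := hac.ae_le hg
  have hf₀ : MemLp f₀ 2 μ := hfg.memLp.ae_eq hf'
  have hg₀ : MemLp g₀ 2 μ := hfg.memLp_grad.ae_eq hg'
  obtain ⟨a, ha⟩ := hDle f₀ _ hfg₀ (by rw [← eLpNorm_two_sq]; exact ENNReal.pow_ne_top hf₀.2.ne) (by
    simp only [← enorm_sq_eq_sum]
    rw [← eLpNorm_two_sq]; exact ENNReal.pow_ne_top hg₀.2.ne)
  simp only [← enorm_sq_eq_sum] at ha
  rw [← eLpNorm_two_sq, ← eLpNorm_two_sq] at ha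
  have ha' : eLpNorm (fun x => (f₀ x - a) * (1 + ‖horGrad X v x‖)) 2 μ ≤
      D ^ (1 / 2 : ℝ) * eLpNorm g₀ 2 μ := by
    have h1 := ENNReal.rpow_le_rpow ha (by norm_num : (0 : ℝ) ≤ 1 / 2)
    rw [ENNReal.mul_rpow_of_nonneg _ _ (by norm_num), ← ENNReal.rpow_natCast,
      ← ENNReal.rpow_natCast, ← ENNReal.rpow_mul, ← ENNReal.rpow_mul] at h1
    norm_num at h1
    exact h1
  have e1 : ⨍ y, f y ∂μ = ⨍ y, f₀ y ∂μ := average_congr hf'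
  have e2 : eLpNorm (fun x => |f x - ⨍ y, f y ∂μ| * (1 + ‖horGrad X v x‖)) 2 μ =
      eLpNorm (fun x => |f₀ x - ⨍ y, f₀ y ∂μ| * (1 + ‖horGrad X v x‖)) 2 μ :=
    eLpNorm_congr_ae (hf'.mono fun x hx => by simp only [hx, e1])
  rw [e2, eLpNorm_norm, eLpNorm_congr_ae hg']
  calc _ ≤ A * eLpNorm (fun x => (f₀ x - a) * (1 + ‖horGrad X v x‖)) 2 μ :=
        eLpNorm_sub_average_mul_le hf₀ hwm (fun x => by simp) a
    _ ≤ A * (D ^ (1 / 2 : ℝ) * eLpNorm g₀ 2 μ) := by gcongr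
    _ = A * D ^ (1 / 2 : ℝ) * eLpNorm g₀ 2 μ := by rw [mul_assoc]
    _ ≤ _ := by
        gcongr
        rw [← ENNReal.ofReal_toReal (ENNReal.mul_ne_top hAtop hDtop)]
        exact ENNReal.ofReal_le_ofReal (by simp)

lemma muChiM_eq_weightedMeasure {M : G → ℝ} (hχ : Continuous χ) (hpos : ∀ x, 0 < χ x)
    (hM : Continuous M) (hM0 : ∀ x, 0 < M x) :
    muChiM ρ χ M = weightedMeasure ρ χ fun x => -Real.log (M x) := by
  rw [muChiM, muChi, ← withDensity_mul _ hχ.measurable.ennreal_ofReal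
    hM.measurable.ennreal_ofReal, weightedMeasure]
  congr 1
  ext x
  rw [Pi.mul_apply, neg_neg, Real.exp_log (hM0 x), ENNReal.ofReal_mul (hpos x).le]

end Poincare

end LiePoincare

theorem mainTheorem6
    {E : Type*} [NormedAddCommGroup E] [NormedSpace ℝ E] [FiniteDimensional ℝ E]
    -- a noncompact connected Lie group
    {G : Type*} [TopologicalSpace G] [ChartedSpace E G] [Group G] [LieGroup 𝓘(ℝ, E) ∞ G]
    [T2Space G] [SecondCountableTopology G] [ConnectedSpace G] [NoncompactSpace G]
    [MeasurableSpace G] [BorelSpace G]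
    -- a right Haar measure
    (ρ : Measure G) [ρ.IsMulRightInvariant] [IsFiniteMeasureOnCompacts ρ] [ρ.IsOpenPosMeasure]
    -- linearly independent left-invariant vector fields satisfying Hörmander's condition
    {ℓ : ℕ} (X : Fin ℓ → GroupLieAlgebra 𝓘(ℝ, E) G) (hX : LinearIndependent ℝ X)
    (hHor : LiePoincare.HormanderCondition X)
    -- a continuous positive character
    (χ : G →* ℝ) (hχ : Continuous χ) (hχ_pos : ∀ x, 0 < χ x)
    (M : G → ℝ) (hM : ContMDiff 𝓘(ℝ, E) 𝓘(ℝ, ℝ) 2 M) (hM_pos : ∀ x, 0 < M x)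
    (hM_int : Integrable M (LiePoincare.muChi ρ χ))
    (v : G → ℝ) (hv : v = fun x => -Real.log (M x))
    (c R ε : ℝ) (hc : 0 < c) (hR : 0 < R) (hε : ε ∈ Set.Ioo (0 : ℝ) 1)
    (hcond : ∀ x, x ∉ LiePoincare.ccBall X R →
      c ≤ (1 - ε) / 2 * ‖LiePoincare.horGrad X v x‖ ^ 2 + LiePoincare.subLaplacian X χ v x) :
    ∃ C : ℝ, 0 < C ∧ ∀ (f : G → ℝ) (g : G → EuclideanSpace ℝ (Fin ℓ)),
      LiePoincare.MemSobolev X ρ (LiePoincare.muChiM ρ χ M) f g →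
      eLpNorm (fun x => |f x - ⨍ y, f y ∂(LiePoincare.muChiM ρ χ M)| *
          (1 + ‖LiePoincare.horGrad X v x‖)) 2 (LiePoincare.muChiM ρ χ M)
        ≤ ENNReal.ofReal C * eLpNorm (fun x => ‖g x‖) 2 (LiePoincare.muChiM ρ χ M) := by
  have : CompleteSpace E := FiniteDimensional.complete ℝ E
  have : ProperSpace E := FiniteDimensional.proper ℝ E
  have : IsTopologicalGroup G := topologicalGroup_of_lieGroup (G := G) 𝓘(ℝ, E) ∞
  have : LocallyCompactSpace G := ChartedSpace.locallyCompactSpace E G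
  have hμ : LiePoincare.muChiM ρ χ M = LiePoincare.weightedMeasure ρ χ v := by
    rw [hv]
    exact LiePoincare.muChiM_eq_weightedMeasure hχ hχ_pos hM.continuous hM_pos
  have hv2 : ContMDiff 𝓘(ℝ, E) 𝓘(ℝ, ℝ) 2 v := by
    rw [hv]
    intro x
    have h1 : ContDiffAt ℝ 2 (fun y : ℝ => -Real.log y) (M x) :=
      (Real.contDiffAt_log.2 (hM_pos x).ne').neg
    exact h1.contMDiffAt.comp x (hM x)
  have : IsFiniteMeasure (LiePoincare.weightedMeasure ρ χ v) := by
    rw [← hμ]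
    exact isFiniteMeasure_withDensity_ofReal hM_int.2
  rw [hμ]
  exact LiePoincare.exists_sobolev_poincare hHor hχ hχ_pos hv2 hc hε.1 hcond
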